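/- **Setting.** Let $W_i=(Y_i,X_i,Z_i)$, $i\ge 1$, be i.i.d. with law $F_0$, where $Y_i$ is real valued and $X_i,Z_i$ take values in measurable spaces. Write $\|\cdot\|$ for the $L_2(F_0)$ norm. Let $\Gamma$ be a linear space of measurable functions $\gamma$ with $E[\gamma(X)^2]<\infty$ (for instance all of them), and let $\gamma_0\in\Gamma$ satisfy $E[Y-\gamma_0(X)\mid Z]=0$. Let $m(w,\gamma)$ be linear in $\gamma\in\Gamma$, and suppose that there is a measurable $\alpha_0$ such that, for all $\gamma\in\Gamma$, $m(W,\gamma)$ is integrable and $E[m(W,\gamma)]=E[\alpha_0(Z)\gamma(X)]$. Put $\theta_0=E[m(W,\gamma_0)]$ and $T\gamma=E[\gamma(X)\mid Z]$. For each $n$ let $b=(b_1,\dots,b_p)$ be measurable functions of $z$ and $d=(d_1,\dots,d_q)$ elements of $\Gamma$, where $p=p_n\le q=q_n$ and $q_n\ge 2$ for all large $n$. Put $G=E[d(X)b(Z)']$, $M=E[m(W,d)]$, $\psi_j(w,\rho)=m(w,d_j)-d_j(x)\,b(z)'\rho$ and $\sigma_j^2(\rho)=E[\psi_j(W,\rho)^2]$.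 For a $q\times q$ matrix $\Omega$ write $\Omega_q=\Omega/q$. **Estimators.** Let $L\ge 2$ be fixed and let $I_1,\dots,I_L$ be a (non-random) partition of $\{1,\dots,n\}$ with $|I_\ell|/n\to 1/L$ for each $\ell$. For each $\ell$ let $\hat\gamma_\ell\in\Gamma$ be a (jointly measurable) function of the observations not in $I_\ell$. Let $\lambda_n>0$. Let $\hat M_\ell$, $\hat G_\ell$, $\hat\sigma^2_{j,\ell}(\rho)$ be the averages of $m(W_i,d)$, $d(X_i)b(Z_i)'$, $\psi_j(W_i,\rho)^2$ over $i\notin I_\ell$. Let $\tilde\rho_\ell$ be a (measurable) minimizer over $\rho\in\mathbb R^p$ of $$(\hat M_\ell-\hat G_\ell\rho)'\,\Omega_q\,(\hat M_\ell-\hat G_\ell\rho)+2\lambda_n|\rho|_1$$ with $\Omega=I_q$, and let $\hat\rho_\ell$ be a (measurable) minimizer of the same objective with the diagonal weight matrix $\Omega=\mathrm{diag}(\hat\sigma^{-2}_{1,\ell}(\tilde\rho_\ell),\dots,\hat\sigma^{-2}_{q,\ell}(\tilde\rho_\ell))$. Put $\hat\alpha_\ell=b'\hat\rho_\ell$ and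 $$\hat\theta=\frac1n\sum_{\ell=1}^L\sum_{i\in I_\ell}\{m(W_i,\hat\gamma_\ell)+\hat\alpha_\ell(Z_i)[Y_i-\hat\gamma_\ell(X_i)]\},\qquad \hat V=\frac1n\sum_{\ell=1}^L\sum_{i\in I_\ell}\{m(W_i,\hat\gamma_\ell)-\hat\theta+\hat\alpha_\ell(Z_i)[Y_i-\hat\gamma_\ell(X_i)]\}^2.$$ **Assumptions.** The constants do not depend on $n$; conditions 1, 3, 4 and 5 hold for all large $n$. 1. (Boundedness) Almost surely $\max_j|b_j(Z)|\le C_b$, $\max_j|d_j(X)|\le C_d$ and $\max_j|m(W,d_j)|\le C$. 2. (Rates of moments) $\sqrt{\log q/n}\to 0$; there is a sequence $\varepsilon_n^M\to0$ with $\|\hat M-M\|_\infty=O_p(\varepsilon_n^M)$, where $\hat M=\frac1n\sum_{i=1}^n m(W_i,d)$. Put $\varepsilon_n=\max\{\sqrt{\log q/n},\,\varepsilon_n^M\}$. 3. (Sparse approximation) There are $C>1$, $\bar A<\infty$ and $\bar\rho\in\mathbb R^p$ with $\bar s=\bar s_n$ non-zero elements such that $\|\alpha_0-b'\bar\rho\|^2\le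 C\bar s\varepsilon_n^2$ and $|\bar\rho|_1\le\bar A$. 4. (Non-degenerate moments) Let $\rho_L,\rho_\star\in\mathbb R^p$ be population coefficients: with $\Omega=\mathrm{diag}(\sigma_1^{-2}(\rho_\star),\dots,\sigma_q^{-2}(\rho_\star))$, $\rho_L$ minimizes $(M-G\rho)'\Omega_q(M-G\rho)+2\varepsilon_n|\rho|_1$ over $\rho$, and $\rho_\star$ minimizes $(\rho_L-v)'G'\Omega_qG(\rho_L-v)+2\varepsilon_n\sum_{k:\bar\rho_k=0}|v_k|$ over $v$. There is $\underline\sigma^2>0$ with $\min_j\sigma_j^2(\rho_\star)\ge\underline\sigma^2$. 5. (Restricted eigenvalue) For this $\Omega$, the largest eigenvalue of $G'\Omega_qG$ is bounded uniformly in $n$, and for some $c>0$ one has $\delta'G'\Omega_qG\delta\ge c\|\delta_S\|_2^2$ for every index set $S$ with $|S|\le\bar s$ and every $\delta\neq0$ with $|\delta_{S^c}|_1\le3|\delta_S|_1$. 6. $\alpha_0(Z)$ is a.s. bounded, $E[(Y-\gamma_0(X))^2]<\infty$, $E[(Y-\gamma_0(X))^2\mid Z]$ is a.s. bounded, and $E[m(W,\gamma_0)^2]<\infty$.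 7. For each $\ell$, $\int[m(w,\hat\gamma_\ell)-m(w,\gamma_0)]^2F_0(dw)\to_p0$ and $\|\hat\gamma_\ell-\gamma_0\|\to_p0$. 8. For each $\ell$, $\|T(\hat\gamma_\ell-\gamma_0)\|=O_p(\kappa_n^\gamma)$, where $\kappa_n^\gamma\to0$. 9. With $\kappa_n^\alpha=\bar s\lambda_n$: $\sqrt n\,\kappa_n^\alpha\kappa_n^\gamma\to0$; moreover $\varepsilon_n=o(\lambda_n)$ and $\bar s^2\lambda_n=o(1)$. **Conclusion.** For $\psi_0(w)=m(w,\gamma_0)-\theta_0+\alpha_0(z)[y-\gamma_0(x)]$, the variance $V=E[\psi_0(W)^2]$ is finite, and $$\sqrt n(\hat\theta-\theta_0)\xrightarrow{d}\mathcal N(0,V),\qquad \hat V\xrightarrow{p}V .$$ -/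

import Mathlib

open MeasureTheory ProbabilityTheory Filter Topology Asymptotics
open scoped ENNReal NNReal Matrix BigOperators

noncomputable section

namespace DebiasedNPIV

/-! ### Stochastic order symbols -/

/-- `X n = O_p(r n)`, for random quantities with values in `[0, ∞]`. -/
def IsBigOP {Ω : Type*} [MeasurableSpace Ω] (P : Measure Ω) (X : ℕ → Ω → ℝ≥0∞) (r : ℕ → ℝ) :
    Prop :=
  ∀ δ : ℝ, 0 < δ → ∃ C : ℝ, 0 < C ∧
    ∀ᶠ n in atTop, P {ω | ENNReal.ofReal (C * r n) < X n ω} ≤ ENNReal.ofReal δ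

/-- `X n → 0` in probability, for random quantities with values in `[0, ∞]`. -/
def TendstoZeroInProb {Ω : Type*} [MeasurableSpace Ω] (P : Measure Ω) (X : ℕ → Ω → ℝ≥0∞) :
    Prop :=
  ∀ δ : ℝ, 0 < δ → Tendsto (fun n => P {ω | ENNReal.ofReal δ ≤ X n ω}) atTop (𝓝 0)

/-! ### Observations, the projection on the instruments, the orthogonal score -/

/-- A data observation `w = (y, x, z)`. -/
abbrev Obs (𝒳 𝒵 : Type*) := ℝ × 𝒳 × 𝒵

variable {𝒳 𝒵 : Type*}

/-- The outcome `y`. -/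
def Obs.y (w : Obs 𝒳 𝒵) : ℝ := w.1

/-- The regressors `x`. -/
def Obs.x (w : Obs 𝒳 𝒵) : 𝒳 := w.2.1

/-- The instruments `z`. -/
def Obs.z (w : Obs 𝒳 𝒵) : 𝒵 := w.2.2

/-- The σ-algebra generated by the instruments. -/
abbrev sigmaZ (𝒳 𝒵 : Type*) [MeasurableSpace 𝒵] : MeasurableSpace (Obs 𝒳 𝒵) :=
  MeasurableSpace.comap Obs.z inferInstance

/-- The mean square norm `‖γ‖ = E[γ(X)²]^{1/2}`. -/
def normX [MeasurableSpace 𝒳] [MeasurableSpace 𝒵] (F : Measure (Obs 𝒳 𝒵)) (γ : 𝒳 → ℝ) : ℝ≥0∞ :=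
  eLpNorm (fun w : Obs 𝒳 𝒵 => γ (Obs.x w)) 2 F

/-- The projected mean square norm `‖Tγ‖`, with `Tγ = E[γ(X) | Z]`. -/
def projNorm [MeasurableSpace 𝒳] [MeasurableSpace 𝒵] (F : Measure (Obs 𝒳 𝒵)) (γ : 𝒳 → ℝ) :
    ℝ≥0∞ :=
  eLpNorm (F[fun w : Obs 𝒳 𝒵 => γ (Obs.x w) | sigmaZ 𝒳 𝒵]) 2 F

/-- `m(w, γ) + α(z) (y - γ(x))`; subtracting `θ` gives the orthogonal moment function `ψ`. -/
def score {Γ : Submodule ℝ (𝒳 → ℝ)} (m : Obs 𝒳 𝒵 → Γ →ₗ[ℝ] ℝ) (γ : Γ) (α : 𝒵 → ℝ)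
    (w : Obs 𝒳 𝒵) : ℝ :=
  m w γ + α (Obs.z w) * (Obs.y w - (γ : 𝒳 → ℝ) (Obs.x w))

/-- The linear combination `b(z)'ρ`. -/
def lin {p : ℕ} (b : Fin p → 𝒵 → ℝ) (ρ : Fin p → ℝ) (z : 𝒵) : ℝ := ∑ k, b k z * ρ k

/-- The `j`-th moment function `ψ_j(w, ρ) = m(w, d_j) - d_j(x) b(z)'ρ`. -/
def psi {Γ : Submodule ℝ (𝒳 → ℝ)} {p q : ℕ} (m : Obs 𝒳 𝒵 → Γ →ₗ[ℝ] ℝ) (d : Fin q → Γ)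
    (b : Fin p → 𝒵 → ℝ) (ρ : Fin p → ℝ) (j : Fin q) (w : Obs 𝒳 𝒵) : ℝ :=
  m w (d j) - (d j : 𝒳 → ℝ) (Obs.x w) * lin b ρ (Obs.z w)

/-! ### Sample and population moments -/

section Moments

variable {Γ : Submodule ℝ (𝒳 → ℝ)} {p q : ℕ}

/-- The average of `f` over a finite sample `D`. -/
def avg {ι : Type*} [Fintype ι] (D : ι → Obs 𝒳 𝒵) (f : Obs 𝒳 𝒵 → ℝ) : ℝ :=
  (Fintype.card ι : ℝ)⁻¹ * ∑ i, f (D i)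

def Mhat {ι : Type*} [Fintype ι] (m : Obs 𝒳 𝒵 → Γ →ₗ[ℝ] ℝ) (d : Fin q → Γ)
    (D : ι → Obs 𝒳 𝒵) : Fin q → ℝ :=
  fun j => avg D (fun w => m w (d j))

def Ghat {ι : Type*} [Fintype ι] (d : Fin q → Γ) (b : Fin p → 𝒵 → ℝ)
    (D : ι → Obs 𝒳 𝒵) : Matrix (Fin q) (Fin p) ℝ :=
  Matrix.of fun j k => avg D (fun w => (d j : 𝒳 → ℝ) (Obs.x w) * b k (Obs.z w))

/-- The sample variance `σ̂_j²(ρ)` of the `j`-th moment. -/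
def sigmaHatSq {ι : Type*} [Fintype ι] (m : Obs 𝒳 𝒵 → Γ →ₗ[ℝ] ℝ) (d : Fin q → Γ)
    (b : Fin p → 𝒵 → ℝ) (D : ι → Obs 𝒳 𝒵) (ρ : Fin p → ℝ) (j : Fin q) : ℝ :=
  avg D (fun w => psi m d b ρ j w ^ 2)

/-- The diagonal weight matrix `Ω̂ = diag(σ̂_1⁻²(ρ), …, σ̂_q⁻²(ρ))`. -/
def omegaHat {ι : Type*} [Fintype ι] (m : Obs 𝒳 𝒵 → Γ →ₗ[ℝ] ℝ) (d : Fin q → Γ)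
    (b : Fin p → 𝒵 → ℝ) (D : ι → Obs 𝒳 𝒵) (ρ : Fin p → ℝ) : Matrix (Fin q) (Fin q) ℝ :=
  Matrix.diagonal fun j => (sigmaHatSq m d b D ρ j)⁻¹

variable [MeasurableSpace 𝒳] [MeasurableSpace 𝒵]

def Mpop (F : Measure (Obs 𝒳 𝒵)) (m : Obs 𝒳 𝒵 → Γ →ₗ[ℝ] ℝ) (d : Fin q → Γ) : Fin q → ℝ :=
  fun j => ∫ w, m w (d j) ∂F

def Gpop (F : Measure (Obs 𝒳 𝒵)) (d : Fin q → Γ) (b : Fin p → 𝒵 → ℝ) :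
    Matrix (Fin q) (Fin p) ℝ :=
  Matrix.of fun j k => ∫ w, (d j : 𝒳 → ℝ) (Obs.x w) * b k (Obs.z w) ∂F

/-- The population variance `σ_j²(ρ) = E[ψ_j(W, ρ)²]`. -/
def sigmaSq (F : Measure (Obs 𝒳 𝒵)) (m : Obs 𝒳 𝒵 → Γ →ₗ[ℝ] ℝ) (d : Fin q → Γ)
    (b : Fin p → 𝒵 → ℝ) (ρ : Fin p → ℝ) (j : Fin q) : ℝ :=
  ∫ w, psi m d b ρ j w ^ 2 ∂F

/-- The population diagonal weight matrix `Ω = diag(σ_1⁻²(ρ), …, σ_q⁻²(ρ))`. -/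
def omegaPop (F : Measure (Obs 𝒳 𝒵)) (m : Obs 𝒳 𝒵 → Γ →ₗ[ℝ] ℝ) (d : Fin q → Γ)
    (b : Fin p → 𝒵 → ℝ) (ρ : Fin p → ℝ) : Matrix (Fin q) (Fin q) ℝ :=
  Matrix.diagonal fun j => (sigmaSq F m d b ρ j)⁻¹

end Moments

/-! ### Penalized GMM -/

/-- `(M - Gρ)' Ω_q (M - Gρ) + 2 λ |ρ|₁` with `Ω_q = Ω / q`. -/
def pgmmObjective {p q : ℕ} (M : Fin q → ℝ) (G : Matrix (Fin q) (Fin p) ℝ)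
    (W : Matrix (Fin q) (Fin q) ℝ) (lam : ℝ) (ρ : Fin p → ℝ) : ℝ :=
  (M - G *ᵥ ρ) ⬝ᵥ (((q : ℝ)⁻¹ • W) *ᵥ (M - G *ᵥ ρ)) + 2 * lam * ∑ k, |ρ k|

/-- `ρ` is a penalized GMM solution. -/
def IsPGMM {p q : ℕ} (M : Fin q → ℝ) (G : Matrix (Fin q) (Fin p) ℝ)
    (W : Matrix (Fin q) (Fin q) ℝ) (lam : ℝ) (ρ : Fin p → ℝ) : Prop :=
  IsMinOn (pgmmObjective M G W lam) Set.univ ρ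

/-- `G' Ω_q G` with `Ω_q = Ω / q`. -/
def gram {p q : ℕ} (G : Matrix (Fin q) (Fin p) ℝ) (W : Matrix (Fin q) (Fin q) ℝ) :
    Matrix (Fin p) (Fin p) ℝ :=
  Gᵀ * ((q : ℝ)⁻¹ • W) * G

/-- The number of non-zero coordinates. -/
def numNonzero {p : ℕ} (ρ : Fin p → ℝ) : ℕ := (Finset.univ.filter fun k => ρ k ≠ 0).card

/-- `(ρ_L - v)' A (ρ_L - v) + 2 ε ∑_{k : ρ̄_k = 0} |v_k|`. -/
def sparseObjective {p : ℕ} (A : Matrix (Fin p) (Fin p) ℝ) (rhoL rhoBar : Fin p → ℝ) (ε : ℝ)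
    (v : Fin p → ℝ) : ℝ :=
  (rhoL - v) ⬝ᵥ (A *ᵥ (rhoL - v))
    + 2 * ε * ∑ k ∈ Finset.univ.filter (fun k => rhoBar k = 0), |v k|

/-- `φ²(s) ≥ c`, where `φ²(s)` is the infimum of `δ'Aδ / ‖δ_S‖²` over all index sets `S` with at
most `s` elements and all `δ ≠ 0` with `|δ_{Sᶜ}|₁ ≤ 3 |δ_S|₁` (for such `δ`, `‖δ_S‖ ≠ 0`). -/
def RestrictedEigenvalueGE {p : ℕ} (A : Matrix (Fin p) (Fin p) ℝ) (s : ℕ) (c : ℝ) : Prop :=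
  ∀ S : Finset (Fin p), S.card ≤ s → ∀ δ : Fin p → ℝ, δ ≠ 0 →
    ∑ k ∈ Sᶜ, |δ k| ≤ 3 * ∑ k ∈ S, |δ k| →
    c ≤ (δ ⬝ᵥ (A *ᵥ δ)) / ∑ k ∈ S, δ k ^ 2

/-- `ε_n = max {√(log q / n), ε_n^M}`. -/
def eps (q : ℕ → ℕ) (epsM : ℕ → ℝ) (n : ℕ) : ℝ :=
  max (Real.sqrt (Real.log (q n) / n)) (epsM n)

/-! ### Cross-fitting -/

section CrossFit

variable {n L : ℕ}

/-- The observations that are not in fold `I_ℓ = {i | fold i = ℓ}`. -/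
abbrev TrainIdx (fold : Fin n → Fin L) (ℓ : Fin L) := {i : Fin n // fold i ≠ ℓ}

def foldSize (fold : Fin n → Fin L) (ℓ : Fin L) : ℕ :=
  (Finset.univ.filter fun i => fold i = ℓ).card

/-- The training sample of fold `ℓ`: the part of the data that is not in fold `ℓ`. -/
def train (fold : Fin n → Fin L) (ℓ : Fin L) (D : Fin n → Obs 𝒳 𝒵) :
    TrainIdx fold ℓ → Obs 𝒳 𝒵 :=
  fun i => D i

/-- The first `n` observations. -/
def sample {Ω : Type*} (W : ℕ → Ω → Obs 𝒳 𝒵) (n : ℕ) (ω : Ω) : Fin n → Obs 𝒳 𝒵 :=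
  fun i => W i ω

variable {Γ : Submodule ℝ (𝒳 → ℝ)} {p : ℕ}

/-- The debiased cross-fitted estimator `θ̂`, with `α̂_ℓ = b'ρ̂_ℓ`. -/
def thetaHat (m : Obs 𝒳 𝒵 → Γ →ₗ[ℝ] ℝ) (b : Fin p → 𝒵 → ℝ) (fold : Fin n → Fin L)
    (gammaHat : (ℓ : Fin L) → (TrainIdx fold ℓ → Obs 𝒳 𝒵) → Γ)
    (rhoHat : (ℓ : Fin L) → (TrainIdx fold ℓ → Obs 𝒳 𝒵) → Fin p → ℝ)
    (D : Fin n → Obs 𝒳 𝒵) : ℝ :=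
  (n : ℝ)⁻¹ * ∑ ℓ : Fin L, ∑ i ∈ Finset.univ.filter (fun i => fold i = ℓ),
    score m (gammaHat ℓ (train fold ℓ D)) (lin b (rhoHat ℓ (train fold ℓ D))) (D i)

/-- The variance estimator `V̂`. -/
def varHat (m : Obs 𝒳 𝒵 → Γ →ₗ[ℝ] ℝ) (b : Fin p → 𝒵 → ℝ) (fold : Fin n → Fin L)
    (gammaHat : (ℓ : Fin L) → (TrainIdx fold ℓ → Obs 𝒳 𝒵) → Γ)
    (rhoHat : (ℓ : Fin L) → (TrainIdx fold ℓ → Obs 𝒳 𝒵) → Fin p → ℝ)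
    (D : Fin n → Obs 𝒳 𝒵) : ℝ :=
  (n : ℝ)⁻¹ * ∑ ℓ : Fin L, ∑ i ∈ Finset.univ.filter (fun i => fold i = ℓ),
    (score m (gammaHat ℓ (train fold ℓ D)) (lin b (rhoHat ℓ (train fold ℓ D))) (D i)
      - thetaHat m b fold gammaHat rhoHat D) ^ 2

end CrossFit

end DebiasedNPIV

end

/-!
# Asymptotic normality of the debiased estimator with penalized GMM weights

Let `h` be the difference between the score at the estimates `(γ̂, α̂)` and the score at the truth
`(γ₀, α₀)`. With `Δ = γ̂ - γ₀` and `U = Y - γ₀(X)`,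

  `h = m(W, Δ) + (α̂ - α₀)(Z) U - α̂(Z) Δ(X)`.

By cross-fitting, `γ̂` and `α̂` are fixed given the training sample. The Riesz representation and
`E[U | Z] = 0` then give `E[h] = -E[(α̂ - α₀)(Z) E[Δ(X) | Z]]`, which is at most
`‖α̂ - α₀‖ ‖TΔ‖` (`enorm_integral_score_sub_le`), and `E[h²]` is controlled by the mean square errors
of the ingredients (`lintegral_score_sub_sq_le`). Training sample and held-out fold have a product
law (`measurePreserving_train_prod`). Hence Chebyshev's inequality, conditionally on the training
sample, shows that `n^{-1/2} ∑ h(W_i) → 0` in probability as soon as `E[h²] → 0` and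
`√n E[h] → 0` (`withHighProb_abs_sum_lt`). The central limit theorem with Slutsky's lemma gives the
limit of `θ̂`; the law of large numbers gives that of `V̂`, because errors that are small in mean
square do not change the empirical variance in the limit (`limit_of_scoreError`).

What remains is the rate `‖α̂ - α₀‖ = O_p(s λ)`. The functions `b_k` are bounded, so it is enough to
prove `|ρ̂ - ρ̄|₁ = O_p(s λ)`, and this is a Lasso argument for the coefficients
(`exists_l1_bound`):

* By the Riesz representation each entry of `M - G ρ̄` is the covariance of a bounded function with
  `α₀ - b'ρ̄`, so the weighted mean square of this vector is `O(s ε²)` (`wsq_Mpop_sub_le`). Its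
  supremum norm need not be `o(λ)`, which is why it enters the basic inequality through the
  quadratic form, while the sampling errors enter through the supremum norm
  (`sum_abs_pgmm_sub_le`).
* The population coefficients satisfy `|ρ_⋆ - ρ̄|₁ = O(s ε)` (`sum_abs_rhoStar_sub_le`). Since
  `σ_j²(ρ_⋆)` is bounded away from zero, the restricted eigenvalue condition passes from the weights
  `σ_j⁻²(ρ_⋆)` to identity weights (`Compatible.one`), which gives the rate of the first step `ρ̃`.
* Consequently `|ρ̃ - ρ_⋆|₁ → 0`, the estimated variances `σ̂_j²(ρ̃)` are bounded and bounded away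
  from zero, and the same argument applies to the second step `ρ̂`.

The sample moments are within `η λ` of the population moments with probability tending to one, for
every fixed `η > 0`: the moment functions are bounded, so Hoeffding's inequality and a union bound
over at most `q²` functions apply, and `√(log q / n) ≤ ε = o(λ)`
(`withHighProb_forall_abs_avg_sub_le`).
-/

namespace DebiasedNPIV

/-! ### Diagonally weighted quadratic forms -/

/-- The diagonally weighted mean square `q⁻¹ ∑ⱼ wⱼ vⱼ²`, which is `v' Ω_q v` for
`Ω = diag(w)`. -/
noncomputable def wsq {q : ℕ} (w v : Fin q → ℝ) : ℝ := (q : ℝ)⁻¹ * ∑ j, w j * v j ^ 2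

section Wsq

variable {q : ℕ}

lemma dotProduct_diagonal_mulVec (w v : Fin q → ℝ) :
    v ⬝ᵥ (((q : ℝ)⁻¹ • Matrix.diagonal w) *ᵥ v) = wsq w v := by
  simp only [wsq, dotProduct, Matrix.smul_mulVec, Matrix.mulVec_diagonal, Pi.smul_apply,
    smul_eq_mul, Finset.mul_sum]
  exact Finset.sum_congr rfl fun j _ => by ring

lemma wsq_nonneg {w : Fin q → ℝ} (hw : ∀ j, 0 ≤ w j) (v : Fin q → ℝ) : 0 ≤ wsq w v :=
  mul_nonneg (by positivity) (Finset.sum_nonneg fun j _ => mul_nonneg (hw j) (sq_nonneg _))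

/-- Pointwise comparison of the summands of two weighted mean squares. -/
lemma wsq_le_of_forall {w w' v v' : Fin q → ℝ} {c c' : ℝ}
    (h : ∀ j, c * (w j * v j ^ 2) ≤ c' * (w' j * v' j ^ 2)) : c * wsq w v ≤ c' * wsq w' v' := by
  have : (q : ℝ)⁻¹ * ∑ j, c * (w j * v j ^ 2) ≤ (q : ℝ)⁻¹ * ∑ j, c' * (w' j * v' j ^ 2) :=
    mul_le_mul_of_nonneg_left (Finset.sum_le_sum fun j _ => h j) (by positivity)
  rw [← Finset.mul_sum, ← Finset.mul_sum] at this
  unfold wsq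
  linarith

lemma wsq_le_of_abs_le {w v : Fin q → ℝ} {wh B : ℝ} (hwh : ∀ j, w j ≤ wh)
    (hwh0 : 0 ≤ wh) (hv : ∀ j, |v j| ≤ B) : wsq w v ≤ wh * B ^ 2 := by
  have h1 : ∑ j, w j * v j ^ 2 ≤ ∑ _j : Fin q, wh * B ^ 2 := by
    refine Finset.sum_le_sum fun j _ => ?_
    have : v j ^ 2 ≤ B ^ 2 := sq_le_sq' (by linarith [(abs_le.1 (hv j)).1]) (abs_le.1 (hv j)).2
    exact mul_le_mul (hwh j) this (sq_nonneg _) hwh0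
  calc wsq w v ≤ (q : ℝ)⁻¹ * ∑ _j : Fin q, wh * B ^ 2 :=
        mul_le_mul_of_nonneg_left h1 (by positivity)
    _ = ((q : ℝ)⁻¹ * q) * (wh * B ^ 2) := by simp; ring
    _ ≤ 1 * (wh * B ^ 2) :=
        mul_le_mul_of_nonneg_right (inv_mul_le_one) (mul_nonneg hwh0 (sq_nonneg B))
    _ = wh * B ^ 2 := one_mul _

lemma wsq_add_le {w : Fin q → ℝ} (hw : ∀ j, 0 ≤ w j) (u v : Fin q → ℝ) :
    wsq w (u + v) ≤ 2 * wsq w u + 2 * wsq w v := by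
  have : ∑ j, w j * (u + v) j ^ 2 ≤ 2 * ∑ j, w j * u j ^ 2 + 2 * ∑ j, w j * v j ^ 2 := by
    rw [Finset.mul_sum, Finset.mul_sum, ← Finset.sum_add_distrib]
    refine Finset.sum_le_sum fun j _ => ?_
    simp only [Pi.add_apply]
    nlinarith [mul_nonneg (hw j) (sq_nonneg (u j - v j))]
  have h := mul_le_mul_of_nonneg_left this (show (0 : ℝ) ≤ (q : ℝ)⁻¹ by positivity)
  unfold wsq
  linarith

lemma wsq_neg (w v : Fin q → ℝ) : wsq w (-v) = wsq w v := by simp [wsq]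

/-- The basic expansion behind the sample inequality: the error `u + t` of the moments is split into
a part `u` that is small in the supremum norm, and a part `t` that is small in mean square. -/
lemma half_wsq_le {w : Fin q → ℝ} {wh a y : ℝ} (hw : ∀ j, 0 ≤ w j) (hwh : ∀ j, w j ≤ wh)
    (hwh0 : 0 ≤ wh) (ha : 0 ≤ a) (hy : 0 ≤ y) (u t v : Fin q → ℝ) (hu : ∀ j, |u j| ≤ a)
    (hv : ∀ j, |v j| ≤ y) :
    wsq w v / 2 ≤ wsq w (u + t - v) - wsq w (u + t) + 2 * (wh * a * y) + 2 * wsq w t := by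
  have hsum : ∑ j, w j * v j ^ 2 ≤ ∑ j, (2 * (w j * (u + t - v) j ^ 2)
      - 2 * (w j * (u + t) j ^ 2) + 4 * (wh * a * y) + 4 * (w j * t j ^ 2)) := by
    refine Finset.sum_le_sum fun j _ => ?_
    simp only [Pi.add_apply, Pi.sub_apply]
    have h1 : w j * (u j * v j) ≤ wh * (a * y) := by
      calc w j * (u j * v j) ≤ w j * (a * y) := by
            refine mul_le_mul_of_nonneg_left ?_ (hw j)
            calc u j * v j ≤ |u j * v j| := le_abs_self _
              _ = |u j| * |v j| := abs_mul _ _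
              _ ≤ a * y := mul_le_mul (hu j) (hv j) (abs_nonneg _) ha
        _ ≤ wh * (a * y) := mul_le_mul_of_nonneg_right (hwh j) (mul_nonneg ha hy)
    nlinarith [mul_nonneg (hw j) (sq_nonneg (2 * t j - v j))]
  simp only [Finset.sum_add_distrib, Finset.sum_sub_distrib, ← Finset.mul_sum, Finset.sum_const,
    Finset.card_univ, Fintype.card_fin, nsmul_eq_mul] at hsum
  have h := mul_le_mul_of_nonneg_left hsum (show (0 : ℝ) ≤ (q : ℝ)⁻¹ by positivity)
  have hq : (q : ℝ)⁻¹ * q * (wh * a * y) ≤ 1 * (wh * a * y) :=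
    mul_le_mul_of_nonneg_right inv_mul_le_one (mul_nonneg (mul_nonneg hwh0 ha) hy)
  unfold wsq
  linarith

end Wsq

/-! ### Penalized GMM in terms of the weighted mean square -/

section Lasso

variable {p q : ℕ}

lemma pgmmObjective_diagonal (M : Fin q → ℝ) (G : Matrix (Fin q) (Fin p) ℝ) (w : Fin q → ℝ)
    (lam : ℝ) (ρ : Fin p → ℝ) :
    pgmmObjective M G (Matrix.diagonal w) lam ρ = wsq w (M - G *ᵥ ρ) + 2 * lam * ∑ k, |ρ k| := by
  rw [pgmmObjective, dotProduct_diagonal_mulVec]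

lemma dotProduct_gram_diagonal (G : Matrix (Fin q) (Fin p) ℝ) (w : Fin q → ℝ) (δ : Fin p → ℝ) :
    δ ⬝ᵥ (gram G (Matrix.diagonal w) *ᵥ δ) = wsq w (G *ᵥ δ) := by
  rw [gram, ← dotProduct_diagonal_mulVec, Matrix.mul_assoc, ← Matrix.mulVec_mulVec,
    ← Matrix.mulVec_mulVec, Matrix.dotProduct_mulVec, Matrix.vecMul_transpose]

lemma abs_mulVec_le {G : Matrix (Fin q) (Fin p) ℝ} {B : ℝ} (hG : ∀ j k, |G j k| ≤ B)
    (δ : Fin p → ℝ) (j : Fin q) : |(G *ᵥ δ) j| ≤ B * ∑ k, |δ k| := by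
  rw [Matrix.mulVec, dotProduct, Finset.mul_sum]
  refine (Finset.abs_sum_le_sum_abs _ _).trans (Finset.sum_le_sum fun k _ => ?_)
  rw [abs_mul]
  exact mul_le_mul_of_nonneg_right (hG j k) (abs_nonneg _)

/-- The support of a coefficient vector. -/
noncomputable def supp (ρ : Fin p → ℝ) : Finset (Fin p) := Finset.univ.filter fun k => ρ k ≠ 0

lemma sum_abs_eq (S : Finset (Fin p)) (δ : Fin p → ℝ) :
    ∑ k, |δ k| = ∑ k ∈ S, |δ k| + ∑ k ∈ Sᶜ, |δ k| := (Finset.sum_add_sum_compl S _).symm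

lemma sum_abs_add_compl_le (ρbar ρ : Fin p → ℝ) :
    ∑ k, |ρbar k| + ∑ k ∈ (supp ρbar)ᶜ, |(ρ - ρbar) k|
      ≤ ∑ k, |ρ k| + ∑ k ∈ supp ρbar, |(ρ - ρbar) k| := by
  have hS : ∀ k ∈ (supp ρbar)ᶜ, ρbar k = 0 := fun k hk => by simpa [supp] using hk
  rw [sum_abs_eq (supp ρbar) ρbar, sum_abs_eq (supp ρbar) ρ]
  have h1 : ∑ k ∈ (supp ρbar)ᶜ, |ρbar k| = 0 :=
    Finset.sum_eq_zero fun k hk => by simp [hS k hk]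
  have h2 : ∑ k ∈ (supp ρbar)ᶜ, |(ρ - ρbar) k| = ∑ k ∈ (supp ρbar)ᶜ, |ρ k| :=
    Finset.sum_congr rfl fun k hk => by simp [hS k hk]
  have h3 : ∑ k ∈ supp ρbar, |ρbar k|
      ≤ ∑ k ∈ supp ρbar, |ρ k| + ∑ k ∈ supp ρbar, |(ρ - ρbar) k| := by
    rw [← Finset.sum_add_distrib]
    refine Finset.sum_le_sum fun k _ => ?_
    have := abs_sub_abs_le_abs_sub (ρbar k) (ρ k)
    rw [abs_sub_comm] at this
    simp only [Pi.sub_apply]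
    linarith
  linarith

/-- The compatibility condition on the support of `ρbar`: on the cone
`|δ_{Sᶜ}|₁ ≤ 3 |δ_S|₁`, the squared `ℓ₁` norm of `δ_S` is controlled by the quadratic form. -/
def Compatible (w : Fin q → ℝ) (G : Matrix (Fin q) (Fin p) ℝ) (ρbar : Fin p → ℝ) (s c : ℝ) :
    Prop :=
  ∀ δ : Fin p → ℝ, ∑ k ∈ (supp ρbar)ᶜ, |δ k| ≤ 3 * ∑ k ∈ supp ρbar, |δ k| →
    c * (∑ k ∈ supp ρbar, |δ k|) ^ 2 ≤ s * wsq w (G *ᵥ δ)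

lemma RestrictedEigenvalueGE.compatible {w : Fin q → ℝ} {G : Matrix (Fin q) (Fin p) ℝ}
    {ρbar : Fin p → ℝ} {c : ℝ} (hc : 0 ≤ c)
    (h : RestrictedEigenvalueGE (gram G (Matrix.diagonal w)) (numNonzero ρbar) c) :
    Compatible w G ρbar (numNonzero ρbar) c := by
  intro δ hδ
  by_cases h0 : δ = 0
  · simp [h0, wsq]
  have h1 := h (supp ρbar) le_rfl δ h0 hδ
  rw [dotProduct_gram_diagonal] at h1
  have hpos : 0 < ∑ k ∈ supp ρbar, δ k ^ 2 := by
    refine lt_of_le_of_ne (Finset.sum_nonneg fun k _ => sq_nonneg _) fun hz => h0 ?_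
    have hz1 : ∀ k ∈ supp ρbar, |δ k| = 0 := fun k hk => by
      have := (Finset.sum_eq_zero_iff_of_nonneg fun k _ => sq_nonneg (δ k)).1 hz.symm k hk
      simpa using this
    rw [Finset.sum_eq_zero hz1, mul_zero] at hδ
    have hz2 := (Finset.sum_eq_zero_iff_of_nonneg fun k _ => abs_nonneg (δ k)).1
      (le_antisymm hδ (Finset.sum_nonneg fun k _ => abs_nonneg _))
    funext k
    by_cases hk : k ∈ supp ρbar
    · exact abs_eq_zero.1 (hz1 k hk)
    · exact abs_eq_zero.1 (hz2 k (Finset.mem_compl.2 hk))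
  rw [le_div_iff₀ hpos] at h1
  have h2 : (∑ k ∈ supp ρbar, |δ k|) ^ 2 ≤ (numNonzero ρbar : ℝ) * ∑ k ∈ supp ρbar, δ k ^ 2 := by
    have := sq_sum_le_card_mul_sum_sq (s := supp ρbar) (f := fun k => |δ k|)
    simp only [sq_abs] at this
    exact this
  calc c * (∑ k ∈ supp ρbar, |δ k|) ^ 2
      ≤ c * ((numNonzero ρbar : ℝ) * ∑ k ∈ supp ρbar, δ k ^ 2) := mul_le_mul_of_nonneg_left h2 hc
    _ = (numNonzero ρbar : ℝ) * (c * ∑ k ∈ supp ρbar, δ k ^ 2) := by ring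
    _ ≤ _ := mul_le_mul_of_nonneg_left h1 (Nat.cast_nonneg _)

/-! ### The population coefficients -/

/-- The prediction bound of the Lasso, as an inequality between real numbers: `x` is the quadratic
form of the residual, `a` its value at the sparse approximation, `D` and `E` the `ℓ₁` norms of the
estimation error on and off the support. -/
lemma lasso_prediction_bound {c s ε a x D E y : ℝ} (hc : 0 < c) (hs : 0 ≤ s) (hε : 0 < ε)
    (ha : 0 ≤ a) (hx : 0 ≤ x) (hbasic : x + 2 * ε * E ≤ a + 2 * ε * D) (hE : 0 ≤ E)
    (hcompat : E ≤ 3 * D → c * D ^ 2 ≤ s * y) (hy : y ≤ 2 * x + 2 * a) :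
    x ≤ 3 * a + 8 * (s * ε ^ 2 / c) := by
  have hk : 0 ≤ s * ε ^ 2 / c := by positivity
  have hεE : 0 ≤ ε * E := mul_nonneg hε.le hE
  by_cases hcase : a ≤ 4 * ε * D
  · have hED : E ≤ 3 * D := by
      have : ε * E ≤ ε * (3 * D) := by nlinarith
      exact le_of_mul_le_mul_left this hε
    have h1 := hcompat hED
    have h2 : (2 * ε * D) ^ 2 ≤ (4 * (s * ε ^ 2 / c) + (2 * x + 2 * a) / 4) ^ 2 := by
      have h3 : D ^ 2 ≤ s * (2 * x + 2 * a) / c := by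
        rw [le_div_iff₀ hc]
        nlinarith [mul_le_mul_of_nonneg_left hy hs]
      have h4 : (2 * ε * D) ^ 2 ≤ 4 * ε ^ 2 * (s * (2 * x + 2 * a) / c) := by
        nlinarith [mul_le_mul_of_nonneg_left h3 (show 0 ≤ 4 * ε ^ 2 by positivity)]
      have h5 : 4 * ε ^ 2 * (s * (2 * x + 2 * a) / c)
          = 4 * (s * ε ^ 2 / c) * (2 * x + 2 * a) := by ring
      nlinarith [sq_nonneg (4 * (s * ε ^ 2 / c) - (2 * x + 2 * a) / 4)]
    have h6 := abs_le_of_sq_le_sq h2 (by positivity)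
    linarith [le_abs_self (2 * ε * D)]
  · nlinarith

/-- The population coefficients `ρ_⋆` differ from `ρbar` by `O(s ε)` in the `ℓ₁` norm: the prediction
bound for `ρ_L` bounds the objective of `ρ_⋆` at `ρbar`. -/
lemma sum_abs_rhoStar_sub_le {M : Fin q → ℝ} {G : Matrix (Fin q) (Fin p) ℝ} {w : Fin q → ℝ}
    {ρbar ρL ρS : Fin p → ℝ} {ε s c K : ℝ} (hw : ∀ j, 0 ≤ w j) (hc : 0 < c) (hs : 0 ≤ s)
    (hε : 0 < ε) (hK : 0 ≤ K)
    (hcompat : Compatible w G ρbar s c) (happrox : wsq w (M - G *ᵥ ρbar) ≤ K * (s * ε ^ 2))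
    (hL : IsPGMM M G (Matrix.diagonal w) ε ρL)
    (hS : IsMinOn (sparseObjective (gram G (Matrix.diagonal w)) ρL ρbar ε) Set.univ ρS) :
    ∑ k, |(ρS - ρbar) k| ≤ (16 * K + 32 / c + 4 * (8 * K + 16 / c) / c + 1) * (s * ε) := by
  have hLbar := hL (Set.mem_univ ρbar)
  have hSbar := hS (Set.mem_univ ρbar)
  simp only [Set.mem_ofPred_eq, pgmmObjective_diagonal] at hLbar
  simp only [Set.mem_ofPred_eq, sparseObjective, dotProduct_gram_diagonal] at hSbar
  have hfil : (Finset.univ.filter fun k => ρbar k = 0) = (supp ρbar)ᶜ := by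
    ext k; simp [supp]
  rw [hfil] at hSbar
  have hz : ∑ k ∈ (supp ρbar)ᶜ, |ρbar k| = 0 :=
    Finset.sum_eq_zero fun k hk => by
      have : ρbar k = 0 := by simpa [supp] using hk
      simp [this]
  have hz' : ∑ k ∈ (supp ρbar)ᶜ, |ρS k| = ∑ k ∈ (supp ρbar)ᶜ, |(ρS - ρbar) k| :=
    Finset.sum_congr rfl fun k hk => by
      have : ρbar k = 0 := by simpa [supp] using hk
      simp [this]
  rw [hz, hz', mul_zero, add_zero] at hSbar
  have hl1 := sum_abs_add_compl_le ρbar ρL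
  have ha := wsq_nonneg hw (M - G *ᵥ ρbar)
  have hx := wsq_nonneg hw (M - G *ᵥ ρL)
  -- the quadratic form of `ρ_L - ρbar` is bounded by those of the two residuals
  have hdiff : wsq w (G *ᵥ (ρL - ρbar))
      ≤ 2 * wsq w (M - G *ᵥ ρL) + 2 * wsq w (M - G *ᵥ ρbar) := by
    have h1 : G *ᵥ (ρL - ρbar) = -(M - G *ᵥ ρL) + (M - G *ᵥ ρbar) := by
      rw [Matrix.mulVec_sub]; abel
    rw [h1]
    refine (wsq_add_le hw _ _).trans ?_
    rw [wsq_neg]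
  have hxb := lasso_prediction_bound (D := ∑ k ∈ supp ρbar, |(ρL - ρbar) k|)
    (E := ∑ k ∈ (supp ρbar)ᶜ, |(ρL - ρbar) k|) hc hs hε ha hx
    (by nlinarith [mul_le_mul_of_nonneg_left hl1 hε.le])
    (Finset.sum_nonneg fun k _ => abs_nonneg _) (hcompat _) hdiff
  have hk : 0 ≤ s * ε ^ 2 / c := by positivity
  set T := s * ε ^ 2 with hT
  have hT0 : 0 ≤ T := by positivity
  have hB : wsq w (G *ᵥ (ρL - ρbar)) ≤ (8 * K + 16 / c) * T := by
    have : (16 / c) * T = 16 * (T / c) := by ring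
    nlinarith
  set D := ∑ k ∈ supp ρbar, |(ρS - ρbar) k| with hD
  set E := ∑ k ∈ (supp ρbar)ᶜ, |(ρS - ρbar) k| with hE
  have hD0 : 0 ≤ D := Finset.sum_nonneg fun k _ => abs_nonneg _
  have hE0 : 0 ≤ E := Finset.sum_nonneg fun k _ => abs_nonneg _
  have hq0 := wsq_nonneg hw (G *ᵥ (ρL - ρS))
  set K2 := 8 * K + 16 / c with hK2
  have hK20 : 0 ≤ K2 := by positivity
  have hEb : E ≤ K2 * (s * ε) / 2 := by
    have : ε * E ≤ ε * (K2 * (s * ε) / 2) := by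
      have h2 : ε * (K2 * (s * ε) / 2) = K2 * T / 2 := by rw [hT]; ring
      rw [h2]; linarith
    exact le_of_mul_le_mul_left this hε
  have hGS : wsq w (G *ᵥ (ρS - ρbar)) ≤ 4 * (K2 * T) := by
    have h1 : G *ᵥ (ρS - ρbar) = -(G *ᵥ (ρL - ρS)) + G *ᵥ (ρL - ρbar) := by
      rw [Matrix.mulVec_sub, Matrix.mulVec_sub, Matrix.mulVec_sub]; abel
    rw [h1]
    refine (wsq_add_le hw _ _).trans ?_
    rw [wsq_neg]
    have : 0 ≤ ε * E := mul_nonneg hε.le hE0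
    linarith
  have hDb : D ≤ E + (4 * K2 / c + 1) * (s * ε) := by
    have hsε : 0 ≤ (4 * K2 / c + 1) * (s * ε) := by positivity
    by_cases hcone : E ≤ 3 * D
    · have h1 := hcompat _ hcone
      have h2 : D ^ 2 ≤ ((4 * K2 / c + 1) * (s * ε)) ^ 2 := by
        have h3 : D ^ 2 ≤ (4 * K2 / c) * (s * ε) ^ 2 := by
          have h4 : c * D ^ 2 ≤ c * ((4 * K2 / c) * (s * ε) ^ 2) := by
            have h5 : c * ((4 * K2 / c) * (s * ε) ^ 2) = s * (4 * (K2 * T)) := by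
              rw [hT]; field_simp
            rw [h5]
            exact h1.trans (mul_le_mul_of_nonneg_left hGS hs)
          exact le_of_mul_le_mul_left h4 hc
        have h6 : 4 * K2 / c ≤ (4 * K2 / c + 1) ^ 2 := by
          have : 0 ≤ 4 * K2 / c := by positivity
          nlinarith
        rw [mul_pow]
        exact h3.trans (mul_le_mul_of_nonneg_right h6 (sq_nonneg _))
      have := (le_abs_self D).trans (abs_le_of_sq_le_sq h2 hsε)
      linarith
    · linarith
  rw [sum_abs_eq (supp ρbar)]
  have : (16 * K + 32 / c + 4 * K2 / c + 1) * (s * ε)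
      = 2 * K2 * (s * ε) + (4 * K2 / c + 1) * (s * ε) := by rw [hK2]; ring
  rw [this]
  have : 0 ≤ K2 * (s * ε) := by positivity
  linarith

/-! ### The penalized GMM estimator -/

/-- The `ℓ₁` bound of the Lasso, as an inequality between real numbers: `D` and `E` are the `ℓ₁`
norms of the estimation error on and off the support, `y` and `z` are its weighted and unweighted
quadratic forms, and `R` measures the approximation error. -/
lemma lasso_l1_bound {c s lam wl D E y z R : ℝ} (hc : 0 < c) (hs : 0 ≤ s) (hlam : 0 < lam)
    (hwl : 0 < wl) (hD : 0 ≤ D) (hE : 0 ≤ E) (hy : 0 ≤ y) (hR : 0 ≤ R)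
    (hbasic : y / 2 + 3 / 2 * (lam * E) ≤ 5 / 2 * (lam * D) + lam * R)
    (hcone : E ≤ 3 * D → c / 2 * D ^ 2 ≤ s * (2 * z)) (hz : wl * z ≤ y) :
    D + E ≤ 112 / (c * wl) * (s * lam) + 4 * R := by
  have hlE : 0 ≤ lam * E := mul_nonneg hlam.le hE
  by_cases hcase : R ≤ D
  · have hRD : lam * R ≤ lam * D := mul_le_mul_of_nonneg_left hcase hlam.le
    have hED : E ≤ 3 * D := by
      have : lam * E ≤ lam * (3 * D) := by linarith [mul_nonneg hlam.le hD]
      exact le_of_mul_le_mul_left this hlam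
    have h1 : y ≤ 7 * (lam * D) := by linarith
    have h2 : wl * (c / 2 * D ^ 2) ≤ s * (2 * (7 * (lam * D))) :=
      calc wl * (c / 2 * D ^ 2) ≤ wl * (s * (2 * z)) :=
            mul_le_mul_of_nonneg_left (hcone hED) hwl.le
        _ = s * (2 * (wl * z)) := by ring
        _ ≤ s * (2 * (7 * (lam * D))) := mul_le_mul_of_nonneg_left (by linarith) hs
    have h3 : D ≤ 28 / (c * wl) * (s * lam) := by
      rcases hD.eq_or_lt with h0 | hpos
      · rw [← h0]; positivity
      · have h4 : (c * wl) * D ≤ 28 * (s * lam) := by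
          have : D * ((c * wl) * D) ≤ D * (28 * (s * lam)) := by linarith
          exact le_of_mul_le_mul_left this hpos
        rw [div_mul_eq_mul_div, le_div_iff₀ (by positivity)]
        linarith
    have h5 : 112 / (c * wl) * (s * lam) = 4 * (28 / (c * wl) * (s * lam)) := by ring
    linarith
  · push Not at hcase
    have h1 : lam * D ≤ lam * R := mul_le_mul_of_nonneg_left hcase.le hlam.le
    have h2 : E ≤ 3 * R := by
      have : lam * E ≤ lam * (3 * R) := by linarith [mul_nonneg hlam.le hR]
      exact le_of_mul_le_mul_left this hlam
    have h3 : 0 ≤ 112 / (c * wl) * (s * lam) := by positivity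
    linarith

/-- The `ℓ₁` bound for penalized GMM with estimated moments and diagonal weights between `wl` and
`wh`. The moments have errors of order `η λ` in the supremum norm, with `η` small, and the error
`M - G ρbar` of the sparse approximation is only small in mean square. -/
lemma sum_abs_pgmm_sub_le {M Mh : Fin q → ℝ} {G Gh : Matrix (Fin q) (Fin p) ℝ} {wt : Fin q → ℝ}
    {ρbar ρ : Fin p → ℝ} {lam s c K A B wl wh η : ℝ} (hwl : 0 < wl) (hwt : ∀ j, wl ≤ wt j)
    (hwh : ∀ j, wt j ≤ wh) (hwh0 : 0 ≤ wh) (hc : 0 < c) (hs : 0 ≤ s) (hlam : 0 < lam) (hK : 0 ≤ K)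
    (hA : ∑ k, |ρbar k| ≤ A) (hB : 0 ≤ B)
    (hη : 0 ≤ η) (hη1 : η ≤ 1) (hηs : 4 * (wh * (η * (1 + A)) * B) ≤ 1)
    (hslam : 32 * (s * lam ^ 2) ≤ c / 2)
    (hcompat : Compatible 1 G ρbar s c)
    (happrox : wsq 1 (M - G *ᵥ ρbar) ≤ K * (s * lam ^ 2))
    (hMh : ∀ j, |Mh j - M j| ≤ η * lam) (hGh : ∀ j k, |Gh j k - G j k| ≤ η * lam)
    (hGhB : ∀ j k, |Gh j k| ≤ B)
    (hρ : IsPGMM Mh Gh (Matrix.diagonal wt) lam ρ) :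
    ∑ k, |(ρ - ρbar) k| ≤ (112 / (c * wl) + 8 * (wh * K)) * (s * lam) := by
  have hwt0 : ∀ j, 0 ≤ wt j := fun j => hwl.le.trans (hwt j)
  have hmin := hρ (Set.mem_univ ρbar)
  simp only [Set.mem_ofPred_eq, pgmmObjective_diagonal] at hmin
  have hl1 := sum_abs_add_compl_le ρbar ρ
  set δ := ρ - ρbar with hδ
  set D := ∑ k ∈ supp ρbar, |δ k| with hD
  set E := ∑ k ∈ (supp ρbar)ᶜ, |δ k| with hE
  have hD0 : 0 ≤ D := Finset.sum_nonneg fun k _ => abs_nonneg _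
  have hE0 : 0 ≤ E := Finset.sum_nonneg fun k _ => abs_nonneg _
  have hsum : ∑ k, |δ k| = D + E := sum_abs_eq _ _
  have hA0 : 0 ≤ A := (Finset.sum_nonneg fun k _ => abs_nonneg _).trans hA
  set u : Fin q → ℝ := Mh - M + (G - Gh) *ᵥ ρbar with hu
  set t : Fin q → ℝ := M - G *ᵥ ρbar with ht
  have hut : Mh - Gh *ᵥ ρbar = u + t := by
    rw [hu, ht, Matrix.sub_mulVec]; abel
  have hutv : Mh - Gh *ᵥ ρ = u + t - Gh *ᵥ δ := by
    rw [← hut, hδ, Matrix.mulVec_sub]; abel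
  rw [hut, hutv] at hmin
  have hub : ∀ j, |u j| ≤ η * lam * (1 + A) := fun j => by
    have h1 := abs_mulVec_le (G := G - Gh) (B := η * lam)
      (fun j k => by rw [Matrix.sub_apply, abs_sub_comm]; exact hGh j k) ρbar j
    have h2 : η * lam * ∑ k, |ρbar k| ≤ η * lam * A :=
      mul_le_mul_of_nonneg_left hA (by positivity)
    have h3 : |u j| ≤ |Mh j - M j| + |((G - Gh) *ᵥ ρbar) j| := by
      rw [hu]; exact abs_add_le _ _
    linarith [hMh j]
  have hhalf := half_wsq_le (a := η * lam * (1 + A)) (y := B * (D + E)) hwt0 hwh hwh0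
    (by positivity) (by positivity) u t (Gh *ᵥ δ) hub
    (fun j => by rw [← hsum]; exact abs_mulVec_le hGhB δ j)
  have htb : wsq wt t ≤ wh * (K * (s * lam ^ 2)) := by
    have h1 : (1 : ℝ) * wsq wt t ≤ wh * wsq 1 t := wsq_le_of_forall fun j => by
      simp only [Pi.one_apply, one_mul]
      exact mul_le_mul_of_nonneg_right (hwh j) (sq_nonneg _)
    rw [one_mul] at h1
    exact h1.trans (mul_le_mul_of_nonneg_left happrox hwh0)
  have hcross : 2 * (wh * (η * lam * (1 + A)) * (B * (D + E))) ≤ lam * (D + E) / 2 := by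
    have h1 : 2 * (wh * (η * lam * (1 + A)) * (B * (D + E)))
        = (4 * (wh * (η * (1 + A)) * B)) * (lam * (D + E) / 2) := by ring
    rw [h1]
    have h2 : 0 ≤ lam * (D + E) / 2 := by positivity
    nlinarith
  set y := wsq wt (Gh *ᵥ δ) with hy
  have hy0 : 0 ≤ y := wsq_nonneg hwt0 _
  have hbasic : y / 2 + 3 / 2 * (lam * E) ≤ 5 / 2 * (lam * D) + 2 * (wh * (K * (s * lam ^ 2))) := by
    nlinarith [mul_le_mul_of_nonneg_left hl1 hlam.le]
  rw [hsum]
  have hcone : E ≤ 3 * D → c / 2 * D ^ 2 ≤ s * (2 * wsq 1 (Gh *ᵥ δ)) := fun hED => by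
    have h1 : c * D ^ 2 ≤ s * wsq 1 (G *ᵥ δ) := hcompat δ hED
    have h2 : wsq 1 (G *ᵥ δ) ≤ 2 * wsq 1 (Gh *ᵥ δ) + 2 * (4 * (η * lam) * D) ^ 2 := by
      have h3 : G *ᵥ δ = Gh *ᵥ δ + (G - Gh) *ᵥ δ := by rw [Matrix.sub_mulVec]; abel
      have h4 := wsq_le_of_abs_le (w := (1 : Fin q → ℝ)) (wh := 1) (v := (G - Gh) *ᵥ δ)
        (B := 4 * (η * lam) * D) (fun _ => le_rfl) zero_le_one fun j => by
          refine (abs_mulVec_le (B := η * lam)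
            (fun j k => by rw [Matrix.sub_apply, abs_sub_comm]; exact hGh j k) δ j).trans ?_
          rw [hsum]
          have : η * lam * E ≤ η * lam * (3 * D) :=
            mul_le_mul_of_nonneg_left hED (by positivity)
          linarith
      have h5 := wsq_add_le (w := (1 : Fin q → ℝ)) (fun _ => zero_le_one) (Gh *ᵥ δ)
        ((G - Gh) *ᵥ δ)
      rw [h3]
      linarith
    have h6 : s * (2 * (4 * (η * lam) * D) ^ 2) ≤ c / 2 * D ^ 2 := by
      have hη2 : η ^ 2 ≤ 1 := pow_le_one₀ hη hη1
      have h7 : 32 * (s * lam ^ 2) * D ^ 2 ≤ c / 2 * D ^ 2 :=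
        mul_le_mul_of_nonneg_right hslam (sq_nonneg _)
      have h8 : η ^ 2 * (32 * (s * lam ^ 2) * D ^ 2) ≤ 1 * (32 * (s * lam ^ 2) * D ^ 2) :=
        mul_le_mul_of_nonneg_right hη2 (by positivity)
      linarith
    linarith [mul_le_mul_of_nonneg_left h2 hs]
  have hz : wl * wsq 1 (Gh *ᵥ δ) ≤ y := by
    have : wl * wsq 1 (Gh *ᵥ δ) ≤ 1 * y := wsq_le_of_forall fun j => by
      simp only [Pi.one_apply, one_mul]
      exact mul_le_mul_of_nonneg_right (hwt j) (sq_nonneg _)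
    linarith
  refine (lasso_l1_bound (R := 2 * (wh * K) * (s * lam)) hc hs hlam hwl hD0 hE0 hy0 (by positivity)
    (by linarith) hcone hz).trans (le_of_eq (by ring))

end Lasso


section TwoStep

variable {𝒳 𝒵 : Type*} {Γ : Submodule ℝ (𝒳 → ℝ)} {p q : ℕ}

/-! ### Sample averages of the moment functions -/

section Sample

variable {ι : Type*} [Fintype ι]

lemma avg_le_avg {D : ι → Obs 𝒳 𝒵} {f g : Obs 𝒳 𝒵 → ℝ} (h : ∀ i, f (D i) ≤ g (D i)) :
    avg D f ≤ avg D g :=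
  mul_le_mul_of_nonneg_left (Finset.sum_le_sum fun i _ => h i) (by positivity)

lemma avg_const_le {D : ι → Obs 𝒳 𝒵} {B : ℝ} (hB : 0 ≤ B) : avg D (fun _ => B) ≤ B := by
  simp only [avg, Finset.sum_const, Finset.card_univ, nsmul_eq_mul, ← mul_assoc]
  exact (mul_le_mul_of_nonneg_right inv_mul_le_one hB).trans (one_mul B).le

lemma avg_add (D : ι → Obs 𝒳 𝒵) (f g : Obs 𝒳 𝒵 → ℝ) :
    avg D (fun w => f w + g w) = avg D f + avg D g := by
  simp [avg, Finset.sum_add_distrib, mul_add]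

lemma abs_avg_le {D : ι → Obs 𝒳 𝒵} {f : Obs 𝒳 𝒵 → ℝ} {B : ℝ} (hB : 0 ≤ B)
    (h : ∀ i, |f (D i)| ≤ B) : |avg D f| ≤ B := by
  have h1 : |avg D f| ≤ avg D (fun w => |f w|) := by
    rw [avg, avg, abs_mul, abs_of_nonneg (by positivity : (0 : ℝ) ≤ (Fintype.card ι : ℝ)⁻¹)]
    exact mul_le_mul_of_nonneg_left (Finset.abs_sum_le_sum_abs _ _) (by positivity)
  exact h1.trans ((avg_le_avg h).trans (avg_const_le hB))

lemma abs_lin_le {b : Fin p → 𝒵 → ℝ} {Cb : ℝ} {z : 𝒵} (hb : ∀ k, |b k z| ≤ Cb) (ρ : Fin p → ℝ) :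
    |lin b ρ z| ≤ Cb * ∑ k, |ρ k| := by
  rw [lin, Finset.mul_sum]
  refine (Finset.abs_sum_le_sum_abs _ _).trans (Finset.sum_le_sum fun k _ => ?_)
  rw [abs_mul]
  exact mul_le_mul_of_nonneg_right (hb k) (abs_nonneg _)

lemma lin_sub (b : Fin p → 𝒵 → ℝ) (ρ ρ' : Fin p → ℝ) (z : 𝒵) :
    lin b (ρ - ρ') z = lin b ρ z - lin b ρ' z := by
  simp [lin, mul_sub, Finset.sum_sub_distrib]

/-- The dictionaries and the functionals of the dictionary are bounded at the observation `w`. -/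
def BoundedAt (m : Obs 𝒳 𝒵 → Γ →ₗ[ℝ] ℝ) (d : Fin q → Γ) (b : Fin p → 𝒵 → ℝ) (Cb Cd Cm : ℝ)
    (w : Obs 𝒳 𝒵) : Prop :=
  (∀ k, |b k (Obs.z w)| ≤ Cb) ∧ (∀ j, |(d j : 𝒳 → ℝ) (Obs.x w)| ≤ Cd) ∧ ∀ j, |m w (d j)| ≤ Cm

variable {m : Obs 𝒳 𝒵 → Γ →ₗ[ℝ] ℝ} {d : Fin q → Γ} {b : Fin p → 𝒵 → ℝ} {Cb Cd Cm : ℝ}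

lemma BoundedAt.abs_mul_lin_le {w : Obs 𝒳 𝒵} (h : BoundedAt m d b Cb Cd Cm w) (hCd : 0 ≤ Cd)
    (ρ : Fin p → ℝ) (j : Fin q) :
    |(d j : 𝒳 → ℝ) (Obs.x w) * lin b ρ (Obs.z w)| ≤ Cd * Cb * ∑ k, |ρ k| := by
  rw [abs_mul, mul_assoc]
  exact mul_le_mul (h.2.1 j) (abs_lin_le h.1 ρ) (abs_nonneg _) hCd

lemma BoundedAt.abs_psi_le {w : Obs 𝒳 𝒵} (h : BoundedAt m d b Cb Cd Cm w) (hCd : 0 ≤ Cd)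
    (ρ : Fin p → ℝ) (j : Fin q) : |psi m d b ρ j w| ≤ Cm + Cd * Cb * ∑ k, |ρ k| := by
  have h1 := h.abs_mul_lin_le hCd ρ j
  have h2 := h.2.2 j
  exact (abs_sub _ _).trans (by linarith)

lemma BoundedAt.psi_sq_le {w : Obs 𝒳 𝒵} (h : BoundedAt m d b Cb Cd Cm w) (hCd : 0 ≤ Cd)
    {ρ : Fin p → ℝ} {R : ℝ} (hR : Cm + Cd * Cb * ∑ k, |ρ k| ≤ R) (j : Fin q) :
    psi m d b ρ j w ^ 2 ≤ R ^ 2 := by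
  have := abs_le.1 ((h.abs_psi_le hCd ρ j).trans hR)
  exact sq_le_sq' this.1 this.2

lemma sigmaHatSq_le {D : ι → Obs 𝒳 𝒵} (h : ∀ i, BoundedAt m d b Cb Cd Cm (D i)) (hCd : 0 ≤ Cd)
    {ρ : Fin p → ℝ} {R : ℝ} (hR : Cm + Cd * Cb * ∑ k, |ρ k| ≤ R) (j : Fin q) :
    sigmaHatSq m d b D ρ j ≤ R ^ 2 :=
  (avg_le_avg (g := fun _ => R ^ 2) fun i => (h i).psi_sq_le hCd hR j).trans
    (avg_const_le (sq_nonneg R))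

/-- The sample second moments are Lipschitz in the coefficients, with respect to the `ℓ₁` norm. -/
lemma sigmaHatSq_le_add {D : ι → Obs 𝒳 𝒵} (h : ∀ i, BoundedAt m d b Cb Cd Cm (D i)) (hCb : 0 ≤ Cb)
    (hCd : 0 ≤ Cd) {ρ ρ' : Fin p → ℝ} {R : ℝ} (hR0 : 0 ≤ R) (hR : Cm + Cd * Cb * ∑ k, |ρ k| ≤ R)
    (hR' : Cm + Cd * Cb * ∑ k, |ρ' k| ≤ R) (j : Fin q) :
    sigmaHatSq m d b D ρ j
      ≤ sigmaHatSq m d b D ρ' j + 2 * R * (Cd * Cb * ∑ k, |(ρ - ρ') k|) := by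
  have hnn : 0 ≤ 2 * R * (Cd * Cb * ∑ k, |(ρ - ρ') k|) :=
    mul_nonneg (by linarith) (mul_nonneg (mul_nonneg hCd hCb)
      (Finset.sum_nonneg fun k _ => abs_nonneg _))
  calc sigmaHatSq m d b D ρ j
      ≤ avg D (fun w => psi m d b ρ' j w ^ 2 + 2 * R * (Cd * Cb * ∑ k, |(ρ - ρ') k|)) :=
        avg_le_avg fun i => by
          have h1 := ((h i).abs_psi_le hCd ρ j).trans hR
          have h2 := ((h i).abs_psi_le hCd ρ' j).trans hR'
          have h3 : psi m d b ρ j (D i) - psi m d b ρ' j (D i)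
              = -((d j : 𝒳 → ℝ) (Obs.x (D i)) * lin b (ρ - ρ') (Obs.z (D i))) := by
            rw [lin_sub, psi, psi]; ring
          have h4 : |psi m d b ρ j (D i) - psi m d b ρ' j (D i)|
              ≤ Cd * Cb * ∑ k, |(ρ - ρ') k| := by
            rw [h3, abs_neg]; exact (h i).abs_mul_lin_le hCd _ j
          have h5 : |psi m d b ρ j (D i) + psi m d b ρ' j (D i)| ≤ 2 * R :=
            (abs_add_le _ _).trans (by linarith)
          have h6 : psi m d b ρ j (D i) ^ 2 - psi m d b ρ' j (D i) ^ 2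
              ≤ 2 * R * (Cd * Cb * ∑ k, |(ρ - ρ') k|) := by
            rw [sq_sub_sq]
            refine (le_abs_self _).trans ?_
            rw [abs_mul]
            exact mul_le_mul h5 h4 (abs_nonneg _) (by linarith)
          linarith
    _ = sigmaHatSq m d b D ρ' j + avg D (fun _ => 2 * R * (Cd * Cb * ∑ k, |(ρ - ρ') k|)) :=
        avg_add _ _ _
    _ ≤ _ := by linarith [avg_const_le (D := D) hnn]

end Sample

/-! ### The two-step penalized GMM estimator -/

lemma Compatible.one {w : Fin q → ℝ} {G : Matrix (Fin q) (Fin p) ℝ} {ρbar : Fin p → ℝ}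
    {s c v : ℝ} (hs : 0 ≤ s) (hv : 0 < v) (hw : ∀ j, w j ≤ v⁻¹) (h : Compatible w G ρbar s c) :
    Compatible 1 G ρbar s (c * v) := fun δ hδ => by
  have h1 : v * wsq w (G *ᵥ δ) ≤ 1 * wsq 1 (G *ᵥ δ) := wsq_le_of_forall fun j => by
    have : v * w j ≤ 1 := by
      calc v * w j ≤ v * v⁻¹ := mul_le_mul_of_nonneg_left (hw j) hv.le
        _ = 1 := mul_inv_cancel₀ hv.ne'
    simp only [Pi.one_apply, one_mul, ← mul_assoc]
    exact (mul_le_mul_of_nonneg_right this (sq_nonneg _)).trans (one_mul _).le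
  calc c * v * (∑ k ∈ supp ρbar, |δ k|) ^ 2 = v * (c * (∑ k ∈ supp ρbar, |δ k|) ^ 2) := by ring
    _ ≤ v * (s * wsq w (G *ᵥ δ)) := mul_le_mul_of_nonneg_left (h δ hδ) hv.le
    _ = s * (v * wsq w (G *ᵥ δ)) := by ring
    _ ≤ s * wsq 1 (G *ᵥ δ) := mul_le_mul_of_nonneg_left (by linarith) hs

lemma sum_abs_sub_le (ρ ρ' ρ'' : Fin p → ℝ) :
    ∑ k, |(ρ - ρ'') k| ≤ ∑ k, |(ρ - ρ') k| + ∑ k, |(ρ'' - ρ') k| := by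
  rw [← Finset.sum_add_distrib]
  refine Finset.sum_le_sum fun k _ => ?_
  simp only [Pi.sub_apply]
  rw [abs_sub_comm (ρ'' k)]
  exact abs_sub_le _ _ _

lemma sum_abs_le_add (ρ ρ' : Fin p → ℝ) :
    ∑ k, |ρ k| ≤ ∑ k, |ρ' k| + ∑ k, |(ρ - ρ') k| := by
  rw [← Finset.sum_add_distrib]
  refine Finset.sum_le_sum fun k _ => ?_
  have := abs_add_le (ρ' k) ((ρ - ρ') k)
  simpa using this

/-- The event on which the training sample behaves as in the population: the observations are
bounded, the sample moments have errors at most `a`, and the sample second moments at the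
population coefficients `ρS` have errors at most `τ`. -/
structure GoodSample [MeasurableSpace 𝒳] [MeasurableSpace 𝒵] {ι : Type*} [Fintype ι]
    (F : Measure (Obs 𝒳 𝒵)) (m : Obs 𝒳 𝒵 → Γ →ₗ[ℝ] ℝ) (d : Fin q → Γ) (b : Fin p → 𝒵 → ℝ)
    (ρS : Fin p → ℝ) (Cb Cd Cm a τ : ℝ) (D : ι → Obs 𝒳 𝒵) : Prop where
  bounded : ∀ i, BoundedAt m d b Cb Cd Cm (D i)
  moment : ∀ j, |Mhat m d D j - Mpop F m d j| ≤ a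
  jacobian : ∀ j k, |Ghat d b D j k - Gpop F d b j k| ≤ a
  variance : ∀ j, |sigmaHatSq m d b D ρS j - sigmaSq F m d b ρS j| ≤ τ

/-- On the good event, both steps of penalized GMM have the `ℓ₁` rate `s λ`, with a constant that
depends only on the constants of the assumptions. The first step makes the estimated weights
bounded and bounded away from zero, which is what the second step needs. -/
theorem exists_l1_bound [MeasurableSpace 𝒳] [MeasurableSpace 𝒵] (F : Measure (Obs 𝒳 𝒵))
    (m : Obs 𝒳 𝒵 → Γ →ₗ[ℝ] ℝ) {A Cb Cd Cm c v K KS : ℝ} (hA : 0 ≤ A) (hCb : 0 ≤ Cb) (hCd : 0 ≤ Cd)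
    (hCm : 0 < Cm) (hc : 0 < c) (hv : 0 < v) (hK : 0 ≤ K)
    (hKS0 : 0 ≤ KS) :
    ∃ η κ Kc : ℝ, 0 < η ∧ 0 < κ ∧ 0 < Kc ∧ ∀ {p q : ℕ} {ι : Type} [Fintype ι] (d : Fin q → Γ)
      (b : Fin p → 𝒵 → ℝ) (s lam : ℝ) (ρbar ρS ρt ρh : Fin p → ℝ) (D : ι → Obs 𝒳 𝒵),
      0 ≤ s → 0 < lam → s * lam ≤ κ → s * lam ^ 2 ≤ κ → ∑ k, |ρbar k| ≤ A →
      (∀ j, v ≤ sigmaSq F m d b ρS j) →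
      Compatible (fun j => (sigmaSq F m d b ρS j)⁻¹) (Gpop F d b) ρbar s c →
      wsq 1 (Mpop F m d - Gpop F d b *ᵥ ρbar) ≤ K * (s * lam ^ 2) →
      ∑ k, |(ρS - ρbar) k| ≤ KS * (s * lam) →
      GoodSample F m d b ρS Cb Cd Cm (η * lam) (v / 4) D →
      IsPGMM (Mhat m d D) (Ghat d b D) 1 lam ρt →
      IsPGMM (Mhat m d D) (Ghat d b D) (omegaHat m d b D ρt) lam ρh →
      ∑ k, |(ρh - ρbar) k| ≤ Kc * (s * lam) := by
  set B := Cd * Cb with hB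
  have hB0 : 0 ≤ B := mul_nonneg hCd hCb
  set R := Cm + B * (A + 1) with hR
  have hR0 : 0 < R := by positivity
  -- the constants of the first and of the second step
  set Kt := 112 / (c * v * 1) + 8 * (1 * K) with hKt
  have hKt0 : 0 < Kt := by positivity
  set Kh := 112 / (c * v * (R ^ 2)⁻¹) + 8 * ((v / 2)⁻¹ * K) with hKh
  have hKh0 : 0 < Kh := by positivity
  set wm := 1 + (v / 2)⁻¹ with hwm
  have hwm0 : 0 < wm := by positivity
  set η := (1 + 4 * (wm * (1 + A) * B))⁻¹ with hη
  have hη0 : 0 < η := by positivity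
  have hη1 : η ≤ 1 := inv_le_one_of_one_le₀ (by
    have : 0 ≤ 4 * (wm * (1 + A) * B) := by positivity
    linarith)
  have hηw : ∀ wh : ℝ, 0 ≤ wh → wh ≤ wm → 4 * (wh * (η * (1 + A)) * B) ≤ 1 := fun wh h0 h1 => by
    calc 4 * (wh * (η * (1 + A)) * B) = η * (4 * (wh * ((1 + A) * B))) := by ring
      _ ≤ η * (1 + 4 * (wm * (1 + A) * B)) := by
          refine mul_le_mul_of_nonneg_left ?_ hη0.le
          have := mul_le_mul_of_nonneg_right h1 (show 0 ≤ (1 + A) * B by positivity)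
          linarith
      _ = 1 := inv_mul_cancel₀ (by positivity)
  set κ := min (c * v / 64) (min (Kt + KS)⁻¹ (v / 4 / (2 * R * (B * (Kt + KS)) + 1))) with hκ
  have hκ0 : 0 < κ := by positivity
  refine ⟨η, κ, Kh, hη0, hκ0, hKh0, ?_⟩
  intro p q ι _ d b s lam ρbar ρS ρt ρh D hs hlam hsl hsl2 hρbar hσ hcompat happrox' hstar hgood
    ht hh
  have hwpop : ∀ j, (sigmaSq F m d b ρS j)⁻¹ ≤ v⁻¹ := fun j => inv_anti₀ hv (hσ j)
  have hcompat1 := hcompat.one hs hv hwpop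
  have hslam : 32 * (s * lam ^ 2) ≤ c * v / 2 := by
    have := hsl2.trans (min_le_left _ _)
    linarith
  have hGB : ∀ j k, |Ghat d b D j k| ≤ B := fun j k => by
    simp only [Ghat, Matrix.of_apply]
    refine abs_avg_le hB0 fun i => ?_
    rw [abs_mul]
    exact mul_le_mul ((hgood.bounded i).2.1 j) ((hgood.bounded i).1 k) (abs_nonneg _) hCd
  -- the first step, with identity weights
  have hone : (1 : Matrix (Fin q) (Fin q) ℝ) = Matrix.diagonal 1 := Matrix.diagonal_one.symm
  rw [hone] at ht
  have htilde : ∑ k, |(ρt - ρbar) k| ≤ Kt * (s * lam) :=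
    sum_abs_pgmm_sub_le (wl := 1) (wh := 1) one_pos (fun _ => le_rfl) (fun _ => le_rfl)
      zero_le_one (by positivity) hs hlam hK hρbar hB0 hη0.le hη1
      (hηw 1 zero_le_one (by rw [hwm]; linarith [inv_pos.2 (half_pos hv)])) hslam hcompat1 happrox'
      hgood.moment hgood.jacobian hGB ht
  -- the estimated weights
  have hsl0 : 0 ≤ s * lam := by positivity
  have hsmall : (Kt + KS) * (s * lam) ≤ 1 := by
    have h1 := hsl.trans ((min_le_right _ _).trans (min_le_left _ _))
    calc (Kt + KS) * (s * lam) ≤ (Kt + KS) * (Kt + KS)⁻¹ :=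
          mul_le_mul_of_nonneg_left h1 (by positivity)
      _ = 1 := mul_inv_cancel₀ (by positivity)
  have hKtS : 0 ≤ Kt * (s * lam) := by positivity
  have hKSS : 0 ≤ KS * (s * lam) := by positivity
  have hRof : ∀ ρ : Fin p → ℝ, ∑ k, |(ρ - ρbar) k| ≤ 1 → Cm + Cd * Cb * ∑ k, |ρ k| ≤ R :=
    fun ρ hρ => by
      have h1 := sum_abs_le_add ρ ρbar
      have : B * ∑ k, |ρ k| ≤ B * (A + 1) := mul_le_mul_of_nonneg_left (by linarith) hB0
      rw [hR]; linarith
  have hRt := hRof ρt (by linarith)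
  have hRS := hRof ρS (by linarith)
  have hup : ∀ j, sigmaHatSq m d b D ρt j ≤ R ^ 2 := sigmaHatSq_le hgood.bounded hCd hRt
  have hlow : ∀ j, v / 2 ≤ sigmaHatSq m d b D ρt j := fun j => by
    have h1 := sigmaHatSq_le_add hgood.bounded hCb hCd hR0.le hRS hRt j
    have h2 := (abs_le.1 (hgood.variance j)).1
    have h3 := hσ j
    have h4 : ∑ k, |(ρS - ρt) k| ≤ (Kt + KS) * (s * lam) := by
      linarith [sum_abs_sub_le ρS ρbar ρt]
    have h5 : 2 * R * (B * ∑ k, |(ρS - ρt) k|) ≤ v / 4 := by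
      have h6 := hsl.trans ((min_le_right _ _).trans (min_le_right _ _))
      rw [le_div_iff₀ (by positivity)] at h6
      have h7 : 2 * R * (B * ∑ k, |(ρS - ρt) k|) ≤ 2 * R * (B * ((Kt + KS) * (s * lam))) :=
        mul_le_mul_of_nonneg_left (mul_le_mul_of_nonneg_left h4 hB0) (by positivity)
      linarith
    linarith
  have hlow0 : ∀ j, 0 < sigmaHatSq m d b D ρt j := fun j => (half_pos hv).trans_le (hlow j)
  -- the second step
  exact sum_abs_pgmm_sub_le (wl := (R ^ 2)⁻¹) (wh := (v / 2)⁻¹) (by positivity)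
    (fun j => inv_anti₀ (hlow0 j) (hup j)) (fun j => inv_anti₀ (half_pos hv) (hlow j))
    (by positivity) (by positivity) hs hlam hK hρbar hB0 hη0.le hη1
    (hηw _ (by positivity) (by rw [hwm]; linarith)) hslam hcompat1 happrox'
    hgood.moment hgood.jacobian hGB hh

end TwoStep


/-! ### Events with probability tending to one -/

section WithHighProb

variable {Ω : Type*} [MeasurableSpace Ω] {P : Measure Ω}

/-- The events `A n` have probability tending to one. The complement is measured by the outer
measure, so no measurability is required. -/
def WithHighProb (P : Measure Ω) (A : ℕ → Ω → Prop) : Prop :=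
  Tendsto (fun n => P {ω | ¬ A n ω}) atTop (𝓝 0)

lemma WithHighProb.mono {A B : ℕ → Ω → Prop} (hA : WithHighProb P A)
    (h : ∀ᶠ n in atTop, ∀ ω, A n ω → B n ω) : WithHighProb P B := by
  refine tendsto_of_tendsto_of_tendsto_of_le_of_le' tendsto_const_nhds hA
    (Eventually.of_forall fun _ => zero_le) ?_
  filter_upwards [h] with n hn
  exact measure_mono fun ω hω hAω => hω (hn ω hAω)

lemma WithHighProb.and {A B : ℕ → Ω → Prop} (hA : WithHighProb P A) (hB : WithHighProb P B) :
    WithHighProb P fun n ω => A n ω ∧ B n ω := by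
  have h := Tendsto.add hA hB
  rw [add_zero] at h
  refine tendsto_of_tendsto_of_tendsto_of_le_of_le tendsto_const_nhds h
    (fun _ => zero_le) fun n => ?_
  refine (measure_mono fun ω hω => ?_).trans (measure_union_le _ _)
  simp only [Set.mem_ofPred_eq, not_and_or] at hω
  exact hω

lemma WithHighProb.of_ae {A : ℕ → Ω → Prop} (h : ∀ᶠ n in atTop, ∀ᵐ ω ∂P, A n ω) :
    WithHighProb P A :=
  tendsto_const_nhds.congr' (by filter_upwards [h] with n hn using (ae_iff.1 hn).symm)

lemma WithHighProb.forall {ι : Type*} [Finite ι] {A : ι → ℕ → Ω → Prop}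
    (h : ∀ i, WithHighProb P (A i)) : WithHighProb P fun n ω => ∀ i, A i n ω := by
  have := Fintype.ofFinite ι
  have hs : Tendsto (fun n => ∑ i, P {ω | ¬ A i n ω}) atTop (𝓝 (∑ _i : ι, 0)) :=
    tendsto_finsetSum _ fun i _ => h i
  simp only [Finset.sum_const_zero] at hs
  refine tendsto_of_tendsto_of_tendsto_of_le_of_le tendsto_const_nhds hs (fun _ => zero_le)
    fun n => ?_
  refine (measure_mono fun ω hω => ?_).trans (measure_iUnion_fintype_le P _)
  simp only [Set.mem_ofPred_eq, not_forall] at hω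
  exact Set.mem_iUnion.2 hω

lemma TendstoZeroInProb.withHighProb {X : ℕ → Ω → ℝ≥0∞} (h : TendstoZeroInProb P X) {δ : ℝ}
    (hδ : 0 < δ) : WithHighProb P fun n ω => X n ω < ENNReal.ofReal δ := by
  have := h δ hδ
  simpa only [WithHighProb, not_lt] using this

lemma IsBigOP.withHighProb_mul_le {X : ℕ → Ω → ℝ≥0∞} {r a : ℕ → ℝ} (h : IsBigOP P X r)
    (ha : ∀ n, 0 ≤ a n) (har : Tendsto (fun n => a n * r n) atTop (𝓝 0)) {δ : ℝ} (hδ : 0 < δ) :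
    WithHighProb P fun n ω => ENNReal.ofReal (a n) * X n ω ≤ ENNReal.ofReal δ := by
  refine ENNReal.tendsto_nhds_zero.2 fun ε hε => ?_
  obtain ⟨e, he, heε⟩ : ∃ e : ℝ, 0 < e ∧ ENNReal.ofReal e ≤ ε := by
    obtain ⟨e, -, he, h2⟩ := ENNReal.lt_iff_exists_real_btwn.1 hε
    exact ⟨e, ENNReal.ofReal_pos.1 he, h2.le⟩
  obtain ⟨C, hC, hev⟩ := h e he
  have h2 : ∀ᶠ n in atTop, a n * r n < δ / C :=
    har.eventually (gt_mem_nhds (by positivity))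
  filter_upwards [hev, h2] with n hn hn2
  refine (measure_mono fun ω hω => ?_).trans (hn.trans heε)
  simp only [Set.mem_ofPred_eq, not_le] at hω ⊢
  by_contra! hcon
  refine absurd hω (not_lt.2 ?_)
  calc ENNReal.ofReal (a n) * X n ω ≤ ENNReal.ofReal (a n) * ENNReal.ofReal (C * r n) := by gcongr
    _ = ENNReal.ofReal (a n * (C * r n)) := (ENNReal.ofReal_mul (ha n)).symm
    _ ≤ ENNReal.ofReal δ := ENNReal.ofReal_le_ofReal (by
        rw [lt_div_iff₀ hC] at hn2; linarith)

lemma tendstoInMeasure_of_withHighProb {f : ℕ → Ω → ℝ} {g : Ω → ℝ}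
    (h : ∀ ε : ℝ, 0 < ε → WithHighProb P fun n ω => |f n ω - g ω| < ε) :
    TendstoInMeasure P f atTop g := by
  rw [tendstoInMeasure_iff_norm]
  intro ε hε
  simpa only [WithHighProb, not_lt, Real.norm_eq_abs] using h ε hε

lemma withHighProb_of_tendstoInMeasure {f : ℕ → Ω → ℝ} {g : Ω → ℝ}
    (h : TendstoInMeasure P f atTop g) {ε : ℝ} (hε : 0 < ε) :
    WithHighProb P fun n ω => |f n ω - g ω| < ε := by
  rw [tendstoInMeasure_iff_norm] at h
  simpa only [WithHighProb, not_lt, Real.norm_eq_abs] using h ε hε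

lemma withHighProb_of_forall_le_add {A : ℕ → Ω → Prop} {g : ℝ → ℕ → Ω → Prop} {c : ℝ}
    (hc : 0 ≤ c) (hg : ∀ η : ℝ, 0 < η → WithHighProb P (g η))
    (h : ∀ η : ℝ, 0 < η → ∀ᶠ n in atTop,
      P {ω | ¬ A n ω} ≤ P {ω | ¬ g η n ω} + ENNReal.ofReal (c * η)) :
    WithHighProb P A := by
  refine ENNReal.tendsto_nhds_zero.2 fun ε hε => ?_
  obtain ⟨e, he, heε⟩ : ∃ e : ℝ, 0 < e ∧ ENNReal.ofReal e ≤ ε := by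
    obtain ⟨e, -, he, h2⟩ := ENNReal.lt_iff_exists_real_btwn.1 hε
    exact ⟨e, ENNReal.ofReal_pos.1 he, h2.le⟩
  set η := e / 2 / (c + 1) with hη
  have hη0 : 0 < η := by positivity
  have hcη : c * η ≤ e / 2 := by
    rw [hη, ← mul_div_assoc, div_le_iff₀ (by positivity)]
    nlinarith
  have h1 := ENNReal.tendsto_nhds_zero.1 (hg η hη0) (ENNReal.ofReal (e / 2))
    (by simpa using half_pos he)
  filter_upwards [h η hη0, h1] with n hn hn1
  calc P {ω | ¬ A n ω} ≤ ENNReal.ofReal (e / 2) + ENNReal.ofReal (e / 2) :=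
        hn.trans (add_le_add hn1 (ENNReal.ofReal_le_ofReal hcη))
    _ = ENNReal.ofReal e := by
        rw [← ENNReal.ofReal_add (by linarith) (by linarith), add_halves]
    _ ≤ ε := heε

end WithHighProb

/-! ### Concentration of the sample moments -/

section Concentration

variable {𝒳 𝒵 Ω : Type*} [MeasurableSpace 𝒳] [MeasurableSpace 𝒵] [MeasurableSpace Ω]
  {P : Measure Ω} [IsProbabilityMeasure P] {F : Measure (Obs 𝒳 𝒵)}
  {W : ℕ → Ω → Obs 𝒳 𝒵}

/-- Hoeffding's inequality for the average of a bounded function over a subsample. -/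
lemma measure_abs_avg_sub_gt_le (hWmeas : ∀ i, Measurable (W i)) (hWlaw : ∀ i, P.map (W i) = F)
    (hWindep : iIndepFun W P) {ι : Type*} [Fintype ι] {e : ι → ℕ} (he : e.Injective)
    {f : Obs 𝒳 𝒵 → ℝ} (hf : Measurable f) {B t : ℝ} (hB : 0 < B) (ht : 0 < t)
    (hfB : ∀ᵐ w ∂F, |f w| ≤ B) :
    P {ω | ¬ |avg (fun i => W (e i) ω) f - ∫ w, f w ∂F| ≤ t}
      ≤ ENNReal.ofReal (2 * Real.exp (-(Fintype.card ι * t ^ 2 / (2 * B ^ 2)))) := by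
  rcases isEmpty_or_nonempty ι with hι | hι
  · have : (1 : ℝ≥0∞) ≤ ENNReal.ofReal
        (2 * Real.exp (-(Fintype.card ι * t ^ 2 / (2 * B ^ 2)))) := by simp
    exact prob_le_one.trans this
  have hN : (0 : ℝ) < Fintype.card ι := by exact_mod_cast Fintype.card_pos
  have hint : ∀ i, ∫ ω, f (W (e i) ω) ∂P = ∫ w, f w ∂F := fun i => by
    rw [← hWlaw (e i), integral_map (hWmeas _).aemeasurable hf.aestronglyMeasurable]
  have hsub : ∀ i, HasSubgaussianMGF (fun ω => f (W (e i) ω) - ∫ w, f w ∂F)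
      ((‖B - -B‖₊ / 2) ^ 2) P := fun i => by
    have h := hasSubgaussianMGF_of_mem_Icc (μ := P) (X := fun ω => f (W (e i) ω)) (a := -B) (b := B)
      (hf.comp (hWmeas _)).aemeasurable (by
        have h1 : ∀ᵐ w ∂(P.map (W (e i))), |f w| ≤ B := by rw [hWlaw]; exact hfB
        filter_upwards [ae_of_ae_map (hWmeas _).aemeasurable h1] with ω hω
        exact abs_le.1 hω)
    rwa [hint i] at h
  have hindep : iIndepFun (fun i ω => f (W (e i) ω) - ∫ w, f w ∂F) P :=
    (hWindep.precomp he).comp (fun _ w => f w - ∫ w, f w ∂F) fun _ => hf.sub_const _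
  have hindep' : iIndepFun (fun i ω => -(f (W (e i) ω) - ∫ w, f w ∂F)) P :=
    hindep.comp (fun _ x => -x) fun _ => measurable_neg
  have hε : 0 ≤ Fintype.card ι * t := by positivity
  have h1 := HasSubgaussianMGF.measure_sum_ge_le_of_iIndepFun hindep (s := Finset.univ) (fun i _ => hsub i) hε
  have h2 := HasSubgaussianMGF.measure_sum_ge_le_of_iIndepFun hindep' (s := Finset.univ)
    (fun i _ => (hsub i).neg) hε
  have hc : (∑ _i : ι, (((‖B - -B‖₊ / 2) ^ 2 : ℝ≥0) : ℝ)) = Fintype.card ι * B ^ 2 := by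
    have : ((‖B - -B‖₊ / 2 : ℝ≥0) : ℝ) = B := by
      push_cast
      rw [Real.norm_eq_abs, abs_of_pos (by linarith)]; ring
    rw [Finset.sum_const, Finset.card_univ, nsmul_eq_mul, NNReal.coe_pow, this]
  have hexp : -(Fintype.card ι * t) ^ 2 / (2 * (Fintype.card ι * B ^ 2))
      = -(Fintype.card ι * t ^ 2 / (2 * B ^ 2)) := by
    field_simp
  push_cast at h1 h2 hc
  rw [hc, hexp] at h1 h2
  rw [← ENNReal.ofReal_toReal (measure_ne_top P _)]
  refine ENNReal.ofReal_le_ofReal ?_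
  have hsum : ∀ ω, ∑ i, (f (W (e i) ω) - ∫ w, f w ∂F)
      = Fintype.card ι * (avg (fun i => W (e i) ω) f - ∫ w, f w ∂F) := fun ω => by
    rw [avg, mul_sub, mul_inv_cancel_left₀ hN.ne']
    simp
  calc (P {ω | ¬ |avg (fun i => W (e i) ω) f - ∫ w, f w ∂F| ≤ t}).toReal
      ≤ P.real ({ω | Fintype.card ι * t ≤ ∑ i, (f (W (e i) ω) - ∫ w, f w ∂F)}
          ∪ {ω | Fintype.card ι * t ≤ ∑ i, -(f (W (e i) ω) - ∫ w, f w ∂F)}) := by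
        refine measureReal_mono fun ω hω => ?_
        simp only [Set.mem_ofPred_eq, not_le] at hω
        rcases lt_abs.1 hω with h | h
        · refine Or.inl ?_
          simp only [Set.mem_ofPred_eq, hsum]
          exact mul_le_mul_of_nonneg_left h.le hN.le
        · refine Or.inr ?_
          simp only [Set.mem_ofPred_eq, Finset.sum_neg_distrib, hsum, ← mul_neg]
          exact mul_le_mul_of_nonneg_left h.le hN.le
    _ ≤ _ := (measureReal_union_le _ _).trans (by linarith)

lemma card_trainIdx {n L : ℕ} (fold : Fin n → Fin L) (ℓ : Fin L) :
    (Fintype.card (TrainIdx fold ℓ) : ℝ) = n - foldSize fold ℓ := by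
  have h1 := Fintype.card_subtype_compl fun i : Fin n => fold i = ℓ
  have h2 : Fintype.card {i : Fin n // fold i = ℓ} = foldSize fold ℓ := Fintype.card_subtype _
  have h3 : foldSize fold ℓ ≤ n := by
    unfold foldSize
    exact (Finset.card_le_univ _).trans (Fintype.card_fin n).le
  rw [h2, Fintype.card_fin] at h1
  rw [← Nat.cast_sub h3, ← h1]

lemma eventually_le_card_trainIdx {L : ℕ} (hL : 2 ≤ L) {fold : (n : ℕ) → Fin n → Fin L} {ℓ : Fin L}
    (hfold : Tendsto (fun n : ℕ => (foldSize (fold n) ℓ : ℝ) / n) atTop (𝓝 (1 / (L : ℝ)))) :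
    ∀ᶠ n : ℕ in atTop, (n : ℝ) / 4 ≤ Fintype.card (TrainIdx (fold n) ℓ) := by
  have hL' : (1 : ℝ) / L < 3 / 4 := by
    have : (2 : ℝ) ≤ L := by exact_mod_cast hL
    rw [div_lt_iff₀ (by linarith)]; linarith
  filter_upwards [hfold.eventually (gt_mem_nhds hL'), eventually_gt_atTop 0] with n hn hn0
  have hn0' : (0 : ℝ) < n := by exact_mod_cast hn0
  rw [div_lt_iff₀ hn0'] at hn
  rw [card_trainIdx]
  linarith

/-- Uniform concentration over at most `q²` uniformly bounded functions, at any tolerance `t` with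
`√(log q / n) = o(t)`. -/
lemma withHighProb_forall_abs_avg_sub_le (hWmeas : ∀ i, Measurable (W i))
    (hWlaw : ∀ i, P.map (W i) = F) (hWindep : iIndepFun W P) {L : ℕ} (hL : 2 ≤ L)
    {fold : (n : ℕ) → Fin n → Fin L} {ℓ : Fin L}
    (hfold : Tendsto (fun n : ℕ => (foldSize (fold n) ℓ : ℝ) / n) atTop (𝓝 (1 / (L : ℝ))))
    {q : ℕ → ℕ} (hq : ∀ᶠ n in atTop, 2 ≤ q n) {t : ℕ → ℝ} (ht : ∀ n, 0 < t n)
    (hqt : (fun n : ℕ => Real.sqrt (Real.log (q n) / n)) =o[atTop] t)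
    {ι : ℕ → Type*} [∀ n, Fintype (ι n)] (hι : ∀ᶠ n in atTop, Fintype.card (ι n) ≤ q n ^ 2)
    {f : (n : ℕ) → ι n → Obs 𝒳 𝒵 → ℝ} (hf : ∀ n j, Measurable (f n j)) {B : ℝ} (hB : 0 < B)
    (hfB : ∀ᶠ n in atTop, ∀ j, ∀ᵐ w ∂F, |f n j w| ≤ B) :
    WithHighProb P fun n ω => ∀ j,
      |avg (train (fold n) ℓ (sample W n ω)) (f n j) - ∫ w, f n j w ∂F| ≤ t n := by
  have hlog2 : 0 < Real.log 2 := Real.log_pos one_lt_two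
  -- the exponent of the union bound diverges, because `n t² / log q → ∞` and `log q ≥ log 2`
  have hexp : Tendsto (fun n : ℕ => 2 * Real.log (q n) - n / 4 * t n ^ 2 / (2 * B ^ 2)) atTop
      atBot := by
    rw [tendsto_atBot]
    intro c
    set k := |c| / Real.log 2 with hk
    have hk0 : 0 ≤ k := by positivity
    set M := 8 * B ^ 2 * (2 + k) with hM
    have hM0 : 0 < M := by positivity
    filter_upwards [hqt.def (c := (Real.sqrt M)⁻¹) (by positivity), hq, eventually_gt_atTop 0]
      with n hn hqn hn0
    have hn0' : (0 : ℝ) < n := by exact_mod_cast hn0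
    have hq2 : (2 : ℝ) ≤ q n := by exact_mod_cast hqn
    have hlq : Real.log 2 ≤ Real.log (q n) := Real.log_le_log two_pos hq2
    rw [Real.norm_of_nonneg (Real.sqrt_nonneg _), Real.norm_of_nonneg (ht n).le,
      ← div_eq_inv_mul, le_div_iff₀ (by positivity), ← Real.sqrt_mul' _ hM0.le] at hn
    have h1 : Real.log (q n) / n * M ≤ t n ^ 2 := (Real.sqrt_le_left (ht n).le).1 hn
    have h2 : Real.log (q n) * M ≤ n * t n ^ 2 := by
      have := mul_le_mul_of_nonneg_left h1 hn0'.le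
      have e : (n : ℝ) * (Real.log (q n) / n * M) = Real.log (q n) * M := by field_simp
      linarith
    have h3 : (2 + k) * Real.log (q n) ≤ n / 4 * t n ^ 2 / (2 * B ^ 2) := by
      rw [le_div_iff₀ (by positivity)]
      have : Real.log (q n) * M = (2 + k) * Real.log (q n) * (2 * B ^ 2) * 4 := by rw [hM]; ring
      linarith
    have h4 : |c| ≤ k * Real.log (q n) := by
      calc |c| = k * Real.log 2 := by rw [hk]; field_simp
        _ ≤ _ := mul_le_mul_of_nonneg_left hlq hk0
    linarith [neg_abs_le c]
  have hlim : Tendsto (fun n : ℕ => ENNReal.ofReal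
      (2 * Real.exp (2 * Real.log (q n) - n / 4 * t n ^ 2 / (2 * B ^ 2)))) atTop (𝓝 0) := by
    have := ENNReal.tendsto_ofReal ((Real.tendsto_exp_atBot.comp hexp).const_mul 2)
    simpa using this
  refine tendsto_of_tendsto_of_tendsto_of_le_of_le' tendsto_const_nhds hlim
    (Eventually.of_forall fun _ => zero_le) ?_
  filter_upwards [eventually_le_card_trainIdx hL hfold, hι, hfB, hq] with n hcard hιn hfn hqn
  have hinj : Function.Injective fun i : TrainIdx (fold n) ℓ => ((i : Fin n) : ℕ) :=
    Fin.val_injective.comp Subtype.val_injective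
  have hq0 : (0 : ℝ) < q n := by exact_mod_cast (by omega : 0 < q n)
  calc P {ω | ¬ ∀ j, |avg (train (fold n) ℓ (sample W n ω)) (f n j) - ∫ w, f n j w ∂F| ≤ t n}
      ≤ P (⋃ j, {ω | ¬ |avg (train (fold n) ℓ (sample W n ω)) (f n j) - ∫ w, f n j w ∂F|
          ≤ t n}) := measure_mono fun ω hω => by
        simp only [Set.mem_ofPred_eq, not_forall] at hω
        exact Set.mem_iUnion.2 hω
    _ ≤ ∑ j, P {ω | ¬ |avg (train (fold n) ℓ (sample W n ω)) (f n j) - ∫ w, f n j w ∂F|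
          ≤ t n} := measure_iUnion_fintype_le P _
    _ ≤ ∑ _j : ι n, ENNReal.ofReal (2 * Real.exp (-(n / 4 * t n ^ 2 / (2 * B ^ 2)))) := by
        refine Finset.sum_le_sum fun j _ => ?_
        refine (measure_abs_avg_sub_gt_le hWmeas hWlaw hWindep hinj (hf n j) hB (ht n)
          (hfn j)).trans (ENNReal.ofReal_le_ofReal ?_)
        gcongr
    _ = ENNReal.ofReal
          (Fintype.card (ι n) * (2 * Real.exp (-(n / 4 * t n ^ 2 / (2 * B ^ 2))))) := by
        rw [ENNReal.ofReal_mul (Nat.cast_nonneg _), ENNReal.ofReal_natCast, Finset.sum_const,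
          Finset.card_univ, nsmul_eq_mul]
    _ ≤ _ := by
        refine ENNReal.ofReal_le_ofReal ?_
        have h1 : (Fintype.card (ι n) : ℝ) ≤ Real.exp (2 * Real.log (q n)) := by
          have : Real.exp (2 * Real.log (q n)) = (q n : ℝ) ^ 2 := by
            rw [two_mul, Real.exp_add, Real.exp_log hq0, sq]
          rw [this]
          exact_mod_cast hιn
        rw [sub_eq_add_neg, Real.exp_add]
        have := mul_le_mul_of_nonneg_right h1
          (show 0 ≤ 2 * Real.exp (-(n / 4 * t n ^ 2 / (2 * B ^ 2))) by positivity)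
        linarith

end Concentration


/-! ### Sums over the held-out fold, conditionally on the training sample -/

section CrossFitting

lemma memLp_two_of_lintegral_sq_le {β : Type*} [MeasurableSpace β] {F : Measure β} {f : β → ℝ} (hf : AEStronglyMeasurable f F) {c : ℝ≥0∞}
    (hc : c ≠ ∞) (h : ∫⁻ w, ENNReal.ofReal (f w ^ 2) ∂F ≤ c) : MemLp f 2 F := by
  rw [memLp_two_iff_integrable_sq hf]
  refine ⟨hf.pow 2, ?_⟩
  rw [hasFiniteIntegral_iff_ofReal (ae_of_all _ fun _ => sq_nonneg _)]
  exact h.trans_lt (lt_top_iff_ne_top.2 hc)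

section Product

variable {α β ι : Type*} [MeasurableSpace α] [MeasurableSpace β] [Fintype ι]
  {μ : Measure α} [IsProbabilityMeasure μ] {F : Measure β} [IsProbabilityMeasure F]

lemma prod_le_add_of_forall_mem {γ : Type*} [MeasurableSpace γ] {ν : Measure γ}
    [IsProbabilityMeasure ν] {S : Set (α × γ)} (hS : MeasurableSet S) {G : Set α} {c : ℝ≥0∞}
    (h : ∀ a ∈ G, ν (Prod.mk a ⁻¹' S) ≤ c) : μ.prod ν S ≤ μ Gᶜ + c := by
  rw [Measure.prod_apply hS]
  calc ∫⁻ a, ν (Prod.mk a ⁻¹' S) ∂μ ≤ ∫⁻ a, (Gᶜ.indicator 1 a + c) ∂μ := by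
        refine lintegral_mono fun a => ?_
        by_cases ha : a ∈ G
        · simpa [ha] using h a ha
        · simp only [Set.mem_compl_iff, ha, not_false_eq_true, Set.indicator_of_mem, Pi.one_apply]
          exact prob_le_one.trans le_self_add
    _ = ∫⁻ a, Gᶜ.indicator 1 a ∂μ + c := by
        rw [lintegral_add_right _ measurable_const]; simp
    _ ≤ _ := by gcongr; exact lintegral_indicator_one_le _

/-- Markov's inequality for a sum of squares over an independent sample. -/
lemma pi_sum_sq_ge_le {f : β → ℝ} (hf : Measurable f) {η t : ℝ} (ht : 0 < t)
    (hfη : ∫⁻ w, ENNReal.ofReal (f w ^ 2) ∂F ≤ ENNReal.ofReal η) :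
    Measure.pi (fun _ : ι => F) {u | t ≤ ∑ i, f (u i) ^ 2}
      ≤ ENNReal.ofReal (Fintype.card ι * η / t) := by
  have hset : {u : ι → β | t ≤ ∑ i, f (u i) ^ 2}
      = {u | ENNReal.ofReal t ≤ ∑ i, ENNReal.ofReal (f (u i) ^ 2)} := by
    ext u
    simp only [Set.mem_ofPred_eq]
    rw [← ENNReal.ofReal_sum_of_nonneg fun i _ => sq_nonneg _, ENNReal.ofReal_le_ofReal_iff]
    exact Finset.sum_nonneg fun i _ => sq_nonneg _
  have hmeas : Measurable fun u : ι → β => ∑ i, ENNReal.ofReal (f (u i) ^ 2) := by fun_prop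
  rw [hset]
  refine (meas_ge_le_lintegral_div hmeas.aemeasurable (by simpa using ht)
    ENNReal.ofReal_ne_top).trans ?_
  rw [lintegral_finsetSum _ fun i _ => by fun_prop]
  have h1 : ∀ i : ι, ∫⁻ u, ENNReal.ofReal (f (u i) ^ 2) ∂(Measure.pi fun _ : ι => F)
      = ∫⁻ w, ENNReal.ofReal (f w ^ 2) ∂F := fun i =>
    (measurePreserving_eval (fun _ : ι => F) i).lintegral_comp
      (f := fun w => ENNReal.ofReal (f w ^ 2)) (by fun_prop)
  simp only [h1, Finset.sum_const, Finset.card_univ, nsmul_eq_mul]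
  rw [ENNReal.ofReal_div_of_pos ht, ENNReal.ofReal_mul (Nat.cast_nonneg _), ENNReal.ofReal_natCast]
  gcongr

/-- Chebyshev's inequality for a sum over an independent sample, when the mean of the summands is
small. -/
lemma pi_abs_sum_ge_le {f : β → ℝ} (hf : Measurable f) {η t : ℝ} (hη : 0 ≤ η) (ht : 0 < t)
    (hfη : ∫⁻ w, ENNReal.ofReal (f w ^ 2) ∂F ≤ ENNReal.ofReal η)
    (hmean : Fintype.card ι * |∫ w, f w ∂F| ≤ t / 2) :
    Measure.pi (fun _ : ι => F) {u | t ≤ |∑ i, f (u i)|}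
      ≤ ENNReal.ofReal (Fintype.card ι * η / (t / 2) ^ 2) := by
  have hf2 : MemLp f 2 F :=
    memLp_two_of_lintegral_sq_le hf.aestronglyMeasurable ENNReal.ofReal_ne_top hfη
  set X : (ι → β) → ℝ := ∑ i, fun u => f (u i) with hX
  have hXu : ∀ u, X u = ∑ i, f (u i) := fun u => by simp [hX]
  have hmp : ∀ i : ι, MeasurePreserving (Function.eval i) (Measure.pi fun _ : ι => F) F :=
    fun i => measurePreserving_eval (fun _ : ι => F) i
  have hfi : ∀ i : ι, MemLp (fun u : ι → β => f (u i)) 2 (Measure.pi fun _ : ι => F) :=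
    fun i => hf2.comp_measurePreserving (hmp i)
  have hX2 : MemLp X 2 (Measure.pi fun _ : ι => F) := memLp_finsetSum' _ fun i _ => hfi i
  have hXint : ∫ u, X u ∂(Measure.pi fun _ : ι => F) = Fintype.card ι * ∫ w, f w ∂F := by
    simp only [hXu]
    rw [integral_finsetSum _ fun i _ => (hfi i).integrable one_le_two]
    have : ∀ i : ι, ∫ u, f (u i) ∂(Measure.pi fun _ : ι => F) = ∫ w, f w ∂F := fun i => by
      have h1 := integral_map (μ := Measure.pi fun _ : ι => F) (hmp i).measurable.aemeasurable
        (f := f) (by rw [(hmp i).map_eq]; exact hf.aestronglyMeasurable)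
      rw [(hmp i).map_eq] at h1
      exact h1.symm
    simp [this]
  have hvar : Var[X; Measure.pi fun _ : ι => F] ≤ Fintype.card ι * η := by
    rw [hX, variance_sum_pi (μ := fun _ : ι => F) (X := fun _ => f) fun _ => hf2]
    have h1 : Var[f; F] ≤ η := by
      refine (variance_le_expectation_sq hf.aestronglyMeasurable).trans ?_
      have h2 : ∫ w, (f ^ 2) w ∂F = (∫⁻ w, ENNReal.ofReal (f w ^ 2) ∂F).toReal :=
        integral_eq_lintegral_of_nonneg_ae (ae_of_all _ fun _ => sq_nonneg _)
          (hf.pow_const 2).aestronglyMeasurable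
      rw [h2]
      exact ENNReal.toReal_le_of_le_ofReal hη hfη
    simp only [Finset.sum_const, Finset.card_univ, nsmul_eq_mul]
    exact mul_le_mul_of_nonneg_left h1 (Nat.cast_nonneg _)
  calc Measure.pi (fun _ : ι => F) {u | t ≤ |∑ i, f (u i)|}
      ≤ Measure.pi (fun _ : ι => F)
          {u | t / 2 ≤ |X u - ∫ u, X u ∂(Measure.pi fun _ : ι => F)|} := by
        refine measure_mono fun u hu => ?_
        simp only [Set.mem_ofPred_eq] at hu ⊢
        rw [hXint, hXu]
        have h1 := abs_sub_abs_le_abs_sub (∑ i, f (u i)) (Fintype.card ι * ∫ w, f w ∂F)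
        rw [abs_mul, Nat.abs_cast] at h1
        linarith
    _ ≤ _ := (meas_ge_le_variance_div_sq hX2 (half_pos ht)).trans
        (ENNReal.ofReal_le_ofReal (by gcongr))

end Product

variable {𝒳 𝒵 Ω : Type*} [MeasurableSpace 𝒳] [MeasurableSpace 𝒵] [MeasurableSpace Ω]
  {P : Measure Ω} [IsProbabilityMeasure P] {F : Measure (Obs 𝒳 𝒵)} [IsProbabilityMeasure F]
  {W : ℕ → Ω → Obs 𝒳 𝒵}

/-- The training sample and the held-out sample are independent: their joint law is a product. -/
lemma measurePreserving_train_prod (hWmeas : ∀ i, Measurable (W i)) (hWlaw : ∀ i, P.map (W i) = F)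
    (hWindep : iIndepFun W P) {n L : ℕ} (fold : Fin n → Fin L) (ℓ : Fin L) :
    MeasurePreserving (fun ω => (train fold ℓ (sample W n ω),
        fun i : {i : Fin n // ¬ fold i ≠ ℓ} => W (i : Fin n) ω)) P
      ((Measure.pi fun _ : TrainIdx fold ℓ => F).prod
        (Measure.pi fun _ : {i : Fin n // ¬ fold i ≠ ℓ} => F)) := by
  have h1 : MeasurePreserving (fun ω (i : Fin n) => W i ω) P (Measure.pi fun _ : Fin n => F) := by
    refine ⟨measurable_pi_lambda _ fun i => hWmeas i, ?_⟩
    rw [(iIndepFun_iff_map_fun_eq_pi_map fun i : Fin n => (hWmeas i).aemeasurable).1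
      (hWindep.precomp Fin.val_injective)]
    simp only [hWlaw]
  exact (measurePreserving_piEquivPiSubtypeProd (fun _ : Fin n => F) fun i => fold i ≠ ℓ).comp h1

lemma sum_filter_fold_eq {n L : ℕ} (fold : Fin n → Fin L) (ℓ : Fin L) (g : Fin n → ℝ) :
    ∑ i ∈ Finset.univ.filter (fun i => fold i = ℓ), g i
      = ∑ i : {i : Fin n // ¬ fold i ≠ ℓ}, g i :=
  (Finset.sum_subtype _ (fun i => by simp) g)

lemma card_heldOut_le {n L : ℕ} (fold : Fin n → Fin L) (ℓ : Fin L) :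
    Fintype.card {i : Fin n // ¬ fold i ≠ ℓ} ≤ n :=
  (Fintype.card_subtype_le _).trans (Fintype.card_fin n).le

/-- Conditionally on a training sample in `G`, the held-out sample violates the event `S` with
probability at most `c`. -/
lemma measure_train_le (hWmeas : ∀ i, Measurable (W i)) (hWlaw : ∀ i, P.map (W i) = F)
    (hWindep : iIndepFun W P) {n L : ℕ} (fold : Fin n → Fin L) (ℓ : Fin L)
    {S : Set ((TrainIdx fold ℓ → Obs 𝒳 𝒵) × ({i : Fin n // ¬ fold i ≠ ℓ} → Obs 𝒳 𝒵))}
    (hS : MeasurableSet S) {G : Set (TrainIdx fold ℓ → Obs 𝒳 𝒵)} (hG : MeasurableSet G)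
    {c : ℝ≥0∞}
    (h : ∀ D ∈ G, Measure.pi (fun _ : {i : Fin n // ¬ fold i ≠ ℓ} => F) (Prod.mk D ⁻¹' S) ≤ c) :
    P {ω | (train fold ℓ (sample W n ω),
        fun i : {i : Fin n // ¬ fold i ≠ ℓ} => W (i : Fin n) ω) ∈ S}
      ≤ P {ω | train fold ℓ (sample W n ω) ∉ G} + c := by
  have hmp := measurePreserving_train_prod hWmeas hWlaw hWindep fold ℓ
  have h1 := hmp.measure_preimage hS.nullMeasurableSet
  have h2 := (measurePreserving_fst.comp hmp).measure_preimage hG.compl.nullMeasurableSet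
  have h3 := prod_le_add_of_forall_mem
    (μ := Measure.pi fun _ : TrainIdx fold ℓ => F) hS h
  rw [← h1, ← h2] at h3
  exact h3

variable {L : ℕ} {fold : (n : ℕ) → Fin n → Fin L} {ℓ : Fin L}
  {h : (n : ℕ) → (TrainIdx (fold n) ℓ → Obs 𝒳 𝒵) × Obs 𝒳 𝒵 → ℝ}

/-- If the conditional second moment vanishes in probability, so does the average of squares over
the held-out fold. -/
lemma withHighProb_avg_sq_lt (hWmeas : ∀ i, Measurable (W i)) (hWlaw : ∀ i, P.map (W i) = F)
    (hWindep : iIndepFun W P) (hh : ∀ n, Measurable (h n))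
    (hsq : ∀ η : ℝ, 0 < η → WithHighProb P fun n ω =>
      ∫⁻ w, ENNReal.ofReal (h n (train (fold n) ℓ (sample W n ω), w) ^ 2) ∂F ≤ ENNReal.ofReal η)
    {δ : ℝ} (hδ : 0 < δ) :
    WithHighProb P fun n ω => (n : ℝ)⁻¹ * ∑ i ∈ Finset.univ.filter (fun i => fold n i = ℓ),
      h n (train (fold n) ℓ (sample W n ω), W i ω) ^ 2 < δ := by
  refine withHighProb_of_forall_le_add (c := δ⁻¹) (by positivity) hsq fun η hη => ?_
  filter_upwards [eventually_gt_atTop 0] with n hn0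
  have hn : (0 : ℝ) < n := by exact_mod_cast hn0
  have hS : MeasurableSet {u : (TrainIdx (fold n) ℓ → Obs 𝒳 𝒵) ×
      ({i : Fin n // ¬ fold n i ≠ ℓ} → Obs 𝒳 𝒵) | n * δ ≤ ∑ i, h n (u.1, u.2 i) ^ 2} := by
    refine measurableSet_le measurable_const (Finset.measurable_sum _ fun i _ => ?_)
    exact ((hh n).comp (measurable_fst.prodMk
      ((measurable_pi_apply i).comp measurable_snd))).pow_const 2
  have hG : MeasurableSet {D : TrainIdx (fold n) ℓ → Obs 𝒳 𝒵 |
      ∫⁻ w, ENNReal.ofReal (h n (D, w) ^ 2) ∂F ≤ ENNReal.ofReal η} := by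
    refine measurableSet_le (Measurable.lintegral_prod_right' (ν := F)
      (f := fun u => ENNReal.ofReal (h n u ^ 2)) ?_) measurable_const
    exact ((hh n).pow_const 2).ennreal_ofReal
  refine le_trans (measure_mono fun ω hω => ?_) (measure_train_le hWmeas hWlaw hWindep (fold n) ℓ
    hS hG (c := ENNReal.ofReal (δ⁻¹ * η)) fun D hD => ?_)
  · simp only [Set.mem_ofPred_eq, not_lt, sum_filter_fold_eq] at hω ⊢
    rwa [le_inv_mul_iff₀ hn] at hω
  · refine (pi_sum_sq_ge_le ((hh n).comp (measurable_const.prodMk measurable_id))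
      (by positivity) hD).trans (ENNReal.ofReal_le_ofReal ?_)
    have hcard : (Fintype.card {i : Fin n // ¬ fold n i ≠ ℓ} : ℝ) ≤ n := by
      exact_mod_cast card_heldOut_le (fold n) ℓ
    rw [div_le_iff₀ (by positivity)]
    calc (Fintype.card {i : Fin n // ¬ fold n i ≠ ℓ} : ℝ) * η ≤ n * η :=
          mul_le_mul_of_nonneg_right hcard hη.le
      _ = δ⁻¹ * η * (n * δ) := by field_simp

/-- If the conditional second moment vanishes in probability, and the conditional mean vanishes at
a rate faster than `n^{-1/2}`, then the normalized sum over the held-out fold vanishes in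
probability. -/
lemma withHighProb_abs_sum_lt (hWmeas : ∀ i, Measurable (W i)) (hWlaw : ∀ i, P.map (W i) = F)
    (hWindep : iIndepFun W P) (hh : ∀ n, Measurable (h n))
    (hsq : ∀ η : ℝ, 0 < η → WithHighProb P fun n ω =>
      ∫⁻ w, ENNReal.ofReal (h n (train (fold n) ℓ (sample W n ω), w) ^ 2) ∂F ≤ ENNReal.ofReal η)
    (hmean : ∀ η : ℝ, 0 < η → WithHighProb P fun n ω =>
      Real.sqrt n * |∫ w, h n (train (fold n) ℓ (sample W n ω), w) ∂F| ≤ η)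
    {δ : ℝ} (hδ : 0 < δ) :
    WithHighProb P fun n ω =>
      |(Real.sqrt n)⁻¹ * ∑ i ∈ Finset.univ.filter (fun i => fold n i = ℓ),
        h n (train (fold n) ℓ (sample W n ω), W i ω)| < δ := by
  refine withHighProb_of_forall_le_add (c := 4 * (δ ^ 2)⁻¹) (by positivity)
    (fun η hη => (hsq η hη).and (hmean (δ / 2) (half_pos hδ))) fun η hη => ?_
  filter_upwards [eventually_gt_atTop 0] with n hn0
  have hn : (0 : ℝ) < n := by exact_mod_cast hn0
  have hsn : 0 < Real.sqrt n := Real.sqrt_pos.2 hn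
  have hS : MeasurableSet {u : (TrainIdx (fold n) ℓ → Obs 𝒳 𝒵) ×
      ({i : Fin n // ¬ fold n i ≠ ℓ} → Obs 𝒳 𝒵) |
        Real.sqrt n * δ ≤ |∑ i, h n (u.1, u.2 i)|} := by
    refine measurableSet_le measurable_const
      (continuous_abs.measurable.comp (Finset.measurable_sum _ fun i _ => ?_))
    exact (hh n).comp (measurable_fst.prodMk ((measurable_pi_apply i).comp measurable_snd))
  have hG : MeasurableSet {D : TrainIdx (fold n) ℓ → Obs 𝒳 𝒵 |
      ∫⁻ w, ENNReal.ofReal (h n (D, w) ^ 2) ∂F ≤ ENNReal.ofReal η ∧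
        Real.sqrt n * |∫ w, h n (D, w) ∂F| ≤ δ / 2} := by
    have h1 : Measurable fun D => ∫⁻ w, ENNReal.ofReal (h n (D, w) ^ 2) ∂F :=
      Measurable.lintegral_prod_right' (ν := F) (f := fun u => ENNReal.ofReal (h n u ^ 2))
        ((hh n).pow_const 2).ennreal_ofReal
    have h2 : Measurable fun D => Real.sqrt n * |∫ w, h n (D, w) ∂F| :=
      (continuous_abs.measurable.comp
        ((hh n).stronglyMeasurable.integral_prod_right' (ν := F)).measurable).const_mul _
    exact (measurableSet_le h1 measurable_const).inter (measurableSet_le h2 measurable_const)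
  refine le_trans (measure_mono fun ω hω => ?_) (measure_train_le hWmeas hWlaw hWindep (fold n) ℓ
    hS hG (c := ENNReal.ofReal (4 * (δ ^ 2)⁻¹ * η)) fun D hD => ?_)
  · simp only [Set.mem_ofPred_eq, not_lt, sum_filter_fold_eq] at hω ⊢
    rwa [abs_mul, abs_of_nonneg (by positivity : 0 ≤ (Real.sqrt n)⁻¹),
      le_inv_mul_iff₀ hsn] at hω
  · have hcard : (Fintype.card {i : Fin n // ¬ fold n i ≠ ℓ} : ℝ) ≤ n := by
      exact_mod_cast card_heldOut_le (fold n) ℓ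
    refine (pi_abs_sum_ge_le (t := Real.sqrt n * δ)
      ((hh n).comp (measurable_const.prodMk measurable_id)) hη.le
      (by positivity) hD.1 ?_).trans (ENNReal.ofReal_le_ofReal ?_)
    · calc (Fintype.card {i : Fin n // ¬ fold n i ≠ ℓ} : ℝ) * |∫ w, h n (D, w) ∂F|
          ≤ n * |∫ w, h n (D, w) ∂F| := mul_le_mul_of_nonneg_right hcard (abs_nonneg _)
        _ = Real.sqrt n * (Real.sqrt n * |∫ w, h n (D, w) ∂F|) := by
            rw [← mul_assoc, Real.mul_self_sqrt hn.le]
        _ ≤ Real.sqrt n * (δ / 2) := mul_le_mul_of_nonneg_left hD.2 hsn.le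
        _ = Real.sqrt n * δ / 2 := by ring
    · rw [div_le_iff₀ (by positivity)]
      have h1 : (Real.sqrt n * δ / 2) ^ 2 = n * δ ^ 2 / 4 := by
        rw [div_pow, mul_pow, Real.sq_sqrt hn.le]; norm_num
      rw [h1]
      calc (Fintype.card {i : Fin n // ¬ fold n i ≠ ℓ} : ℝ) * η ≤ n * η :=
            mul_le_mul_of_nonneg_right hcard hη.le
        _ = 4 * (δ ^ 2)⁻¹ * η * (n * δ ^ 2 / 4) := by field_simp

end CrossFitting


section FixedFirstStep

variable {𝒳 𝒵 : Type*} [MeasurableSpace 𝒳] [MeasurableSpace 𝒵]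
  {F : Measure (Obs 𝒳 𝒵)}

/-! ### Moments of the estimated score for a fixed first step -/

lemma measurable_obs_x : Measurable (Obs.x : Obs 𝒳 𝒵 → 𝒳) := measurable_fst.comp measurable_snd

lemma measurable_obs_y : Measurable (Obs.y : Obs 𝒳 𝒵 → ℝ) := measurable_fst

lemma measurable_obs_z : Measurable (Obs.z : Obs 𝒳 𝒵 → 𝒵) := measurable_snd.comp measurable_snd

lemma sigmaZ_le : sigmaZ 𝒳 𝒵 ≤ (inferInstance : MeasurableSpace (Obs 𝒳 𝒵)) :=
  measurable_obs_z.comap_le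

lemma integrable_bdd_mul {g : 𝒵 → ℝ} (hg : Measurable g) {B : ℝ}
    (hB : ∀ᵐ w ∂F, |g (Obs.z w)| ≤ B) {U : Obs 𝒳 𝒵 → ℝ} (hU : Integrable U F) :
    Integrable (fun w => g (Obs.z w) * U w) F :=
  hU.bdd_mul (hg.comp measurable_obs_z).aestronglyMeasurable hB

lemma eLpNorm_two_sq (f : Obs 𝒳 𝒵 → ℝ) :
    eLpNorm f 2 F ^ 2 = ∫⁻ w, ENNReal.ofReal (f w ^ 2) ∂F := by
  have h := eLpNorm_nnreal_pow_eq_lintegral (μ := F) (f := f) (p := 2) two_ne_zero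
  simp only [NNReal.coe_ofNat, ENNReal.rpow_ofNat, ENNReal.coe_ofNat] at h
  rw [h]
  refine lintegral_congr fun w => ?_
  rw [Real.enorm_eq_ofReal_abs, ← ENNReal.ofReal_pow (abs_nonneg _), sq_abs]

lemma eLpNorm_two_le_of_integral_sq_le {f : Obs 𝒳 𝒵 → ℝ} (hf : Integrable (fun w => f w ^ 2) F)
    {r : ℝ} (hr : 0 ≤ r) (h : ∫ w, f w ^ 2 ∂F ≤ r ^ 2) : eLpNorm f 2 F ≤ ENNReal.ofReal r := by
  rw [← ENNReal.pow_le_pow_left_iff two_ne_zero, eLpNorm_two_sq,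
    ← ofReal_integral_eq_lintegral_ofReal hf (ae_of_all _ fun _ => sq_nonneg _),
    ← ENNReal.ofReal_pow hr]
  exact ENNReal.ofReal_le_ofReal h

variable [IsProbabilityMeasure F]

/-- A bounded function of the instruments can be integrated against the projection. -/
lemma integral_mul_condExp_sigmaZ {g : 𝒵 → ℝ} (hg : Measurable g) {B : ℝ}
    (hB : ∀ᵐ w ∂F, |g (Obs.z w)| ≤ B) {U : Obs 𝒳 𝒵 → ℝ} (hU : Integrable U F) :
    ∫ w, g (Obs.z w) * U w ∂F = ∫ w, g (Obs.z w) * (F[U | sigmaZ 𝒳 𝒵]) w ∂F := by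
  have hgm : StronglyMeasurable[sigmaZ 𝒳 𝒵] fun w : Obs 𝒳 𝒵 => g (Obs.z w) :=
    (hg.comp (comap_measurable Obs.z)).stronglyMeasurable
  have h1 := condExp_mul_of_stronglyMeasurable_left hgm
    (show Integrable ((fun w => g (Obs.z w)) * U) F from integrable_bdd_mul hg hB hU) hU
  calc ∫ w, g (Obs.z w) * U w ∂F
      = ∫ w, (F[(fun w => g (Obs.z w)) * U | sigmaZ 𝒳 𝒵]) w ∂F := (integral_condExp sigmaZ_le).symm
    _ = _ := integral_congr_ae h1

lemma integrable_sq_of_bdd {g : 𝒵 → ℝ} (hg : Measurable g) {B : ℝ}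
    (hB : ∀ᵐ w ∂F, |g (Obs.z w)| ≤ B) : Integrable (fun w => g (Obs.z w) ^ 2) F := by
  have h := integrable_bdd_mul hg hB (integrable_bdd_mul hg hB (integrable_const (1 : ℝ)))
  exact h.congr (ae_of_all _ fun w => by ring)

/-- The projected norm enters here: against a function of the instruments, only the projection of
`U` on the instruments matters. -/
lemma enorm_integral_mul_le {g : 𝒵 → ℝ} (hg : Measurable g) {B r : ℝ} (hr : 0 ≤ r)
    (hB : ∀ᵐ w ∂F, |g (Obs.z w)| ≤ B) (hgr : ∫ w, g (Obs.z w) ^ 2 ∂F ≤ r ^ 2)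
    {U : Obs 𝒳 𝒵 → ℝ} (hU : Integrable U F) :
    ‖∫ w, g (Obs.z w) * U w ∂F‖ₑ ≤ ENNReal.ofReal r * eLpNorm (F[U | sigmaZ 𝒳 𝒵]) 2 F := by
  rw [integral_mul_condExp_sigmaZ hg hB hU]
  have hgn := eLpNorm_two_le_of_integral_sq_le (integrable_sq_of_bdd hg hB) hr hgr
  have hT : AEStronglyMeasurable (F[U | sigmaZ 𝒳 𝒵]) F := integrable_condExp.aestronglyMeasurable
  have h1 := eLpNorm_smul_le_mul_eLpNorm (p := 2) (q := 2) (r := 1) hT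
    (hg.comp measurable_obs_z).aestronglyMeasurable
  refine (enorm_integral_le_lintegral_enorm _).trans ?_
  rw [eLpNorm_one_eq_lintegral_enorm] at h1
  exact h1.trans (by gcongr; exact hgn)

variable {Γ : Submodule ℝ (𝒳 → ℝ)} {m : Obs 𝒳 𝒵 → Γ →ₗ[ℝ] ℝ} {γ₀ : Γ} {α₀ : 𝒵 → ℝ}

/-- The second moment of the error of the score is controlled by the errors of its ingredients. -/
lemma lintegral_score_sub_sq_le
    (hΓ : ∀ γ ∈ Γ, Measurable γ ∧ MemLp (fun w : Obs 𝒳 𝒵 => γ (Obs.x w)) 2 F)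
    (hm : ∀ γ : Γ, Measurable fun w => m w γ) (hα₀ : Measurable α₀)
    (hresint : Integrable (fun w => (Obs.y w - (γ₀ : 𝒳 → ℝ) (Obs.x w)) ^ 2) F) {C : ℝ}
    (hresbound : ∀ᵐ w ∂F,
      (F[fun w => (Obs.y w - (γ₀ : 𝒳 → ℝ) (Obs.x w)) ^ 2 | sigmaZ 𝒳 𝒵]) w ≤ C)
    (hC : 0 ≤ C) (γ : Γ) {α : 𝒵 → ℝ} (hα : Measurable α) {A B r : ℝ}
    (hA : ∀ᵐ w ∂F, |α (Obs.z w)| ≤ A) (hB : ∀ᵐ w ∂F, |α (Obs.z w) - α₀ (Obs.z w)| ≤ B)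
    (hr : ∫ w, (α (Obs.z w) - α₀ (Obs.z w)) ^ 2 ∂F ≤ r ^ 2) :
    ∫⁻ w, ENNReal.ofReal ((score m γ α w - score m γ₀ α₀ w) ^ 2) ∂F
      ≤ 3 * ∫⁻ w, ENNReal.ofReal ((m w γ - m w γ₀) ^ 2) ∂F + ENNReal.ofReal (3 * C * r ^ 2)
        + ENNReal.ofReal (3 * A ^ 2) * normX F ((γ - γ₀ : Γ) : 𝒳 → ℝ) ^ 2 := by
  have hγm : Measurable fun w : Obs 𝒳 𝒵 => ((γ - γ₀ : Γ) : 𝒳 → ℝ) (Obs.x w) :=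
    (hΓ _ (γ - γ₀).2).1.comp measurable_obs_x
  have hU : Measurable fun w : Obs 𝒳 𝒵 => Obs.y w - (γ₀ : 𝒳 → ℝ) (Obs.x w) :=
    measurable_obs_y.sub ((hΓ _ γ₀.2).1.comp measurable_obs_x)
  have hg : Measurable fun z => α z - α₀ z := hα.sub hα₀
  set g : Obs 𝒳 𝒵 → ℝ := fun w => α (Obs.z w) - α₀ (Obs.z w) with hgdef
  set U : Obs 𝒳 𝒵 → ℝ := fun w => Obs.y w - (γ₀ : 𝒳 → ℝ) (Obs.x w) with hUdef
  have hgm : Measurable g := hg.comp measurable_obs_z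
  -- the bound on the conditional variance of the residual
  have hgU : ∫⁻ w, ENNReal.ofReal (g w ^ 2 * U w ^ 2) ∂F ≤ ENNReal.ofReal (C * r ^ 2) := by
    have hB2 : ∀ᵐ w ∂F, |(α (Obs.z w) - α₀ (Obs.z w)) ^ 2| ≤ B ^ 2 := by
      filter_upwards [hB] with w hw
      rw [abs_pow]
      exact pow_le_pow_left₀ (abs_nonneg _) hw 2
    rw [← ofReal_integral_eq_lintegral_ofReal
      (integrable_bdd_mul (g := fun z => (α z - α₀ z) ^ 2) (hg.pow_const 2) hB2 hresint)
      (ae_of_all _ fun _ => by positivity)]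
    refine ENNReal.ofReal_le_ofReal ?_
    rw [integral_mul_condExp_sigmaZ (g := fun z => (α z - α₀ z) ^ 2) (hg.pow_const 2) hB2 hresint]
    calc _ ≤ ∫ w, C * (α (Obs.z w) - α₀ (Obs.z w)) ^ 2 ∂F := by
          refine integral_mono_ae (integrable_bdd_mul (g := fun z => (α z - α₀ z) ^ 2)
            (hg.pow_const 2) hB2 integrable_condExp)
            ((integrable_sq_of_bdd hg hB).const_mul C) ?_
          filter_upwards [hresbound] with w hw
          have := mul_le_mul_of_nonneg_left hw (sq_nonneg (α (Obs.z w) - α₀ (Obs.z w)))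
          linarith
      _ ≤ C * r ^ 2 := by
          rw [integral_const_mul]; exact mul_le_mul_of_nonneg_left hr hC
  calc ∫⁻ w, ENNReal.ofReal ((score m γ α w - score m γ₀ α₀ w) ^ 2) ∂F
      ≤ ∫⁻ w, (3 * ENNReal.ofReal ((m w γ - m w γ₀) ^ 2)
          + 3 * ENNReal.ofReal (g w ^ 2 * U w ^ 2)
          + ENNReal.ofReal (3 * A ^ 2)
            * ENNReal.ofReal (((γ - γ₀ : Γ) : 𝒳 → ℝ) (Obs.x w) ^ 2)) ∂F := by
        refine lintegral_mono_ae ?_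
        filter_upwards [hA] with w hw
        have h3 : (3 : ℝ≥0∞) = ENNReal.ofReal 3 := by simp
        rw [h3, ← ENNReal.ofReal_mul (by norm_num), ← ENNReal.ofReal_mul (by norm_num),
          ← ENNReal.ofReal_mul (by positivity), ← ENNReal.ofReal_add (by positivity)
          (by positivity), ← ENNReal.ofReal_add (by positivity) (by positivity)]
        refine ENNReal.ofReal_le_ofReal ?_
        have e : score m γ α w - score m γ₀ α₀ w = (m w γ - m w γ₀) + g w * U w
            - α (Obs.z w) * ((γ - γ₀ : Γ) : 𝒳 → ℝ) (Obs.x w) := by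
          simp only [score, hgdef, hUdef, Submodule.coe_sub, Pi.sub_apply]; ring
        have hα2 : α (Obs.z w) ^ 2 ≤ A ^ 2 := sq_le_sq' (by linarith [(abs_le.1 hw).1])
          (abs_le.1 hw).2
        have h4 := mul_le_mul_of_nonneg_right hα2
          (sq_nonneg (((γ - γ₀ : Γ) : 𝒳 → ℝ) (Obs.x w)))
        rw [e]
        set a := m w γ - m w γ₀
        set b := g w * U w with hb
        set c := α (Obs.z w) * ((γ - γ₀ : Γ) : 𝒳 → ℝ) (Obs.x w) with hc
        have h5 : g w ^ 2 * U w ^ 2 = b ^ 2 := by rw [hb]; ring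
        have h6 : α (Obs.z w) ^ 2 * ((γ - γ₀ : Γ) : 𝒳 → ℝ) (Obs.x w) ^ 2 = c ^ 2 := by
          rw [hc]; ring
        rw [h6] at h4
        rw [h5]
        linarith [sq_nonneg (a - b), sq_nonneg (a + c), sq_nonneg (b + c)]
    _ = 3 * ∫⁻ w, ENNReal.ofReal ((m w γ - m w γ₀) ^ 2) ∂F
          + 3 * ∫⁻ w, ENNReal.ofReal (g w ^ 2 * U w ^ 2) ∂F
          + ENNReal.ofReal (3 * A ^ 2) * normX F ((γ - γ₀ : Γ) : 𝒳 → ℝ) ^ 2 := by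
        have hm1 : Measurable fun w => ENNReal.ofReal ((m w γ - m w γ₀) ^ 2) :=
          (((hm γ).sub (hm γ₀)).pow_const 2).ennreal_ofReal
        have hm2 : Measurable fun w => ENNReal.ofReal (g w ^ 2 * U w ^ 2) :=
          ((hgm.pow_const 2).mul (hU.pow_const 2)).ennreal_ofReal
        have hm3 : Measurable fun w : Obs 𝒳 𝒵 =>
            ENNReal.ofReal (((γ - γ₀ : Γ) : 𝒳 → ℝ) (Obs.x w) ^ 2) :=
          (hγm.pow_const 2).ennreal_ofReal
        have hm12 : Measurable fun w => 3 * ENNReal.ofReal ((m w γ - m w γ₀) ^ 2)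
            + 3 * ENNReal.ofReal (g w ^ 2 * U w ^ 2) := (hm1.const_mul 3).add (hm2.const_mul 3)
        rw [lintegral_add_left hm12,
          lintegral_add_left (hm1.const_mul 3), lintegral_const_mul _ hm1,
          lintegral_const_mul _ hm2, lintegral_const_mul _ hm3, normX, eLpNorm_two_sq]
    _ ≤ _ := by
        gcongr
        calc 3 * ∫⁻ w, ENNReal.ofReal (g w ^ 2 * U w ^ 2) ∂F ≤ 3 * ENNReal.ofReal (C * r ^ 2) := by
              gcongr
          _ = ENNReal.ofReal (3 * C * r ^ 2) := by
              rw [mul_assoc, ENNReal.ofReal_mul (by norm_num : (0 : ℝ) ≤ 3)]; simp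

/-- The doubly robust bound: the mean of the error of the score is a product of two errors. -/
lemma enorm_integral_score_sub_le
    (hΓ : ∀ γ ∈ Γ, Measurable γ ∧ MemLp (fun w : Obs 𝒳 𝒵 => γ (Obs.x w)) 2 F)
    (hα₀ : Measurable α₀)
    (hexog : F[fun w => Obs.y w - (γ₀ : 𝒳 → ℝ) (Obs.x w) | sigmaZ 𝒳 𝒵] =ᵐ[F] 0)
    (hriesz : ∀ γ : Γ, Integrable (fun w => m w γ) F ∧
      ∫ w, m w γ ∂F = ∫ w, α₀ (Obs.z w) * (γ : 𝒳 → ℝ) (Obs.x w) ∂F)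
    (hres : Integrable (fun w => Obs.y w - (γ₀ : 𝒳 → ℝ) (Obs.x w)) F) {A₀ : ℝ}
    (hα₀bound : ∀ᵐ w ∂F, |α₀ (Obs.z w)| ≤ A₀) (γ : Γ) {α : 𝒵 → ℝ} (hα : Measurable α) {B r : ℝ}
    (hr0 : 0 ≤ r) (hB : ∀ᵐ w ∂F, |α (Obs.z w) - α₀ (Obs.z w)| ≤ B)
    (hr : ∫ w, (α (Obs.z w) - α₀ (Obs.z w)) ^ 2 ∂F ≤ r ^ 2) :
    ‖∫ w, (score m γ α w - score m γ₀ α₀ w) ∂F‖ₑ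
      ≤ ENNReal.ofReal r * projNorm F ((γ - γ₀ : Γ) : 𝒳 → ℝ) := by
  have hΔ : Integrable (fun w : Obs 𝒳 𝒵 => ((γ - γ₀ : Γ) : 𝒳 → ℝ) (Obs.x w)) F :=
    (hΓ _ (γ - γ₀).2).2.integrable one_le_two
  have hg : Measurable fun z => α z - α₀ z := hα.sub hα₀
  have h1 : Integrable (fun w => m w (γ - γ₀)) F := (hriesz _).1
  have h2 : Integrable (fun w => α₀ (Obs.z w) * ((γ - γ₀ : Γ) : 𝒳 → ℝ) (Obs.x w)) F :=
    integrable_bdd_mul hα₀ hα₀bound hΔ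
  have h3 := integrable_bdd_mul hg hB hres
  have h4 := integrable_bdd_mul hg hB hΔ
  have e : (fun w => score m γ α w - score m γ₀ α₀ w) = fun w =>
      (m w (γ - γ₀) - α₀ (Obs.z w) * ((γ - γ₀ : Γ) : 𝒳 → ℝ) (Obs.x w))
      + (α (Obs.z w) - α₀ (Obs.z w)) * (Obs.y w - (γ₀ : 𝒳 → ℝ) (Obs.x w))
      - (α (Obs.z w) - α₀ (Obs.z w)) * ((γ - γ₀ : Γ) : 𝒳 → ℝ) (Obs.x w) := by
    funext w
    simp only [score, map_sub, Submodule.coe_sub, Pi.sub_apply]; ring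
  have hz : ∫ w, (α (Obs.z w) - α₀ (Obs.z w)) * (Obs.y w - (γ₀ : 𝒳 → ℝ) (Obs.x w)) ∂F = 0 := by
    rw [integral_mul_condExp_sigmaZ hg hB hres]
    refine integral_eq_zero_of_ae ?_
    filter_upwards [hexog] with w hw
    simp [hw]
  have h12 : Integrable (fun w => m w (γ - γ₀)
      - α₀ (Obs.z w) * ((γ - γ₀ : Γ) : 𝒳 → ℝ) (Obs.x w)) F := h1.sub h2
  have h123 : Integrable (fun w => m w (γ - γ₀)
      - α₀ (Obs.z w) * ((γ - γ₀ : Γ) : 𝒳 → ℝ) (Obs.x w)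
      + (α (Obs.z w) - α₀ (Obs.z w)) * (Obs.y w - (γ₀ : 𝒳 → ℝ) (Obs.x w))) F := h12.add h3
  rw [e, integral_sub h123 h4, integral_add h12 h3, integral_sub h1 h2,
    (hriesz _).2, sub_self, hz, zero_add, zero_sub, enorm_neg]
  exact enorm_integral_mul_le hg hr0 hB hr hΔ

/-! ### The sparse approximation of the Riesz representer -/

lemma measurable_lin {p : ℕ} {b : Fin p → 𝒵 → ℝ} (hb : ∀ k, Measurable (b k)) (ρ : Fin p → ℝ) :
    Measurable (lin b ρ) := by
  unfold lin
  exact Finset.measurable_sum _ fun k _ => (hb k).mul_const _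

/-- By the Riesz representation, the moments `M - G ρ` are the covariances of the dictionary with
the approximation error `α₀ - b'ρ`. -/
lemma wsq_Mpop_sub_le (hΓ : ∀ γ ∈ Γ, Measurable γ ∧ MemLp (fun w : Obs 𝒳 𝒵 => γ (Obs.x w)) 2 F)
    (hα₀ : Measurable α₀)
    (hriesz : ∀ γ : Γ, Integrable (fun w => m w γ) F ∧
      ∫ w, m w γ ∂F = ∫ w, α₀ (Obs.z w) * (γ : 𝒳 → ℝ) (Obs.x w) ∂F) {A₀ : ℝ}
    (hα₀bound : ∀ᵐ w ∂F, |α₀ (Obs.z w)| ≤ A₀) {p q : ℕ} {d : Fin q → Γ} {b : Fin p → 𝒵 → ℝ}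
    (hb : ∀ k, Measurable (b k)) {Cb Cd Cm : ℝ} (hbd : ∀ᵐ w ∂F, BoundedAt m d b Cb Cd Cm w)
    (ρ : Fin p → ℝ) :
    wsq 1 (Mpop F m d - Gpop F d b *ᵥ ρ)
      ≤ Cd ^ 2 * ∫ w, (α₀ (Obs.z w) - lin b ρ (Obs.z w)) ^ 2 ∂F := by
  have hd : ∀ j, Integrable (fun w : Obs 𝒳 𝒵 => (d j : 𝒳 → ℝ) (Obs.x w)) F := fun j =>
    (hΓ _ (d j).2).2.integrable one_le_two
  have hbk : ∀ k, ∀ᵐ w ∂F, |b k (Obs.z w)| ≤ Cb := fun k => by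
    filter_upwards [hbd] with w hw using hw.1 k
  have hlb : ∀ᵐ w ∂F, |lin b ρ (Obs.z w)| ≤ Cb * ∑ k, |ρ k| := by
    filter_upwards [hbd] with w hw using abs_lin_le hw.1 ρ
  have hlm := measurable_lin hb ρ
  have hgm : Measurable fun z => α₀ z - lin b ρ z := hα₀.sub hlm
  have hgb : ∀ᵐ w ∂F, |α₀ (Obs.z w) - lin b ρ (Obs.z w)| ≤ A₀ + Cb * ∑ k, |ρ k| := by
    filter_upwards [hα₀bound, hlb] with w h1 h2
    exact (abs_sub _ _).trans (add_le_add h1 h2)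
  have hg2 := integrable_sq_of_bdd hgm hgb
  -- each moment is bounded by the approximation error, by Jensen's inequality
  have key : ∀ j, (Mpop F m d - Gpop F d b *ᵥ ρ) j ^ 2
      ≤ Cd ^ 2 * ∫ w, (α₀ (Obs.z w) - lin b ρ (Obs.z w)) ^ 2 ∂F := fun j => by
    have hG : (Gpop F d b *ᵥ ρ) j
        = ∫ w, lin b ρ (Obs.z w) * (d j : 𝒳 → ℝ) (Obs.x w) ∂F := by
      simp only [Matrix.mulVec, dotProduct, Gpop, Matrix.of_apply, ← integral_mul_const]
      rw [← integral_finsetSum]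
      · refine integral_congr_ae (ae_of_all _ fun w => ?_)
        simp only [lin, Finset.sum_mul]
        exact Finset.sum_congr rfl fun k _ => by ring
      · intro k _
        refine Integrable.mul_const ?_ _
        exact (integrable_bdd_mul (hb k) (hbk k) (hd j)).congr
          (ae_of_all _ fun w => mul_comm _ _)
    have hM : (Mpop F m d - Gpop F d b *ᵥ ρ) j
        = ∫ w, (α₀ (Obs.z w) - lin b ρ (Obs.z w)) * (d j : 𝒳 → ℝ) (Obs.x w) ∂F := by
      rw [Pi.sub_apply, hG, Mpop, (hriesz _).2, ← integral_sub
        (integrable_bdd_mul hα₀ hα₀bound (hd j)) (integrable_bdd_mul hlm hlb (hd j))]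
      exact integral_congr_ae (ae_of_all _ fun w => by ring)
    rw [hM]
    set f : Obs 𝒳 𝒵 → ℝ := fun w =>
      (α₀ (Obs.z w) - lin b ρ (Obs.z w)) * (d j : 𝒳 → ℝ) (Obs.x w) with hf
    have hfm : Measurable f := (hgm.comp measurable_obs_z).mul
      ((hΓ _ (d j).2).1.comp measurable_obs_x)
    have hfle : ∀ᵐ w ∂F, f w ^ 2 ≤ Cd ^ 2 * (α₀ (Obs.z w) - lin b ρ (Obs.z w)) ^ 2 := by
      filter_upwards [hbd] with w hw
      have : (d j : 𝒳 → ℝ) (Obs.x w) ^ 2 ≤ Cd ^ 2 :=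
        sq_le_sq' (abs_le.1 (hw.2.1 j)).1 (abs_le.1 (hw.2.1 j)).2
      have := mul_le_mul_of_nonneg_right this (sq_nonneg (α₀ (Obs.z w) - lin b ρ (Obs.z w)))
      rw [hf]; simp only [mul_pow]; linarith
    have hfi : Integrable (fun w => f w ^ 2) F :=
      (hg2.const_mul (Cd ^ 2)).mono' (hfm.pow_const 2).aestronglyMeasurable (by
        filter_upwards [hfle] with w hw
        rwa [Real.norm_of_nonneg (sq_nonneg _)])
    have hf2 : MemLp f 2 F := (memLp_two_iff_integrable_sq hfm.aestronglyMeasurable).2 hfi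
    have hvar := variance_nonneg f F
    rw [variance_eq_sub hf2] at hvar
    calc (∫ w, f w ∂F) ^ 2 ≤ ∫ w, f w ^ 2 ∂F := by
          simp only [Pi.pow_apply] at hvar; linarith
      _ ≤ ∫ w, Cd ^ 2 * (α₀ (Obs.z w) - lin b ρ (Obs.z w)) ^ 2 ∂F :=
          integral_mono_ae hfi (hg2.const_mul _) hfle
      _ = _ := integral_const_mul _ _
  have hI : 0 ≤ ∫ w, (α₀ (Obs.z w) - lin b ρ (Obs.z w)) ^ 2 ∂F :=
    integral_nonneg fun _ => sq_nonneg _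
  have hS : 0 ≤ Cd ^ 2 * ∫ w, (α₀ (Obs.z w) - lin b ρ (Obs.z w)) ^ 2 ∂F :=
    mul_nonneg (sq_nonneg _) hI
  have := wsq_le_of_abs_le (w := (1 : Fin q → ℝ)) (wh := 1) (fun _ => le_rfl) zero_le_one
    (fun j => Real.abs_le_sqrt (key j))
  rwa [one_mul, Real.sq_sqrt hS] at this

/-- The mean square error of the estimated Riesz representer, from the `ℓ₁` error of its
coefficients and the sparse approximation error. -/
lemma integral_lin_sub_sq_le (hα₀ : Measurable α₀) {A₀ : ℝ}
    (hα₀bound : ∀ᵐ w ∂F, |α₀ (Obs.z w)| ≤ A₀) {p : ℕ} {b : Fin p → 𝒵 → ℝ}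
    (hb : ∀ k, Measurable (b k)) {Cb : ℝ} (hCb : ∀ᵐ w ∂F, ∀ k, |b k (Obs.z w)| ≤ Cb)
    (hCb0 : 0 ≤ Cb) (ρbar ρ : Fin p → ℝ) {R : ℝ} (hR : ∑ k, |(ρ - ρbar) k| ≤ R) :
    ∫ w, (lin b ρ (Obs.z w) - α₀ (Obs.z w)) ^ 2 ∂F
      ≤ 2 * (Cb * R) ^ 2 + 2 * ∫ w, (α₀ (Obs.z w) - lin b ρbar (Obs.z w)) ^ 2 ∂F := by
  have hbnd : ∀ ρ : Fin p → ℝ, ∀ᵐ w ∂F,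
      |α₀ (Obs.z w) - lin b ρ (Obs.z w)| ≤ A₀ + Cb * ∑ k, |ρ k| := fun ρ => by
    filter_upwards [hα₀bound, hCb] with w h1 h2
    exact (abs_sub _ _).trans (add_le_add h1 (abs_lin_le h2 ρ))
  have hint : ∀ ρ : Fin p → ℝ,
      Integrable (fun w => (α₀ (Obs.z w) - lin b ρ (Obs.z w)) ^ 2) F := fun ρ =>
    integrable_sq_of_bdd (hα₀.sub (measurable_lin hb ρ)) (hbnd ρ)
  have h1 : ∫ w, (lin b ρ (Obs.z w) - α₀ (Obs.z w)) ^ 2 ∂F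
      = ∫ w, (α₀ (Obs.z w) - lin b ρ (Obs.z w)) ^ 2 ∂F :=
    integral_congr_ae (ae_of_all _ fun w => by ring)
  rw [h1]
  calc ∫ w, (α₀ (Obs.z w) - lin b ρ (Obs.z w)) ^ 2 ∂F
      ≤ ∫ w, (2 * (Cb * R) ^ 2 + 2 * (α₀ (Obs.z w) - lin b ρbar (Obs.z w)) ^ 2) ∂F := by
        refine integral_mono_ae (hint ρ) ((integrable_const _).add ((hint ρbar).const_mul 2)) ?_
        filter_upwards [hCb] with w hw
        have h2 : |lin b (ρ - ρbar) (Obs.z w)| ≤ Cb * R :=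
          (abs_lin_le hw _).trans (mul_le_mul_of_nonneg_left hR hCb0)
        have h3 : lin b (ρ - ρbar) (Obs.z w) ^ 2 ≤ (Cb * R) ^ 2 :=
          sq_le_sq' (abs_le.1 h2).1 (abs_le.1 h2).2
        rw [lin_sub] at h3
        nlinarith [sq_nonneg (α₀ (Obs.z w) - lin b ρbar (Obs.z w)
          + (lin b ρ (Obs.z w) - lin b ρbar (Obs.z w)))]
    _ = _ := by
        rw [integral_add (integrable_const _) ((hint ρbar).const_mul 2), integral_const_mul,
          integral_const_mul]
        simp

end FixedFirstStep


/-! ### The limit theorems for the sample average of the score -/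

section Limit

variable {β Ω : Type*} [MeasurableSpace β] [MeasurableSpace Ω]
  {P : Measure Ω} {F : Measure β} {W : ℕ → Ω → β}

lemma identDistrib_comp (hWmeas : ∀ i, Measurable (W i)) (hWlaw : ∀ i, P.map (W i) = F)
    {f : β → ℝ} (hf : Measurable f) (i : ℕ) :
    IdentDistrib (fun ω => f (W i ω)) (fun ω => f (W 0 ω)) P P :=
  IdentDistrib.comp ⟨(hWmeas i).aemeasurable, (hWmeas 0).aemeasurable, by rw [hWlaw, hWlaw]⟩ hf

lemma integral_comp_law (hWmeas : ∀ i, Measurable (W i)) (hWlaw : ∀ i, P.map (W i) = F)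
    {f : β → ℝ} (hf : Measurable f) (i : ℕ) : ∫ ω, f (W i ω) ∂P = ∫ w, f w ∂F := by
  rw [← hWlaw i, integral_map (hWmeas _).aemeasurable hf.aestronglyMeasurable]

variable [IsProbabilityMeasure P]

/-- The weak law of large numbers, for events of probability tending to one. -/
lemma withHighProb_abs_mean_sub_lt (hWmeas : ∀ i, Measurable (W i))
    (hWlaw : ∀ i, P.map (W i) = F) (hWindep : iIndepFun W P) {f : β → ℝ} (hf : Measurable f)
    (hfi : Integrable f F) {ε : ℝ} (hε : 0 < ε) :
    WithHighProb P fun n ω => |(n : ℝ)⁻¹ * ∑ i : Fin n, f (W i ω) - ∫ w, f w ∂F| < ε := by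
  have hint : Integrable (fun ω => f (W 0 ω)) P := by
    rw [← hWlaw 0] at hfi
    exact hfi.comp_measurable (hWmeas 0)
  have hslln := strong_law_ae_real (fun i ω => f (W i ω)) hint
    (fun i j hij => (hWindep.indepFun hij).comp hf hf) (identDistrib_comp hWmeas hWlaw hf)
  have hmeas : ∀ n : ℕ, AEStronglyMeasurable
      (fun ω => (∑ i ∈ Finset.range n, f (W i ω)) / (n : ℝ)) P := fun n =>
    ((Finset.measurable_sum _ fun i _ => hf.comp (hWmeas i)).div_const _).aestronglyMeasurable
  have h := withHighProb_of_tendstoInMeasure (tendstoInMeasure_of_tendsto_ae hmeas hslln) hε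
  refine h.mono (Eventually.of_forall fun n ω hω => ?_)
  rw [integral_comp_law hWmeas hWlaw hf] at hω
  rwa [← Finset.sum_range fun i => f (W i ω), ← div_eq_inv_mul]

/-- The central limit theorem with a negligible remainder. -/
lemma tendstoInDistribution_add_remainder (hWmeas : ∀ i, Measurable (W i))
    (hWlaw : ∀ i, P.map (W i) = F) (hWindep : iIndepFun W P) {f : β → ℝ} (hf : Measurable f)
    (hf2 : MemLp f 2 F) (hf0 : ∫ w, f w ∂F = 0) {R : ℕ → Ω → ℝ} (hR : ∀ n, Measurable (R n))
    (hR0 : ∀ ε : ℝ, 0 < ε → WithHighProb P fun n ω => |R n ω| < ε) :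
    TendstoInDistribution
      (fun (n : ℕ) ω => (Real.sqrt n)⁻¹ * ∑ i : Fin n, f (W i ω) + R n ω)
      atTop id (fun _ => P) (gaussianReal 0 (∫ w, f w ^ 2 ∂F).toNNReal) := by
  have hX0 : ∫ ω, f (W 0 ω) ∂P = 0 := by rw [integral_comp_law hWmeas hWlaw hf, hf0]
  have hX2 : MemLp (fun ω => f (W 0 ω)) 2 P := by
    rw [← hWlaw 0] at hf2
    exact hf2.comp_of_map (hWmeas 0).aemeasurable
  have hvar : Var[fun ω => f (W 0 ω); P] = ∫ w, f w ^ 2 ∂F := by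
    rw [variance_eq_sub hX2, hX0]
    have := integral_comp_law hWmeas hWlaw (hf.pow_const 2) 0
    simpa using this
  have hlaw : HasLaw (id : ℝ → ℝ) (gaussianReal 0 Var[fun ω => f (W 0 ω); P].toNNReal)
      (gaussianReal 0 (∫ w, f w ^ 2 ∂F).toNNReal) := ⟨aemeasurable_id, by rw [hvar, Measure.map_id]⟩
  have hclt := tendstoInDistribution_inv_sqrt_mul_sum_sub (X := fun i ω => f (W i ω)) hlaw hX2
    (hWindep.comp (fun _ => f) fun _ => hf) (identDistrib_comp hWmeas hWlaw hf)
  have hRm : TendstoInMeasure P R atTop fun _ => (0 : ℝ) :=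
    tendstoInMeasure_of_withHighProb fun ε hε => by simpa using hR0 ε hε
  have h := hclt.add_of_tendstoInMeasure_const hRm fun n => (hR n).aemeasurable
  refine h.congr (fun n => ae_of_all _ fun ω => ?_) (ae_of_all _ fun x => by simp)
  simp only [Pi.add_apply, hX0, mul_zero, sub_zero]
  rw [Finset.sum_range fun i => f (W i ω)]

/-- A perturbation bound for the empirical variance of `a + e`, when `e` is small in mean
square. -/
lemma abs_empirical_variance_sub_le {n : ℕ} (hn : 0 < n) (a e : Fin n → ℝ) {V τ : ℝ} (hτ : 0 < τ)
    (hτ1 : τ ≤ 1) (h2 : |(n : ℝ)⁻¹ * ∑ i, a i ^ 2 - V| < τ) (h1 : |(n : ℝ)⁻¹ * ∑ i, a i| < τ)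
    (he : (n : ℝ)⁻¹ * ∑ i, e i ^ 2 < τ ^ 2) :
    |(n : ℝ)⁻¹ * ∑ i, (a i + e i - (n : ℝ)⁻¹ * ∑ k, (a k + e k)) ^ 2 - V| ≤ τ * (|V| + 8) := by
  have hn' : (0 : ℝ) < n := by exact_mod_cast hn
  set Sa2 := (n : ℝ)⁻¹ * ∑ i, a i ^ 2 with hSa2
  set Sa := (n : ℝ)⁻¹ * ∑ i, a i with hSa
  set Se2 := (n : ℝ)⁻¹ * ∑ i, e i ^ 2 with hSe2
  set Se := (n : ℝ)⁻¹ * ∑ i, e i with hSe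
  set Sae := (n : ℝ)⁻¹ * ∑ i, 2 * (a i * e i) with hSae
  have hmean : (n : ℝ)⁻¹ * ∑ k, (a k + e k) = Sa + Se := by
    rw [Finset.sum_add_distrib, mul_add]
  have hexp : (n : ℝ)⁻¹ * ∑ i, (a i + e i - (n : ℝ)⁻¹ * ∑ k, (a k + e k)) ^ 2
      = Sa2 + Sae + Se2 - (Sa + Se) ^ 2 := by
    rw [hmean]
    have h3 : ∀ i, (a i + e i - (Sa + Se)) ^ 2 = a i ^ 2 + 2 * (a i * e i) + e i ^ 2
        - 2 * (Sa + Se) * (a i + e i) + (Sa + Se) ^ 2 := fun i => by ring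
    simp only [h3, Finset.sum_add_distrib, Finset.sum_sub_distrib, ← Finset.mul_sum,
      Finset.sum_const, Finset.card_univ, Fintype.card_fin, nsmul_eq_mul]
    have h4 : ∑ i, a i = n * Sa := by rw [hSa]; field_simp
    have h5 : ∑ i, e i = n * Se := by rw [hSe]; field_simp
    rw [h4, h5, hSa2, hSae, hSe2, ← Finset.mul_sum]
    field_simp
    ring
  have hSe2' : Se ^ 2 ≤ Se2 := by
    have := sq_sum_le_card_mul_sum_sq (s := Finset.univ) (f := e)
    rw [Finset.card_univ, Fintype.card_fin] at this
    rw [hSe, hSe2, mul_pow, inv_pow, sq (n : ℝ), mul_inv, mul_assoc]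
    refine mul_le_mul_of_nonneg_left ?_ (by positivity)
    rwa [inv_mul_le_iff₀ hn']
  -- the cross term, by the weighted arithmetic-geometric mean inequality
  have hcross : |Sae| ≤ τ * Sa2 + Se2 / τ := by
    have h3 : |∑ i, 2 * (a i * e i)| ≤ ∑ i, (τ * a i ^ 2 + e i ^ 2 / τ) := by
      refine (Finset.abs_sum_le_sum_abs _ _).trans (Finset.sum_le_sum fun i _ => ?_)
      have e1 : e i ^ 2 / τ = τ * (e i / τ) ^ 2 := by field_simp
      have e2 : a i * e i = τ * (a i * (e i / τ)) := by field_simp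
      rw [e1, e2, abs_le]
      constructor
      · nlinarith [mul_nonneg hτ.le (sq_nonneg (a i + e i / τ))]
      · nlinarith [mul_nonneg hτ.le (sq_nonneg (a i - e i / τ))]
    have h4 := mul_le_mul_of_nonneg_left h3 (show (0 : ℝ) ≤ (n : ℝ)⁻¹ by positivity)
    rw [hSae, abs_mul, abs_of_pos (by positivity : (0 : ℝ) < (n : ℝ)⁻¹)]
    refine h4.trans (le_of_eq ?_)
    rw [Finset.sum_add_distrib, ← Finset.mul_sum, ← Finset.sum_div, hSa2, hSe2]
    ring
  have hSe20 : 0 ≤ Se2 := by positivity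
  have hdiv : Se2 / τ ≤ τ := by rw [div_le_iff₀ hτ]; nlinarith
  have hSa2V : Sa2 ≤ |V| + 1 := by linarith [(abs_lt.1 h2).2, le_abs_self V]
  have h6 : τ * Sa2 ≤ τ * (|V| + 1) := mul_le_mul_of_nonneg_left hSa2V hτ.le
  have hsq : (Sa + Se) ^ 2 ≤ 4 * τ := by
    have h7 : Sa ^ 2 ≤ τ ^ 2 := sq_le_sq' (abs_lt.1 h1).1.le (abs_lt.1 h1).2.le
    nlinarith [sq_nonneg (Sa - Se)]
  have hτ2 : τ ^ 2 ≤ τ := by nlinarith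
  rw [hexp, abs_le]
  constructor
  · linarith [(abs_lt.1 h2).1, (abs_le.1 hcross).1]
  · linarith [(abs_lt.1 h2).2, (abs_le.1 hcross).2, sq_nonneg (Sa + Se)]

/-- Consistency of the empirical variance, when the summands are perturbed by errors that are small
in mean square. -/
lemma tendstoInMeasure_empirical_variance (hWmeas : ∀ i, Measurable (W i))
    (hWlaw : ∀ i, P.map (W i) = F) (hWindep : iIndepFun W P) [IsProbabilityMeasure F] {f : β → ℝ}
    (hf : Measurable f) (hf2 : MemLp f 2 F) (hf0 : ∫ w, f w ∂F = 0) {E : (n : ℕ) → Ω → Fin n → ℝ}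
    (hE : ∀ ε : ℝ, 0 < ε → WithHighProb P fun n ω => (n : ℝ)⁻¹ * ∑ i, E n ω i ^ 2 < ε) :
    TendstoInMeasure P
      (fun (n : ℕ) ω => (n : ℝ)⁻¹ * ∑ i : Fin n, (f (W i ω) + E n ω i
        - (n : ℝ)⁻¹ * ∑ k : Fin n, (f (W k ω) + E n ω k)) ^ 2)
      atTop (fun _ => ∫ w, f w ^ 2 ∂F) := by
  refine tendstoInMeasure_of_withHighProb fun ε hε => ?_
  set V := ∫ w, f w ^ 2 ∂F with hV
  set τ := min 1 (ε / 2 / (|V| + 8)) with hτ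
  have hτ0 : 0 < τ := by positivity
  have hτε : τ * (|V| + 8) < ε := by
    have : τ ≤ ε / 2 / (|V| + 8) := min_le_right _ _
    rw [le_div_iff₀ (by positivity)] at this
    linarith
  have h1 := withHighProb_abs_mean_sub_lt hWmeas hWlaw hWindep hf (hf2.integrable one_le_two) hτ0
  have h2 := withHighProb_abs_mean_sub_lt hWmeas hWlaw hWindep (hf.pow_const 2)
    hf2.integrable_sq hτ0
  refine ((h1.and h2).and (hE (τ ^ 2) (by positivity))).mono ?_
  filter_upwards [eventually_gt_atTop 0] with n hn ω hω
  obtain ⟨⟨hω1, hω2⟩, hω3⟩ := hω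
  rw [hf0, sub_zero] at hω1
  exact (abs_empirical_variance_sub_le hn _ _ hτ0 (min_le_left _ _) hω2 hω1 hω3).trans_lt hτε

end Limit

/-! ### The rate of the penalized GMM estimator on the training samples -/

section Rate

variable {𝒳 𝒵 Ω : Type*} [MeasurableSpace 𝒳] [MeasurableSpace 𝒵] [MeasurableSpace Ω]
  {P : Measure Ω} [IsProbabilityMeasure P] {F : Measure (Obs 𝒳 𝒵)} {W : ℕ → Ω → Obs 𝒳 𝒵}
  {Γ : Submodule ℝ (𝒳 → ℝ)} {m : Obs 𝒳 𝒵 → Γ →ₗ[ℝ] ℝ}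

/-- The good event of the penalized GMM analysis has probability tending to one. -/
lemma withHighProb_goodSample (hWmeas : ∀ i, Measurable (W i)) (hWlaw : ∀ i, P.map (W i) = F)
    (hWindep : iIndepFun W P) (hΓ : ∀ γ ∈ Γ, Measurable γ) (hm : ∀ γ : Γ, Measurable fun w => m w γ)
    {p q : ℕ → ℕ} (hpq : ∀ᶠ n in atTop, p n ≤ q n) (hq : ∀ᶠ n in atTop, 2 ≤ q n)
    {b : (n : ℕ) → Fin (p n) → 𝒵 → ℝ} (hb : ∀ n k, Measurable (b n k))
    {d : (n : ℕ) → Fin (q n) → Γ} {L : ℕ} (hL : 2 ≤ L) {fold : (n : ℕ) → Fin n → Fin L} {ℓ : Fin L}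
    (hfold : Tendsto (fun n : ℕ => (foldSize (fold n) ℓ : ℝ) / n) atTop (𝓝 (1 / (L : ℝ))))
    {lam : ℕ → ℝ} (hlam : ∀ n, 0 < lam n)
    (hqlam : (fun n : ℕ => Real.sqrt (Real.log (q n) / n)) =o[atTop] lam)
    (hq0 : Tendsto (fun n : ℕ => Real.sqrt (Real.log (q n) / n)) atTop (𝓝 0))
    {Cb Cd Cm : ℝ} (hCb : 0 ≤ Cb) (hCd : 0 ≤ Cd) (hCm : 0 < Cm)
    (hbd : ∀ᶠ n in atTop, ∀ᵐ w ∂F, BoundedAt m (d n) (b n) Cb Cd Cm w)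
    {rhoStar : (n : ℕ) → Fin (p n) → ℝ} {R : ℝ} (hR0 : 0 ≤ R)
    (hR : ∀ᶠ n in atTop, ∑ k, |rhoStar n k| ≤ R) {η τ : ℝ} (hη : 0 < η) (hτ : 0 < τ) :
    WithHighProb P fun n ω => GoodSample F m (d n) (b n) (rhoStar n) Cb Cd Cm (η * lam n) τ
      (train (fold n) ℓ (sample W n ω)) := by
  have hdm : ∀ n j, Measurable fun w : Obs 𝒳 𝒵 => (d n j : 𝒳 → ℝ) (Obs.x w) := fun n j =>
    (hΓ _ (d n j).2).comp measurable_obs_x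
  have hbm : ∀ n k, Measurable fun w : Obs 𝒳 𝒵 => b n k (Obs.z w) := fun n k =>
    (hb n k).comp measurable_obs_z
  have hlm : ∀ n, Measurable fun w : Obs 𝒳 𝒵 => lin (b n) (rhoStar n) (Obs.z w) := fun n =>
    (measurable_lin (hb n) _).comp measurable_obs_z
  have hηlam : (fun n : ℕ => Real.sqrt (Real.log (q n) / n)) =o[atTop] fun n => η * lam n :=
    (isLittleO_const_mul_right_iff hη.ne').2 hqlam
  have hτo : (fun n : ℕ => Real.sqrt (Real.log (q n) / n)) =o[atTop] fun _ => τ :=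
    (isLittleO_const_iff hτ.ne').2 hq0
  have hcard : ∀ᶠ n in atTop, Fintype.card (Fin (q n)) ≤ q n ^ 2 := by
    filter_upwards [hq] with n hn
    rw [Fintype.card_fin]; nlinarith
  have hcard2 : ∀ᶠ n in atTop, Fintype.card (Fin (q n) × Fin (p n)) ≤ q n ^ 2 := by
    filter_upwards [hpq] with n hn
    rw [Fintype.card_prod, Fintype.card_fin, Fintype.card_fin, sq]
    exact Nat.mul_le_mul_left _ hn
  have hbdW : WithHighProb P fun n ω => ∀ i : Fin n, BoundedAt m (d n) (b n) Cb Cd Cm (W i ω) := by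
    refine WithHighProb.of_ae ?_
    filter_upwards [hbd] with n hn
    refine ae_all_iff.2 fun i => ?_
    rw [← hWlaw i] at hn
    exact ae_of_ae_map (hWmeas i).aemeasurable hn
  have h1 := withHighProb_forall_abs_avg_sub_le hWmeas hWlaw hWindep hL hfold hq
    (fun n => mul_pos hη (hlam n)) hηlam hcard (f := fun n j w => m w (d n j))
    (fun n j => hm _) hCm (by
      filter_upwards [hbd] with n hn j
      filter_upwards [hn] with w hw using hw.2.2 j)
  have h2 := withHighProb_forall_abs_avg_sub_le hWmeas hWlaw hWindep hL hfold hq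
    (fun n => mul_pos hη (hlam n)) hηlam hcard2
    (f := fun n jk w => (d n jk.1 : 𝒳 → ℝ) (Obs.x w) * b n jk.2 (Obs.z w))
    (fun n jk => (hdm n _).mul (hbm n _)) (B := Cd * Cb + 1) (by positivity) (by
      filter_upwards [hbd] with n hn jk
      filter_upwards [hn] with w hw
      rw [abs_mul]
      have := mul_le_mul (hw.2.1 jk.1) (hw.1 jk.2) (abs_nonneg _) hCd
      linarith)
  have h3 := withHighProb_forall_abs_avg_sub_le hWmeas hWlaw hWindep hL hfold hq
    (fun _ => hτ) hτo hcard (f := fun n j w => psi m (d n) (b n) (rhoStar n) j w ^ 2)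
    (fun n j => ((hm _).sub ((hdm n j).mul (hlm n))).pow_const 2)
    (B := (Cm + Cd * Cb * R) ^ 2) (by positivity) (by
      filter_upwards [hbd, hR] with n hn hRn j
      filter_upwards [hn] with w hw
      rw [abs_of_nonneg (sq_nonneg _)]
      refine hw.psi_sq_le hCd ?_ j
      have := mul_le_mul_of_nonneg_left hRn (mul_nonneg hCd hCb)
      linarith)
  refine (((hbdW.and h1).and h2).and h3).mono (Eventually.of_forall fun n ω hω => ?_)
  obtain ⟨⟨⟨g0, g1⟩, g2⟩, g3⟩ := hω
  exact ⟨fun i => g0 i, g1, fun j k => g2 (j, k), g3⟩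

end Rate


section Rate

variable {𝒳 𝒵 Ω : Type*} [MeasurableSpace 𝒳] [MeasurableSpace 𝒵] [MeasurableSpace Ω]
  {P : Measure Ω} [IsProbabilityMeasure P] {F : Measure (Obs 𝒳 𝒵)} [IsProbabilityMeasure F]
  {W : ℕ → Ω → Obs 𝒳 𝒵} {Γ : Submodule ℝ (𝒳 → ℝ)} {m : Obs 𝒳 𝒵 → Γ →ₗ[ℝ] ℝ}

lemma eps_pos {q : ℕ → ℕ} {epsM : ℕ → ℝ} {n : ℕ} (hn : 0 < n) (hq : 2 ≤ q n) :
    0 < eps q epsM n := by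
  have h1 : (1 : ℝ) < q n := by exact_mod_cast hq
  have h2 : (0 : ℝ) < n := by exact_mod_cast hn
  exact lt_max_of_lt_left (Real.sqrt_pos.2 (div_pos (Real.log_pos h1) h2))

lemma natCast_le_sq (s : ℕ) : (s : ℝ) ≤ (s : ℝ) ^ 2 := by
  exact_mod_cast Nat.le_self_pow two_ne_zero s

/-- The `ℓ₁` error of the penalized GMM estimator is `O(s λ)`, with probability tending to one. -/
lemma exists_withHighProb_sum_abs_le (hWmeas : ∀ i, Measurable (W i))
    (hWlaw : ∀ i, P.map (W i) = F) (hWindep : iIndepFun W P)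
    (hΓ : ∀ γ ∈ Γ, Measurable γ ∧ MemLp (fun w : Obs 𝒳 𝒵 => γ (Obs.x w)) 2 F)
    (hm : ∀ γ : Γ, Measurable fun w => m w γ) {α₀ : 𝒵 → ℝ} (hα₀ : Measurable α₀)
    (hriesz : ∀ γ : Γ, Integrable (fun w => m w γ) F ∧
      ∫ w, m w γ ∂F = ∫ w, α₀ (Obs.z w) * (γ : 𝒳 → ℝ) (Obs.x w) ∂F)
    {A₀ : ℝ} (hα₀bound : ∀ᵐ w ∂F, |α₀ (Obs.z w)| ≤ A₀)
    {p q : ℕ → ℕ} (hpq : ∀ᶠ n in atTop, p n ≤ q n) (hq : ∀ᶠ n in atTop, 2 ≤ q n)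
    {b : (n : ℕ) → Fin (p n) → 𝒵 → ℝ} (hb : ∀ n k, Measurable (b n k))
    {d : (n : ℕ) → Fin (q n) → Γ} {L : ℕ} (hL : 2 ≤ L) {fold : (n : ℕ) → Fin n → Fin L}
    (hfold : ∀ ℓ, Tendsto (fun n : ℕ => (foldSize (fold n) ℓ : ℝ) / n) atTop (𝓝 (1 / (L : ℝ))))
    {lam : ℕ → ℝ} (hlam : ∀ n, 0 < lam n)
    {rhoTilde rhoHat : (n : ℕ) → (ℓ : Fin L) → (TrainIdx (fold n) ℓ → Obs 𝒳 𝒵) → Fin (p n) → ℝ}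
    (hrhoTilde : ∀ n ℓ D,
      IsPGMM (Mhat m (d n) D) (Ghat (d n) (b n) D) 1 (lam n) (rhoTilde n ℓ D))
    (hrhoHat : ∀ n ℓ D,
      IsPGMM (Mhat m (d n) D) (Ghat (d n) (b n) D) (omegaHat m (d n) (b n) D (rhoTilde n ℓ D))
        (lam n) (rhoHat n ℓ D))
    {Cb Cd Cm : ℝ} (hCb : 0 ≤ Cb) (hCd : 0 ≤ Cd) (hCm : 0 < Cm)
    (hbd : ∀ᶠ n in atTop, ∀ᵐ w ∂F, BoundedAt m (d n) (b n) Cb Cd Cm w)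
    {epsM : ℕ → ℝ} (hepsG : Tendsto (fun n : ℕ => Real.sqrt (Real.log (q n) / n)) atTop (𝓝 0))
    {sbar : ℕ → ℕ} {rhoBar : (n : ℕ) → Fin (p n) → ℝ}
    (hsbar : ∀ᶠ n in atTop, numNonzero (rhoBar n) = sbar n) {C : ℝ} (hC : 0 ≤ C)
    (hsparse : ∀ᶠ n in atTop,
      ∫ w, (α₀ (Obs.z w) - lin (b n) (rhoBar n) (Obs.z w)) ^ 2 ∂F
        ≤ C * sbar n * eps q epsM n ^ 2)
    {A : ℝ} (hA : 0 ≤ A) (hrhoBar : ∀ᶠ n in atTop, ∑ k, |rhoBar n k| ≤ A)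
    {rhoL rhoStar : (n : ℕ) → Fin (p n) → ℝ}
    (hrhoL : ∀ᶠ n in atTop,
      IsPGMM (Mpop F m (d n)) (Gpop F (d n) (b n)) (omegaPop F m (d n) (b n) (rhoStar n))
        (eps q epsM n) (rhoL n))
    (hrhoStar : ∀ᶠ n in atTop,
      IsMinOn
        (sparseObjective
          (gram (Gpop F (d n) (b n)) (omegaPop F m (d n) (b n) (rhoStar n)))
          (rhoL n) (rhoBar n) (eps q epsM n))
        Set.univ (rhoStar n))
    {v : ℝ} (hv : 0 < v) (hnondeg : ∀ᶠ n in atTop, ∀ j,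
      v ≤ sigmaSq F m (d n) (b n) (rhoStar n) j)
    {c : ℝ} (hc : 0 < c) (hre : ∀ᶠ n in atTop,
      RestrictedEigenvalueGE
        (gram (Gpop F (d n) (b n)) (omegaPop F m (d n) (b n) (rhoStar n))) (sbar n) c)
    (hepslam : eps q epsM =o[atTop] lam)
    (hslam : Tendsto (fun n => (sbar n : ℝ) ^ 2 * lam n) atTop (𝓝 0)) :
    ∃ K : ℝ, 0 < K ∧ ∀ ℓ, WithHighProb P fun n ω =>
      ∑ k, |(rhoHat n ℓ (train (fold n) ℓ (sample W n ω)) - rhoBar n) k|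
        ≤ K * (sbar n * lam n) := by
  set KS := 16 * (v⁻¹ * (Cd ^ 2 * C)) + 32 / c
    + 4 * (8 * (v⁻¹ * (Cd ^ 2 * C)) + 16 / c) / c + 1 with hKS
  have hKS0 : 0 < KS := by positivity
  obtain ⟨η, κ, K, hη, hκ, hK, hmain⟩ := exists_l1_bound (A := A) (Cb := Cb) (Cd := Cd) (Cm := Cm)
    (c := c) (v := v) (K := Cd ^ 2 * C) (KS := KS) F m hA hCb hCd hCm hc hv (by positivity) hKS0.le
  have hs2 : ∀ n, (sbar n : ℝ) * lam n ≤ (sbar n : ℝ) ^ 2 * lam n := fun n =>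
    mul_le_mul_of_nonneg_right (natCast_le_sq _) (hlam n).le
  have hsl : Tendsto (fun n => (sbar n : ℝ) * lam n) atTop (𝓝 0) :=
    squeeze_zero (fun n => mul_nonneg (Nat.cast_nonneg _) (hlam n).le) hs2 hslam
  have hsl2 : Tendsto (fun n => (sbar n : ℝ) * lam n ^ 2) atTop (𝓝 0) := by
    have h2 : Tendsto (fun n => ((sbar n : ℝ) * lam n) ^ 2) atTop (𝓝 0) := by
      simpa using hsl.pow 2
    refine squeeze_zero (fun n => by positivity) (fun n => ?_) h2
    rw [mul_pow]
    exact mul_le_mul_of_nonneg_right (natCast_le_sq _) (sq_nonneg _)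
  have hepsle : ∀ᶠ n in atTop, eps q epsM n ≤ lam n := by
    filter_upwards [hepslam.def one_pos] with n hn
    rw [one_mul, Real.norm_of_nonneg (hlam n).le] at hn
    exact (le_abs_self _).trans hn
  have hqlam : (fun n : ℕ => Real.sqrt (Real.log (q n) / n)) =o[atTop] lam := by
    refine IsBigO.trans_isLittleO (IsBigO.of_bound 1 (Eventually.of_forall fun n => ?_)) hepslam
    rw [one_mul, Real.norm_of_nonneg (Real.sqrt_nonneg _)]
    exact (le_max_left _ _).trans (le_abs_self _)
  have hcompat : ∀ᶠ n in atTop, Compatible (fun j => (sigmaSq F m (d n) (b n) (rhoStar n) j)⁻¹)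
      (Gpop F (d n) (b n)) (rhoBar n) (sbar n) c := by
    filter_upwards [hre, hsbar] with n h1 h2
    rw [← h2] at h1 ⊢
    exact RestrictedEigenvalueGE.compatible hc.le h1
  have happrox : ∀ᶠ n in atTop, wsq 1 (Mpop F m (d n) - Gpop F (d n) (b n) *ᵥ rhoBar n)
      ≤ Cd ^ 2 * C * (sbar n * eps q epsM n ^ 2) := by
    filter_upwards [hbd, hsparse] with n h1 h2
    refine (wsq_Mpop_sub_le hΓ hα₀ hriesz hα₀bound (hb n) h1 (rhoBar n)).trans ?_
    have := mul_le_mul_of_nonneg_left h2 (sq_nonneg Cd)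
    linarith
  have hstar : ∀ᶠ n in atTop, ∑ k, |(rhoStar n - rhoBar n) k| ≤ KS * (sbar n * lam n) := by
    filter_upwards [hcompat, happrox, hrhoL, hrhoStar, hnondeg, hepsle, hq, eventually_gt_atTop 0]
      with n h1 h2 h3 h4 h5 h6 h7 h8
    have hw : ∀ j, (sigmaSq F m (d n) (b n) (rhoStar n) j)⁻¹ ≤ v⁻¹ := fun j => inv_anti₀ hv (h5 j)
    have h9 : wsq (fun j => (sigmaSq F m (d n) (b n) (rhoStar n) j)⁻¹)
        (Mpop F m (d n) - Gpop F (d n) (b n) *ᵥ rhoBar n)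
        ≤ v⁻¹ * (Cd ^ 2 * C) * (sbar n * eps q epsM n ^ 2) := by
      have h10 : (1 : ℝ) * wsq (fun j => (sigmaSq F m (d n) (b n) (rhoStar n) j)⁻¹)
          (Mpop F m (d n) - Gpop F (d n) (b n) *ᵥ rhoBar n)
          ≤ v⁻¹ * wsq 1 (Mpop F m (d n) - Gpop F (d n) (b n) *ᵥ rhoBar n) :=
        wsq_le_of_forall fun j => by
          simp only [Pi.one_apply, one_mul]
          exact mul_le_mul_of_nonneg_right (hw j) (sq_nonneg _)
      have h11 := mul_le_mul_of_nonneg_left h2 (inv_nonneg.2 hv.le)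
      linarith
    refine (sum_abs_rhoStar_sub_le (fun j => inv_nonneg.2 (hv.le.trans (h5 j))) hc
      (Nat.cast_nonneg _) (eps_pos h8 h7) (by positivity) h1 h9 h3 h4).trans ?_
    exact mul_le_mul_of_nonneg_left (mul_le_mul_of_nonneg_left h6 (Nat.cast_nonneg _)) hKS0.le
  have hstarR : ∀ᶠ n in atTop, ∑ k, |rhoStar n k| ≤ A + 1 := by
    have h1 : Tendsto (fun n => KS * ((sbar n : ℝ) * lam n)) atTop (𝓝 0) := by
      simpa using hsl.const_mul KS
    filter_upwards [hstar, hrhoBar, h1.eventually (gt_mem_nhds one_pos)] with n h2 h3 h4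
    linarith [sum_abs_le_add (rhoStar n) (rhoBar n)]
  refine ⟨K, hK, fun ℓ => ?_⟩
  have hgood := withHighProb_goodSample hWmeas hWlaw hWindep (fun γ hγ => (hΓ γ hγ).1) hm hpq hq hb
    (d := d) hL (hfold ℓ) hlam hqlam hepsG hCb hCd hCm hbd (rhoStar := rhoStar)
    (by linarith : 0 ≤ A + 1) hstarR hη (by positivity : 0 < v / 4)
  refine hgood.mono ?_
  filter_upwards [hcompat, happrox, hnondeg, hepsle, hq, eventually_gt_atTop 0, hstar, hrhoBar,
    hsl.eventually (gt_mem_nhds hκ), hsl2.eventually (gt_mem_nhds hκ)]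
    with n h1 h2 h3 h4 h5 h6 h7 h8 h9 h10 ω hω
  refine hmain (d n) (b n) (sbar n) (lam n) (rhoBar n) (rhoStar n) _ _ _ (Nat.cast_nonneg _)
    (hlam n) h9.le h10.le h8 h3 h1 (h2.trans ?_) h7 hω (hrhoTilde n ℓ _) (hrhoHat n ℓ _)
  refine mul_le_mul_of_nonneg_left (mul_le_mul_of_nonneg_left ?_ (Nat.cast_nonneg _))
    (by positivity)
  exact pow_le_pow_left₀ (eps_pos h6 h5).le h4 2

end Rate

/-! ### Assembling the folds -/

section Assembly

variable {𝒳 𝒵 : Type*} {Γ : Submodule ℝ (𝒳 → ℝ)} {n L p : ℕ}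

lemma sum_fold (fold : Fin n → Fin L) (f : Fin L → Fin n → ℝ) :
    ∑ ℓ : Fin L, ∑ i ∈ Finset.univ.filter (fun i => fold i = ℓ), f ℓ i = ∑ i, f (fold i) i := by
  rw [← Finset.sum_fiberwise Finset.univ fold fun i => f (fold i) i]
  refine Finset.sum_congr rfl fun ℓ _ => Finset.sum_congr rfl fun i hi => ?_
  rw [(Finset.mem_filter.1 hi).2]

/-- The error of the cross-fitted score at the `i`-th observation. -/
noncomputable def scoreError (m : Obs 𝒳 𝒵 → Γ →ₗ[ℝ] ℝ) (γ₀ : Γ) (α₀ : 𝒵 → ℝ) (b : Fin p → 𝒵 → ℝ)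
    (fold : Fin n → Fin L) (gammaHat : (ℓ : Fin L) → (TrainIdx fold ℓ → Obs 𝒳 𝒵) → Γ)
    (rhoHat : (ℓ : Fin L) → (TrainIdx fold ℓ → Obs 𝒳 𝒵) → Fin p → ℝ) (ℓ : Fin L)
    (u : (TrainIdx fold ℓ → Obs 𝒳 𝒵) × Obs 𝒳 𝒵) : ℝ :=
  score m (gammaHat ℓ u.1) (lin b (rhoHat ℓ u.1)) u.2 - score m γ₀ α₀ u.2

variable {m : Obs 𝒳 𝒵 → Γ →ₗ[ℝ] ℝ} {γ₀ : Γ} {α₀ : 𝒵 → ℝ} {b : Fin p → 𝒵 → ℝ}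
  {fold : Fin n → Fin L} {gammaHat : (ℓ : Fin L) → (TrainIdx fold ℓ → Obs 𝒳 𝒵) → Γ}
  {rhoHat : (ℓ : Fin L) → (TrainIdx fold ℓ → Obs 𝒳 𝒵) → Fin p → ℝ} {ψ₀ : Obs 𝒳 𝒵 → ℝ} {θ₀ : ℝ}

lemma thetaHat_sub (hn : 0 < n) (hψ₀ : ∀ w, ψ₀ w = score m γ₀ α₀ w - θ₀) (D : Fin n → Obs 𝒳 𝒵) :
    thetaHat m b fold gammaHat rhoHat D - θ₀ = (n : ℝ)⁻¹ * ∑ i, (ψ₀ (D i)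
      + scoreError m γ₀ α₀ b fold gammaHat rhoHat (fold i) (train fold (fold i) D, D i)) := by
  have hn' : (n : ℝ) ≠ 0 := by exact_mod_cast hn.ne'
  have h1 : ∀ i, ψ₀ (D i)
      + scoreError m γ₀ α₀ b fold gammaHat rhoHat (fold i) (train fold (fold i) D, D i)
      = score m (gammaHat (fold i) (train fold (fold i) D))
        (lin b (rhoHat (fold i) (train fold (fold i) D))) (D i) - θ₀ := fun i => by
    rw [hψ₀, scoreError]; ring
  simp only [h1, Finset.sum_sub_distrib, Finset.sum_const, Finset.card_univ, Fintype.card_fin,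
    nsmul_eq_mul, mul_sub, inv_mul_cancel_left₀ hn']
  rw [thetaHat, sum_fold fold fun ℓ i =>
    score m (gammaHat ℓ (train fold ℓ D)) (lin b (rhoHat ℓ (train fold ℓ D))) (D i)]

lemma sqrt_mul_thetaHat_sub (hψ₀ : ∀ w, ψ₀ w = score m γ₀ α₀ w - θ₀) (D : Fin n → Obs 𝒳 𝒵) :
    Real.sqrt n * (thetaHat m b fold gammaHat rhoHat D - θ₀)
      = (Real.sqrt n)⁻¹ * ∑ i, ψ₀ (D i) + (Real.sqrt n)⁻¹ * ∑ i,
        scoreError m γ₀ α₀ b fold gammaHat rhoHat (fold i) (train fold (fold i) D, D i) := by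
  rcases Nat.eq_zero_or_pos n with rfl | hn
  · simp
  · rw [thetaHat_sub hn hψ₀, ← mul_add, ← Finset.sum_add_distrib, ← mul_assoc]
    have hs : Real.sqrt n ≠ 0 := (Real.sqrt_pos.2 (by exact_mod_cast hn)).ne'
    have h2 : Real.sqrt n * (n : ℝ)⁻¹ = (Real.sqrt n)⁻¹ := by
      rw [← div_eq_mul_inv, Real.sqrt_div_self]
    rw [h2]

lemma varHat_eq (hψ₀ : ∀ w, ψ₀ w = score m γ₀ α₀ w - θ₀) (D : Fin n → Obs 𝒳 𝒵) :
    varHat m b fold gammaHat rhoHat D = (n : ℝ)⁻¹ * ∑ i, (ψ₀ (D i)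
      + scoreError m γ₀ α₀ b fold gammaHat rhoHat (fold i) (train fold (fold i) D, D i)
      - (n : ℝ)⁻¹ * ∑ k, (ψ₀ (D k)
        + scoreError m γ₀ α₀ b fold gammaHat rhoHat (fold k) (train fold (fold k) D, D k))) ^ 2 := by
  rcases Nat.eq_zero_or_pos n with rfl | hn
  · simp [varHat]
  · rw [← thetaHat_sub hn hψ₀, varHat, sum_fold fold fun ℓ i =>
      (score m (gammaHat ℓ (train fold ℓ D)) (lin b (rhoHat ℓ (train fold ℓ D))) (D i)
        - thetaHat m b fold gammaHat rhoHat D) ^ 2]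
    congr 1
    refine Finset.sum_congr rfl fun i _ => ?_
    rw [hψ₀, scoreError]
    ring

lemma measurable_scoreError [MeasurableSpace 𝒳] [MeasurableSpace 𝒵]
    (hm : ∀ γ : Γ, Measurable fun w => m w γ) (hγ₀ : Measurable (γ₀ : 𝒳 → ℝ)) (hα₀ : Measurable α₀)
    (hb : ∀ k, Measurable (b k)) {ℓ : Fin L} (hrho : Measurable (rhoHat ℓ))
    (hgamma : Measurable
      fun u : (TrainIdx fold ℓ → Obs 𝒳 𝒵) × 𝒳 => (gammaHat ℓ u.1 : 𝒳 → ℝ) u.2)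
    (hmgamma : Measurable
      fun u : (TrainIdx fold ℓ → Obs 𝒳 𝒵) × Obs 𝒳 𝒵 => m u.2 (gammaHat ℓ u.1)) :
    Measurable (scoreError m γ₀ α₀ b fold gammaHat rhoHat ℓ) := by
  have hx : Measurable fun u : (TrainIdx fold ℓ → Obs 𝒳 𝒵) × Obs 𝒳 𝒵 =>
      (gammaHat ℓ u.1 : 𝒳 → ℝ) (Obs.x u.2) :=
    hgamma.comp (measurable_fst.prodMk (measurable_obs_x.comp measurable_snd))
  have hl : Measurable fun u : (TrainIdx fold ℓ → Obs 𝒳 𝒵) × Obs 𝒳 𝒵 =>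
      lin b (rhoHat ℓ u.1) (Obs.z u.2) :=
    Finset.measurable_sum _ fun k _ => ((hb k).comp (measurable_obs_z.comp measurable_snd)).mul
      ((measurable_pi_apply k).comp (hrho.comp measurable_fst))
  have h0 : Measurable (score m γ₀ α₀) := (hm γ₀).add
    ((hα₀.comp measurable_obs_z).mul (measurable_obs_y.sub (hγ₀.comp measurable_obs_x)))
  exact (hmgamma.add (hl.mul ((measurable_obs_y.comp measurable_snd).sub hx))).sub
    (h0.comp measurable_snd)

end Assembly


/-! ### The score at the true parameters -/

section TrueScore

variable {𝒳 𝒵 : Type*} [MeasurableSpace 𝒳] [MeasurableSpace 𝒵] {F : Measure (Obs 𝒳 𝒵)}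
  {Γ : Submodule ℝ (𝒳 → ℝ)} {m : Obs 𝒳 𝒵 → Γ →ₗ[ℝ] ℝ} {γ₀ : Γ}
  {α₀ : 𝒵 → ℝ} {A₀ : ℝ}

lemma measurable_residual (hγ₀ : Measurable (γ₀ : 𝒳 → ℝ)) :
    Measurable fun w : Obs 𝒳 𝒵 => Obs.y w - (γ₀ : 𝒳 → ℝ) (Obs.x w) :=
  measurable_obs_y.sub (hγ₀.comp measurable_obs_x)

lemma memLp_residual (hγ₀ : Measurable (γ₀ : 𝒳 → ℝ))
    (hresint : Integrable (fun w => (Obs.y w - (γ₀ : 𝒳 → ℝ) (Obs.x w)) ^ 2) F) :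
    MemLp (fun w => Obs.y w - (γ₀ : 𝒳 → ℝ) (Obs.x w)) 2 F :=
  (memLp_two_iff_integrable_sq (measurable_residual hγ₀).aestronglyMeasurable).2 hresint

lemma memLp_score (hm : ∀ γ : Γ, Measurable fun w => m w γ) (hγ₀ : Measurable (γ₀ : 𝒳 → ℝ))
    (hα₀ : Measurable α₀) (hα₀bound : ∀ᵐ w ∂F, |α₀ (Obs.z w)| ≤ A₀)
    (hresint : Integrable (fun w => (Obs.y w - (γ₀ : 𝒳 → ℝ) (Obs.x w)) ^ 2) F)
    (hm2 : Integrable (fun w => m w γ₀ ^ 2) F) : MemLp (score m γ₀ α₀) 2 F := by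
  have h1 : MemLp (fun w => m w γ₀) 2 F :=
    (memLp_two_iff_integrable_sq (hm γ₀).aestronglyMeasurable).2 hm2
  have hmeas : Measurable fun w : Obs 𝒳 𝒵 =>
      α₀ (Obs.z w) * (Obs.y w - (γ₀ : 𝒳 → ℝ) (Obs.x w)) :=
    (hα₀.comp measurable_obs_z).mul (measurable_residual hγ₀)
  have h2 : MemLp (fun w : Obs 𝒳 𝒵 =>
      α₀ (Obs.z w) * (Obs.y w - (γ₀ : 𝒳 → ℝ) (Obs.x w))) 2 F := by
    refine (memLp_two_iff_integrable_sq hmeas.aestronglyMeasurable).2 ?_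
    have h3 := integrable_bdd_mul hα₀ hα₀bound (integrable_bdd_mul hα₀ hα₀bound hresint)
    exact h3.congr (ae_of_all _ fun w => by ring)
  exact h1.add h2

lemma integral_score_sub_eq_zero [IsProbabilityMeasure F] (hγ₀ : Measurable (γ₀ : 𝒳 → ℝ))
    (hα₀ : Measurable α₀) (hα₀bound : ∀ᵐ w ∂F, |α₀ (Obs.z w)| ≤ A₀)
    (hresint : Integrable (fun w => (Obs.y w - (γ₀ : 𝒳 → ℝ) (Obs.x w)) ^ 2) F)
    (hexog : F[fun w => Obs.y w - (γ₀ : 𝒳 → ℝ) (Obs.x w) | sigmaZ 𝒳 𝒵] =ᵐ[F] 0)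
    (hmint : Integrable (fun w => m w γ₀) F) :
    ∫ w, (score m γ₀ α₀ w - ∫ w, m w γ₀ ∂F) ∂F = 0 := by
  have hres := (memLp_residual hγ₀ hresint).integrable one_le_two
  have h2 := integrable_bdd_mul hα₀ hα₀bound hres
  have hz : ∫ w, α₀ (Obs.z w) * (Obs.y w - (γ₀ : 𝒳 → ℝ) (Obs.x w)) ∂F = 0 := by
    rw [integral_mul_condExp_sigmaZ hα₀ hα₀bound hres]
    refine integral_eq_zero_of_ae ?_
    filter_upwards [hexog] with w hw
    simp [hw]
  have h3 : Integrable (score m γ₀ α₀) F := hmint.add h2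
  rw [integral_sub h3 (integrable_const _)]
  simp only [score]
  rw [integral_add hmint h2, hz]
  simp

end TrueScore

/-! ### Limit theory of the cross-fitted estimator -/

section CrossFitLimit

variable {𝒳 𝒵 Ω : Type*} [MeasurableSpace 𝒳] [MeasurableSpace 𝒵] [MeasurableSpace Ω]
  {P : Measure Ω} [IsProbabilityMeasure P] {F : Measure (Obs 𝒳 𝒵)} [IsProbabilityMeasure F]
  {W : ℕ → Ω → Obs 𝒳 𝒵} {Γ : Submodule ℝ (𝒳 → ℝ)} {m : Obs 𝒳 𝒵 → Γ →ₗ[ℝ] ℝ} {γ₀ : Γ}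
  {α₀ : 𝒵 → ℝ}

/-- Asymptotic normality and consistency of the variance estimator, as soon as the error of the
cross-fitted score has a vanishing conditional second moment, and a conditional mean of smaller
order than `n^{-1/2}`. -/
theorem limit_of_scoreError (hWmeas : ∀ i, Measurable (W i)) (hWlaw : ∀ i, P.map (W i) = F)
    (hWindep : iIndepFun W P) {L : ℕ} (hL : 0 < L) {p : ℕ → ℕ}
    {b : (n : ℕ) → Fin (p n) → 𝒵 → ℝ} {fold : (n : ℕ) → Fin n → Fin L}
    {rhoHat : (n : ℕ) → (ℓ : Fin L) → (TrainIdx (fold n) ℓ → Obs 𝒳 𝒵) → Fin (p n) → ℝ}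
    {gammaHat : (n : ℕ) → (ℓ : Fin L) → (TrainIdx (fold n) ℓ → Obs 𝒳 𝒵) → Γ} {θ₀ : ℝ}
    {ψ₀ : Obs 𝒳 𝒵 → ℝ} (hψ₀ : ∀ w, ψ₀ w = score m γ₀ α₀ w - θ₀) (hψm : Measurable ψ₀)
    (hψ2 : MemLp ψ₀ 2 F) (hψint : ∫ w, ψ₀ w ∂F = 0)
    (hEm : ∀ n ℓ, Measurable (scoreError m γ₀ α₀ (b n) (fold n) (gammaHat n) (rhoHat n) ℓ))
    (hsq : ∀ ℓ, ∀ η : ℝ, 0 < η → WithHighProb P fun n ω =>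
      ∫⁻ w, ENNReal.ofReal (scoreError m γ₀ α₀ (b n) (fold n) (gammaHat n) (rhoHat n) ℓ
        (train (fold n) ℓ (sample W n ω), w) ^ 2) ∂F ≤ ENNReal.ofReal η)
    (hmean : ∀ ℓ, ∀ η : ℝ, 0 < η → WithHighProb P fun n ω =>
      Real.sqrt n * |∫ w, scoreError m γ₀ α₀ (b n) (fold n) (gammaHat n) (rhoHat n) ℓ
        (train (fold n) ℓ (sample W n ω), w) ∂F| ≤ η) :
    TendstoInDistribution
      (fun (n : ℕ) ω => Real.sqrt n *
        (thetaHat m (b n) (fold n) (gammaHat n) (rhoHat n) (sample W n ω) - θ₀))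
      atTop id (fun _ => P) (gaussianReal 0 (∫ w, ψ₀ w ^ 2 ∂F).toNNReal) ∧
    TendstoInMeasure P
      (fun (n : ℕ) ω => varHat m (b n) (fold n) (gammaHat n) (rhoHat n) (sample W n ω))
      atTop (fun _ => ∫ w, ψ₀ w ^ 2 ∂F) := by
  have hL0 : (0 : ℝ) < L := by exact_mod_cast hL
  have : Nonempty (Fin L) := ⟨⟨0, hL⟩⟩
  set E : (n : ℕ) → Ω → Fin n → ℝ := fun n ω i =>
    scoreError m γ₀ α₀ (b n) (fold n) (gammaHat n) (rhoHat n) (fold n i)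
      (train (fold n) (fold n i) (sample W n ω), W i ω) with hE
  -- summing the contributions of the `L` folds
  have hEsum : ∀ ε : ℝ, 0 < ε → WithHighProb P fun n ω =>
      |(Real.sqrt n)⁻¹ * ∑ i, E n ω i| < ε := fun ε hε => by
    refine (WithHighProb.forall fun ℓ => withHighProb_abs_sum_lt hWmeas hWlaw hWindep
      (fun n => hEm n ℓ) (hsq ℓ) (hmean ℓ) (by positivity : 0 < ε / L)).mono
      (Eventually.of_forall fun n ω hω => ?_)
    rw [hE, ← sum_fold (fold n) fun ℓ i =>
      scoreError m γ₀ α₀ (b n) (fold n) (gammaHat n) (rhoHat n) ℓ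
        (train (fold n) ℓ (sample W n ω), W i ω), Finset.mul_sum]
    refine (Finset.abs_sum_le_sum_abs _ _).trans_lt ?_
    calc _ < ∑ _ℓ : Fin L, ε / L :=
          Finset.sum_lt_sum_of_nonempty Finset.univ_nonempty fun ℓ _ => hω ℓ
      _ = ε := by simp; field_simp
  have hEsq : ∀ ε : ℝ, 0 < ε → WithHighProb P fun n ω =>
      (n : ℝ)⁻¹ * ∑ i, E n ω i ^ 2 < ε := fun ε hε => by
    refine (WithHighProb.forall fun ℓ => withHighProb_avg_sq_lt hWmeas hWlaw hWindep
      (fun n => hEm n ℓ) (hsq ℓ) (by positivity : 0 < ε / L)).mono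
      (Eventually.of_forall fun n ω hω => ?_)
    rw [hE, ← sum_fold (fold n) fun ℓ i =>
      scoreError m γ₀ α₀ (b n) (fold n) (gammaHat n) (rhoHat n) ℓ
        (train (fold n) ℓ (sample W n ω), W i ω) ^ 2, Finset.mul_sum]
    calc _ < ∑ _ℓ : Fin L, ε / L :=
          Finset.sum_lt_sum_of_nonempty Finset.univ_nonempty fun ℓ _ => hω ℓ
      _ = ε := by simp; field_simp
  refine ⟨?_, ?_⟩
  · have hRm : ∀ n : ℕ, Measurable fun ω => (Real.sqrt n)⁻¹ * ∑ i, E n ω i := fun n => by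
      refine Measurable.const_mul (Finset.measurable_sum _ fun i _ => ?_) _
      exact (hEm n (fold n i)).comp
        ((measurable_pi_lambda _ fun k => hWmeas _).prodMk (hWmeas _))
    refine (tendstoInDistribution_add_remainder hWmeas hWlaw hWindep hψm hψ2 hψint hRm hEsum).congr
      (fun n => ae_of_all _ fun ω => ?_) (ae_of_all _ fun _ => rfl)
    exact (sqrt_mul_thetaHat_sub hψ₀ (sample W n ω)).symm
  · have h := tendstoInMeasure_empirical_variance hWmeas hWlaw hWindep hψm hψ2 hψint hEsq
    refine h.congr (fun n => ae_of_all _ fun ω => ?_) (ae_of_all _ fun _ => rfl)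
    exact (varHat_eq hψ₀ (sample W n ω)).symm

end CrossFitLimit

end DebiasedNPIV

open DebiasedNPIV in
theorem mainTheorem4
    -- the i.i.d. data `W i = (Y i, X i, Z i)` with law `F`
    {𝒳 𝒵 Ω : Type*} [MeasurableSpace 𝒳] [MeasurableSpace 𝒵] [MeasurableSpace Ω]
    (P : Measure Ω) [IsProbabilityMeasure P]
    (F : Measure (Obs 𝒳 𝒵)) [IsProbabilityMeasure F]
    (W : ℕ → Ω → Obs 𝒳 𝒵)
    (hWmeas : ∀ i, Measurable (W i)) (hWlaw : ∀ i, P.map (W i) = F) (hWindep : iIndepFun W P)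
    -- the linear space of square integrable functions on which the functional is defined
    (Γ : Submodule ℝ (𝒳 → ℝ))
    (hΓ : ∀ γ ∈ Γ, Measurable γ ∧ MemLp (fun w : Obs 𝒳 𝒵 => γ (Obs.x w)) 2 F)
    (m : Obs 𝒳 𝒵 → Γ →ₗ[ℝ] ℝ) (hm : ∀ γ : Γ, Measurable fun w => m w γ)
    -- the structural function, the Riesz representer and the parameter
    (γ₀ : Γ) (α₀ : 𝒵 → ℝ) (hα₀ : Measurable α₀)
    (hexog : F[fun w => Obs.y w - (γ₀ : 𝒳 → ℝ) (Obs.x w) | sigmaZ 𝒳 𝒵] =ᵐ[F] 0)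
    (hriesz : ∀ γ : Γ, Integrable (fun w => m w γ) F ∧
      ∫ w, m w γ ∂F = ∫ w, α₀ (Obs.z w) * (γ : 𝒳 → ℝ) (Obs.x w) ∂F)
    (θ₀ : ℝ) (hθ₀ : θ₀ = ∫ w, m w γ₀ ∂F)
    -- the dictionaries
    (p q : ℕ → ℕ) (hpq : ∀ᶠ n in atTop, p n ≤ q n) (hq : ∀ᶠ n in atTop, 2 ≤ q n)
    (b : (n : ℕ) → Fin (p n) → 𝒵 → ℝ) (hb : ∀ n k, Measurable (b n k))
    (d : (n : ℕ) → Fin (q n) → Γ)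
    -- the folds
    (L : ℕ) (hL : 2 ≤ L) (fold : (n : ℕ) → Fin n → Fin L)
    (hfold : ∀ ℓ, Tendsto (fun n : ℕ => (foldSize (fold n) ℓ : ℝ) / n) atTop (𝓝 (1 / (L : ℝ))))
    -- the penalty and the penalized GMM estimators: identity weights, then diagonal weights
    (lam : ℕ → ℝ) (hlam : ∀ n, 0 < lam n)
    (rhoTilde rhoHat : (n : ℕ) → (ℓ : Fin L) → (TrainIdx (fold n) ℓ → Obs 𝒳 𝒵) → Fin (p n) → ℝ)
    (hrhoTilde_meas : ∀ n ℓ, Measurable (rhoTilde n ℓ))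
    (hrhoHat_meas : ∀ n ℓ, Measurable (rhoHat n ℓ))
    (hrhoTilde : ∀ n ℓ D,
      IsPGMM (Mhat m (d n) D) (Ghat (d n) (b n) D) 1 (lam n) (rhoTilde n ℓ D))
    (hrhoHat : ∀ n ℓ D,
      IsPGMM (Mhat m (d n) D) (Ghat (d n) (b n) D) (omegaHat m (d n) (b n) D (rhoTilde n ℓ D))
        (lam n) (rhoHat n ℓ D))
    -- the first-step estimators of the structural function
    (gammaHat : (n : ℕ) → (ℓ : Fin L) → (TrainIdx (fold n) ℓ → Obs 𝒳 𝒵) → Γ)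
    (hgammaHat_meas : ∀ n ℓ, Measurable
      fun u : (TrainIdx (fold n) ℓ → Obs 𝒳 𝒵) × 𝒳 => (gammaHat n ℓ u.1 : 𝒳 → ℝ) u.2)
    (hmgammaHat_meas : ∀ n ℓ, Measurable
      fun u : (TrainIdx (fold n) ℓ → Obs 𝒳 𝒵) × Obs 𝒳 𝒵 => m u.2 (gammaHat n ℓ u.1))
    -- bounded dictionaries
    (hbound : ∃ Cb Cd : ℝ, ∀ᶠ n in atTop, ∀ᵐ w ∂F,
      (∀ k, |b n k (Obs.z w)| ≤ Cb) ∧ ∀ j, |(d n j : 𝒳 → ℝ) (Obs.x w)| ≤ Cd)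
    -- the rates of the sample moments
    (epsM : ℕ → ℝ) (hepsM : Tendsto epsM atTop (𝓝 0))
    (hM : IsBigOP P (fun n ω => ‖Mhat m (d n) (sample W n ω) - Mpop F m (d n)‖ₑ) epsM)
    (hepsG : Tendsto (fun n : ℕ => Real.sqrt (Real.log (q n) / n)) atTop (𝓝 0))
    -- sparse approximation of the Riesz representer
    (sbar : ℕ → ℕ) (rhoBar : (n : ℕ) → Fin (p n) → ℝ)
    (hsbar : ∀ᶠ n in atTop, numNonzero (rhoBar n) = sbar n)
    (hsparse : ∃ C : ℝ, 1 < C ∧ ∀ᶠ n in atTop,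
      ∫ w, (α₀ (Obs.z w) - lin (b n) (rhoBar n) (Obs.z w)) ^ 2 ∂F
        ≤ C * sbar n * eps q epsM n ^ 2)
    (hrhoBar : ∃ A : ℝ, ∀ᶠ n in atTop, ∑ k, |rhoBar n k| ≤ A)
    -- the population coefficients `ρ_L` and `ρ_⋆`, for the diagonal weight matrix at `ρ_⋆`
    (rhoL rhoStar : (n : ℕ) → Fin (p n) → ℝ)
    (hrhoL : ∀ᶠ n in atTop,
      IsPGMM (Mpop F m (d n)) (Gpop F (d n) (b n)) (omegaPop F m (d n) (b n) (rhoStar n))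
        (eps q epsM n) (rhoL n))
    (hrhoStar : ∀ᶠ n in atTop,
      IsMinOn
        (sparseObjective
          (gram (Gpop F (d n) (b n)) (omegaPop F m (d n) (b n) (rhoStar n)))
          (rhoL n) (rhoBar n) (eps q epsM n))
        Set.univ (rhoStar n))
    -- non-degenerate population moments
    (hnondeg : ∃ v : ℝ, 0 < v ∧ ∀ᶠ n in atTop, ∀ j,
      v ≤ sigmaSq F m (d n) (b n) (rhoStar n) j)
    -- largest eigenvalue and restricted eigenvalue
    (hmaxeig : ∃ C : ℝ, ∀ᶠ n in atTop, ∀ μ : ℝ,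
      Module.End.HasEigenvalue
        (Matrix.toLin'
          (gram (Gpop F (d n) (b n)) (omegaPop F m (d n) (b n) (rhoStar n)))) μ → μ ≤ C)
    (hre : ∃ c : ℝ, 0 < c ∧ ∀ᶠ n in atTop,
      RestrictedEigenvalueGE
        (gram (Gpop F (d n) (b n)) (omegaPop F m (d n) (b n) (rhoStar n))) (sbar n) c)
    -- bounded functionals of the dictionary
    (hmbound : ∃ C : ℝ, ∀ᶠ n in atTop, ∀ᵐ w ∂F, ∀ j, |m w (d n j)| ≤ C)
    -- primitive conditions
    (hα₀bound : ∃ C : ℝ, ∀ᵐ w ∂F, |α₀ (Obs.z w)| ≤ C)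
    (hresint : Integrable (fun w => (Obs.y w - (γ₀ : 𝒳 → ℝ) (Obs.x w)) ^ 2) F)
    (hresbound : ∃ C : ℝ, ∀ᵐ w ∂F,
      (F[fun w => (Obs.y w - (γ₀ : 𝒳 → ℝ) (Obs.x w)) ^ 2 | sigmaZ 𝒳 𝒵]) w ≤ C)
    (hm2 : Integrable (fun w => m w γ₀ ^ 2) F)
    -- mean square consistency of the first step
    (hmcons : ∀ ℓ, TendstoZeroInProb P fun n ω =>
      ∫⁻ w, ENNReal.ofReal
        ((m w (gammaHat n ℓ (train (fold n) ℓ (sample W n ω))) - m w γ₀) ^ 2) ∂F)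
    (hγcons : ∀ ℓ, TendstoZeroInProb P fun n ω =>
      normX F ((gammaHat n ℓ (train (fold n) ℓ (sample W n ω)) - γ₀ : Γ) : 𝒳 → ℝ))
    -- the rate of the first step in the projected norm
    (kappaγ : ℕ → ℝ) (hkappaγ : Tendsto kappaγ atTop (𝓝 0))
    (hγrate : ∀ ℓ, IsBigOP P (fun n ω =>
      projNorm F ((gammaHat n ℓ (train (fold n) ℓ (sample W n ω)) - γ₀ : Γ) : 𝒳 → ℝ)) kappaγ)
    -- the rate conditions
    (hrates : Tendsto (fun n : ℕ => Real.sqrt n * (sbar n * lam n) * kappaγ n) atTop (𝓝 0))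
    (hepslam : eps q epsM =o[atTop] lam)
    (hslam : Tendsto (fun n => (sbar n : ℝ) ^ 2 * lam n) atTop (𝓝 0))
    (ψ₀ : Obs 𝒳 𝒵 → ℝ) (hψ₀ : ∀ w, ψ₀ w = score m γ₀ α₀ w - θ₀)
    (V : ℝ) (hV : V = ∫ w, ψ₀ w ^ 2 ∂F) :
    Integrable (fun w => ψ₀ w ^ 2) F ∧
    TendstoInDistribution
      (fun (n : ℕ) ω => Real.sqrt n *
        (thetaHat m (b n) (fold n) (gammaHat n) (rhoHat n) (sample W n ω) - θ₀))
      atTop id (fun _ => P) (gaussianReal 0 V.toNNReal) ∧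
    TendstoInMeasure P
      (fun (n : ℕ) ω => varHat m (b n) (fold n) (gammaHat n) (rhoHat n) (sample W n ω))
      atTop (fun _ => V) := by
  have hγ₀m : Measurable (γ₀ : 𝒳 → ℝ) := (hΓ _ γ₀.2).1
  obtain ⟨A₀, hA₀⟩ := hα₀bound
  obtain ⟨Cres, hCres⟩ := hresbound
  obtain ⟨Cb, Cd, hbC⟩ := hbound
  obtain ⟨Cm, hCm⟩ := hmbound
  obtain ⟨Cs, hCs1, hCs⟩ := hsparse
  obtain ⟨A, hA⟩ := hrhoBar
  obtain ⟨v, hv, hvσ⟩ := hnondeg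
  obtain ⟨c, hc, hcre⟩ := hre
  have hres := memLp_residual hγ₀m hresint
  have hbd : ∀ᶠ n in atTop, ∀ᵐ w ∂F, BoundedAt m (d n) (b n) |Cb| |Cd| (|Cm| + 1) w := by
    filter_upwards [hbC, hCm] with n h1 h2
    filter_upwards [h1, h2] with w g1 g2
    exact ⟨fun k => (g1.1 k).trans (le_abs_self _), fun j => (g1.2 j).trans (le_abs_self _),
      fun j => (g2 j).trans ((le_abs_self _).trans (by linarith))⟩
  have hA' : ∀ᶠ n in atTop, ∑ k, |rhoBar n k| ≤ |A| := by
    filter_upwards [hA] with n hn using hn.trans (le_abs_self _)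
  obtain ⟨K, hK, hrate⟩ := exists_withHighProb_sum_abs_le hWmeas hWlaw hWindep hΓ hm hα₀ hriesz hA₀
    hpq hq hb hL hfold hlam hrhoTilde hrhoHat (abs_nonneg Cb) (abs_nonneg Cd)
    (by positivity : 0 < |Cm| + 1) hbd hepsG hsbar (by linarith : 0 ≤ Cs) hCs (abs_nonneg A) hA'
    hrhoL hrhoStar hv hvσ hc hcre hepslam hslam
  -- the mean square rate of the estimated Riesz representer
  set K' := Real.sqrt (2 * (|Cb| * K) ^ 2 + 2 * Cs) with hK'
  set r : ℕ → ℝ := fun n => K' * (sbar n * lam n) with hr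
  have hK'0 : 0 ≤ K' := Real.sqrt_nonneg _
  have hr0 : ∀ n, 0 ≤ r n := fun n =>
    mul_nonneg hK'0 (mul_nonneg (Nat.cast_nonneg _) (hlam n).le)
  have hsl : Tendsto (fun n => (sbar n : ℝ) * lam n) atTop (𝓝 0) :=
    squeeze_zero (fun n => mul_nonneg (Nat.cast_nonneg _) (hlam n).le)
      (fun n => mul_le_mul_of_nonneg_right (natCast_le_sq _) (hlam n).le) hslam
  have hr_lim : Tendsto r atTop (𝓝 0) := by simpa using hsl.const_mul K'
  set Aα := |Cb| * (|A| + 1) with hAα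
  have hα : ∀ ℓ, WithHighProb P fun n ω =>
      (∀ᵐ w ∂F, |lin (b n) (rhoHat n ℓ (train (fold n) ℓ (sample W n ω))) (Obs.z w)| ≤ Aα) ∧
      (∀ᵐ w ∂F, |lin (b n) (rhoHat n ℓ (train (fold n) ℓ (sample W n ω))) (Obs.z w)
        - α₀ (Obs.z w)| ≤ Aα + A₀) ∧
      ∫ w, (lin (b n) (rhoHat n ℓ (train (fold n) ℓ (sample W n ω))) (Obs.z w)
        - α₀ (Obs.z w)) ^ 2 ∂F ≤ r n ^ 2 := fun ℓ => by
    refine (hrate ℓ).mono ?_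
    have h1 : Tendsto (fun n => K * ((sbar n : ℝ) * lam n)) atTop (𝓝 0) := by
      simpa using hsl.const_mul K
    filter_upwards [hbd, hA', hCs, h1.eventually (gt_mem_nhds one_pos), hepslam.def one_pos, hq,
      eventually_gt_atTop 0] with n g1 g2 g3 g4 g5 g6 g7 ω hω
    have hCb : ∀ᵐ w ∂F, ∀ k, |b n k (Obs.z w)| ≤ |Cb| := by
      filter_upwards [g1] with w hw using hw.1
    set ρ := rhoHat n ℓ (train (fold n) ℓ (sample W n ω)) with hρ
    have h2 : ∑ k, |ρ k| ≤ |A| + 1 := by linarith [sum_abs_le_add ρ (rhoBar n)]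
    have h3 : ∀ᵐ w ∂F, |lin (b n) ρ (Obs.z w)| ≤ Aα := by
      filter_upwards [hCb] with w hw
      exact (abs_lin_le hw ρ).trans (mul_le_mul_of_nonneg_left h2 (abs_nonneg _))
    refine ⟨h3, ?_, ?_⟩
    · filter_upwards [h3, hA₀] with w g8 g9
      exact (abs_sub _ _).trans (add_le_add g8 g9)
    · have h4 := integral_lin_sub_sq_le hα₀ hA₀ (hb n) hCb (abs_nonneg _) (rhoBar n) ρ hω
      have h5 : eps q epsM n ^ 2 ≤ lam n ^ 2 := by
        rw [one_mul, Real.norm_of_nonneg (hlam n).le] at g5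
        exact pow_le_pow_left₀ (eps_pos g7 g6).le ((le_abs_self _).trans g5) 2
      have h6 : (sbar n : ℝ) * eps q epsM n ^ 2 ≤ (sbar n * lam n) ^ 2 := by
        rw [mul_pow]
        exact mul_le_mul (natCast_le_sq _) h5 (sq_nonneg _) (sq_nonneg _)
      have h7 : r n ^ 2 = (2 * (|Cb| * K) ^ 2 + 2 * Cs) * (sbar n * lam n) ^ 2 := by
        rw [hr]
        simp only
        rw [mul_pow, hK', Real.sq_sqrt (by positivity)]
      have h8 := mul_le_mul_of_nonneg_left h6 (by linarith : 0 ≤ Cs)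
      rw [h7]
      calc _ ≤ _ := h4
        _ ≤ 2 * (|Cb| * (K * (sbar n * lam n))) ^ 2 + 2 * (Cs * (sbar n * lam n) ^ 2) := by
            linarith
        _ = _ := by ring
  -- the conditional second moment of the error of the score
  have hsq : ∀ ℓ, ∀ η : ℝ, 0 < η → WithHighProb P fun n ω =>
      ∫⁻ w, ENNReal.ofReal (scoreError m γ₀ α₀ (b n) (fold n) (gammaHat n) (rhoHat n) ℓ
        (train (fold n) ℓ (sample W n ω), w) ^ 2) ∂F ≤ ENNReal.ofReal η := fun ℓ η hη => by
    set δ := Real.sqrt (η / 3 / (3 * Aα ^ 2 + 1)) with hδ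
    have hδ0 : 0 < δ := Real.sqrt_pos.2 (by positivity)
    have hr2 : Tendsto (fun n => 3 * |Cres| * r n ^ 2) atTop (𝓝 0) := by
      simpa using (hr_lim.pow 2).const_mul (3 * |Cres|)
    refine (((hα ℓ).and ((hmcons ℓ).withHighProb (by positivity : 0 < η / 9))).and
      ((hγcons ℓ).withHighProb hδ0)).mono ?_
    filter_upwards [hr2.eventually (gt_mem_nhds (by positivity : 0 < η / 3))] with n hn ω hω
    obtain ⟨⟨⟨g1, g2, g3⟩, g4⟩, g5⟩ := hω
    refine (lintegral_score_sub_sq_le hΓ hm hα₀ hresint (C := |Cres|)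
      (hCres.mono fun w hw => hw.trans (le_abs_self _)) (abs_nonneg _)
      (gammaHat n ℓ (train (fold n) ℓ (sample W n ω))) (measurable_lin (hb n) _) g1 g2 g3).trans ?_
    have e1 : ENNReal.ofReal η
        = 3 * ENNReal.ofReal (η / 9) + ENNReal.ofReal (η / 3)
          + ENNReal.ofReal (3 * Aα ^ 2 + 1) * ENNReal.ofReal δ ^ 2 := by
      have h3 : (3 : ℝ≥0∞) = ENNReal.ofReal 3 := by simp
      rw [← ENNReal.ofReal_pow hδ0.le, hδ, Real.sq_sqrt (by positivity), h3,
        ← ENNReal.ofReal_mul (by norm_num), ← ENNReal.ofReal_mul (by positivity),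
        ← ENNReal.ofReal_add (by positivity) (by positivity),
        ← ENNReal.ofReal_add (by positivity) (by positivity)]
      congr 1
      field_simp
      ring
    rw [e1]
    have h4 : ENNReal.ofReal (3 * Aα ^ 2) ≤ ENNReal.ofReal (3 * Aα ^ 2 + 1) :=
      ENNReal.ofReal_le_ofReal (by linarith)
    gcongr
  -- the conditional mean of the error of the score
  have hmean : ∀ ℓ, ∀ η : ℝ, 0 < η → WithHighProb P fun n ω =>
      Real.sqrt n * |∫ w, scoreError m γ₀ α₀ (b n) (fold n) (gammaHat n) (rhoHat n) ℓ
        (train (fold n) ℓ (sample W n ω), w) ∂F| ≤ η := fun ℓ η hη => by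
    have hlim : Tendsto (fun n : ℕ => Real.sqrt n * r n * kappaγ n) atTop (𝓝 0) := by
      have h1 := hrates.const_mul K'
      rw [mul_zero] at h1
      refine h1.congr fun n => ?_
      rw [hr]; ring
    have h2 := (hγrate ℓ).withHighProb_mul_le (a := fun n : ℕ => Real.sqrt n * r n)
      (fun n => mul_nonneg (Real.sqrt_nonneg _) (hr0 n)) hlim hη
    refine ((hα ℓ).and h2).mono (Eventually.of_forall fun n ω hω => ?_)
    obtain ⟨⟨-, g2, g3⟩, g4⟩ := hω
    have h3 := enorm_integral_score_sub_le hΓ hα₀ hexog hriesz (hres.integrable one_le_two) hA₀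
      (gammaHat n ℓ (train (fold n) ℓ (sample W n ω))) (measurable_lin (hb n) _) (hr0 n) g2 g3
    rw [← ENNReal.ofReal_le_ofReal_iff hη.le, ENNReal.ofReal_mul (Real.sqrt_nonneg _),
      ← Real.enorm_eq_ofReal_abs]
    refine le_trans ?_ g4
    rw [ENNReal.ofReal_mul (Real.sqrt_nonneg _), mul_assoc]
    gcongr
    exact h3
  have hEm : ∀ n ℓ,
      Measurable (scoreError m γ₀ α₀ (b n) (fold n) (gammaHat n) (rhoHat n) ℓ) := fun n ℓ =>
    measurable_scoreError hm hγ₀m hα₀ (hb n) (hrhoHat_meas n ℓ) (hgammaHat_meas n ℓ)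
      (hmgammaHat_meas n ℓ)
  -- the score at the true parameters
  have hψfun : ψ₀ = fun w => score m γ₀ α₀ w - θ₀ := funext hψ₀
  have hψm : Measurable ψ₀ := by
    rw [hψfun]
    exact ((hm γ₀).add ((hα₀.comp measurable_obs_z).mul (measurable_residual hγ₀m))).sub_const _
  have hψ2 : MemLp ψ₀ 2 F := by
    rw [hψfun]
    exact (memLp_score hm hγ₀m hα₀ hA₀ hresint hm2).sub (memLp_const _)
  have hψint : ∫ w, ψ₀ w ∂F = 0 := by
    rw [hψfun, hθ₀]
    exact integral_score_sub_eq_zero hγ₀m hα₀ hA₀ hresint hexog (hriesz γ₀).1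
  have hlim := limit_of_scoreError hWmeas hWlaw hWindep (by omega) hψ₀ hψm hψ2 hψint hEm hsq hmean
  rw [hV]
  exact ⟨hψ2.integrable_sq, hlim⟩
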